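/- Let $E$ range over $(e_{\min},e_{\max})$ and $Q$ over $(q_{\min},q_{\max})$, and let $f_{Q|E}(q|e)$ be a jointly measurable conditional density of $Q$ given $E=e$, with mean $m(e)$ and standard deviation $\sigma(e)$; put $\sigma_{\max}=\sup_e\sigma(e)$ and define $\phi(x|e)$ by $f_{Q|E}(q|e)=\frac1{\sigma(e)}\phi\big(\frac{q-m(e)}{\sigma(e)}\big|e\big)$. For a probability density $f_E$ on $(e_{\min},e_{\max})$ let $f_Q(q)=\int f_{Q|E}(q|e)f_E(e)\,de$, let $h(f)=-\int f\log_2 f$ denote differential entropy, write $h(Q)=h(f_Q)$ and $h(Q|e)=h(f_{Q|E}(\cdot|e))$, let $I(Q;E)=\int[h(Q)-h(Q|e)]f_E(e)\,de$, and let the channel capacity $C$ be the supremum of $I(Q;E)$ over all such $f_E$. Let $\tilde f_E$ be a density that attains this supremum, $\tilde f_Q$ the corresponding density of $Q$, $\tilde F_E,\tilde F_Q$ their distribution functions, and $E^*=\tilde F_E(E)$, $Q^*=\tilde F_Q(Q)$. For $q^*,e^*\in(0,1)$ the conditional density of $Q^*$ given $E^*$ is $$f_{Q^*|E^*}(q^*|e^*)=\frac{f_{Q|E}\big(\tilde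 F_Q^{-1}(q^*)\,\big|\,\tilde F_E^{-1}(e^*)\big)}{\tilde f_Q\big(\tilde F_Q^{-1}(q^*)\big)},$$ and $f_{E^*|Q^*}(e^*|q^*)$ is the conditional density obtained from it by Bayes' rule when $E^*$ is uniform on $(0,1)$. Let $[a,b]\subset(e_{\min},e_{\max})$ with $a<b$, and let $K>0$, $L\ge0$. Say that the slow-change regime holds on $[a,b]$ with constants $K,L$ if: (i) $m$ is non-decreasing on $(e_{\min},e_{\max})$, and for all $e\in(e_{\min},e_{\max})$ and $x\in\mathbb R$ one has $\sigma_{\max}\le K\sigma(e)$ and $\phi(x|e)\le K(1+|x|)^{-3}$; (ii) $m$ and $\sigma$ are differentiable at every point of $[a,b]$, with $m'(e)\ge 1/K$ and $|\sigma'(e)|\le L\sigma(e)$ there; (iii) for all $e,e'\in[a,b]$: $m'(e)\le e^{L|e-e'|}m'(e')$, $\tilde f_E(e)\le e^{L|e-e'|}\tilde f_E(e')$, and $\phi(x|e)\le e^{L|e-e'|}\phi(x|e')$ for every $x$ such that $m(e)+\sigma(e)x$ and $m(e')+\sigma(e')x$ both lie in $(q_{\min},q_{\max})$. Then for every $\delta>0$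 there are $A,\sigma_0>0$, depending only on $e_{\min},e_{\max},q_{\min},q_{\max},a,b,K,L,\delta$, such that for every $f_{Q|E}$ and $\tilde f_E$ as above for which the slow-change regime holds on $[a,b]$ with constants $K,L$ and for which $\sigma_{\max}\le\sigma_0$, and for all $q^*,q^{*\prime}\in[\tilde F_E(a)+\delta,\tilde F_E(b)-\delta]$: 1. the mean of $E^*$ given $Q^*=q^*$, when $E^*$ is uniform, is $q^*+O(\sigma_{\max})$: $\big|\int_0^1 e^* f_{E^*|Q^*}(e^*|q^*)\,de^*-q^*\big|\le A\,\sigma_{\max}$; 2. the entropy $h(E^*|q^*)$ of $f_{E^*|Q^*}(\cdot|q^*)$ is minus the channel capacity up to $O(\sigma_{\max})$: $|h(E^*|q^*)-(-C)|\le A\,\sigma_{\max}$; 3. $h(E^*|q^*)$ is the same for all these $q^*$ up to $O(\sigma_{\max})$: $|h(E^*|q^*)-h(E^*|q^{*\prime})|\le A\,\sigma_{\max}$. -/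

import Mathlib

open MeasureTheory Set

namespace EnvChannel

noncomputable section

/-- Differential entropy, in bits, of a probability density on the line. -/
def entropy (f : ℝ → ℝ) : ℝ := -∫ x, f x * Real.logb 2 (f x)

/-- Distribution function of a density. -/
def cdf (f : ℝ → ℝ) (x : ℝ) : ℝ := ∫ t in Iic x, f t

/-- Inverse of the distribution function of a density. -/
def quantile (f : ℝ → ℝ) (u : ℝ) : ℝ := sInf {x | u ≤ cdf f x}

/-- The uniform density on `(0, 1)`. -/
def uniformDensity : ℝ → ℝ := (Ioo (0 : ℝ) 1).indicator 1

/-- `W q e` is the conditional density `f_{Q|E}(q|e)` of `Q` at `q` given `E = e`, where `E` ranges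
over `(eMin, eMax)` and `Q` over `(qMin, qMax)`. -/
structure IsChannel (eMin eMax qMin qMax : ℝ) (W : ℝ → ℝ → ℝ) : Prop where
  measurable : Measurable (Function.uncurry W)
  nonneg : ∀ e ∈ Ioo eMin eMax, ∀ q, 0 ≤ W q e
  support : ∀ e ∈ Ioo eMin eMax, ∀ q, q ∉ Ioo qMin qMax → W q e = 0
  integral_eq_one : ∀ e ∈ Ioo eMin eMax, ∫ q, W q e = 1

/-- `p` is a probability density of `E` on `(eMin, eMax)`. -/
structure IsInputDensity (eMin eMax : ℝ) (p : ℝ → ℝ) : Prop where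
  measurable : Measurable p
  nonneg : ∀ e, 0 ≤ p e
  support : ∀ e, e ∉ Ioo eMin eMax → p e = 0
  integral_eq_one : ∫ e, p e = 1

/-- Density `f_Q` of `Q` when `E` has density `p`. -/
def outputDensity (W : ℝ → ℝ → ℝ) (p : ℝ → ℝ) (q : ℝ) : ℝ := ∫ e, W q e * p e

/-- Density `f_{E|Q}(e|q)` of `E` at `e` given `Q = q`, when `E` has density `p`. -/
def posterior (W : ℝ → ℝ → ℝ) (p : ℝ → ℝ) (q e : ℝ) : ℝ := W q e * p e / outputDensity W p q

/-- Mutual information: the average over `e` of `h(Q) - h(Q|e)`. -/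
def mutualInfo (W : ℝ → ℝ → ℝ) (p : ℝ → ℝ) : ℝ :=
  ∫ e, (entropy (outputDensity W p) - entropy (fun q => W q e)) * p e

/-- Channel capacity: supremum of the mutual information over all densities of `E`. -/
def capacity (eMin eMax : ℝ) (W : ℝ → ℝ → ℝ) : ℝ :=
  sSup {i | ∃ p, IsInputDensity eMin eMax p ∧ i = mutualInfo W p}

/-- `p` is a density of `E` that maximises the mutual information. -/
def IsCapacityAchieving (eMin eMax : ℝ) (W : ℝ → ℝ → ℝ) (p : ℝ → ℝ) : Prop :=
  IsInputDensity eMin eMax p ∧ ∀ p', IsInputDensity eMin eMax p' → mutualInfo W p' ≤ mutualInfo W p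

/-- `m(e)`, the mean of `Q` given `E = e`. -/
def condMean (W : ℝ → ℝ → ℝ) (e : ℝ) : ℝ := ∫ q, q * W q e

/-- `σ(e)`, the standard deviation of `Q` given `E = e`. -/
def condSD (W : ℝ → ℝ → ℝ) (e : ℝ) : ℝ := Real.sqrt (∫ q, (q - condMean W e) ^ 2 * W q e)

/-- `σ_max`, the largest of the conditional standard deviations. -/
def maxSD (eMin eMax : ℝ) (W : ℝ → ℝ → ℝ) : ℝ := sSup (condSD W '' Ioo eMin eMax)

/-- The standardised conditional density `φ(x|e)`, for which
`W q e = (1 / σ(e)) φ((q - m(e)) / σ(e) | e)`. -/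
def shape (W : ℝ → ℝ → ℝ) (x e : ℝ) : ℝ :=
  condSD W e * W (condMean W e + condSD W e * x) e

/-- The slow-change regime on `[a, b]`, with constants `K` and `L`, for a channel `W` and an
information-maximising density `p` of `E`. The first three fields concern all values of `E`: `m` is
increasing, the widths `σ(e)` are all of the order of `σ_max`, and the standardised variable is
effectively restricted to a range of order one. The others say that `m' > 0` on `[a, b]` and that
on `[a, b]` the quantities `m'`, `σ`, `φ(x|·)` and `p` have logarithmic rate of change at most `L`,
so that they change by a fraction of order `L σ_max` when `e` changes by `σ_max`. -/
structure IsSlowChange (eMin eMax qMin qMax a b K L : ℝ) (W : ℝ → ℝ → ℝ) (p : ℝ → ℝ) :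
    Prop where
  mean_mono : MonotoneOn (condMean W) (Ioo eMin eMax)
  sd_comparable : ∀ e ∈ Ioo eMin eMax, maxSD eMin eMax W ≤ K * condSD W e
  shape_le : ∀ e ∈ Ioo eMin eMax, ∀ x, shape W x e ≤ K / (1 + |x|) ^ 3
  mean_diff : ∀ e ∈ Icc a b, DifferentiableAt ℝ (condMean W) e
  mean_deriv_ge : ∀ e ∈ Icc a b, 1 / K ≤ deriv (condMean W) e
  mean_deriv_slow : ∀ e ∈ Icc a b, ∀ e' ∈ Icc a b,
    deriv (condMean W) e ≤ Real.exp (L * |e - e'|) * deriv (condMean W) e'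
  sd_diff : ∀ e ∈ Icc a b, DifferentiableAt ℝ (condSD W) e
  sd_slow : ∀ e ∈ Icc a b, |deriv (condSD W) e| ≤ L * condSD W e
  shape_slow : ∀ e ∈ Icc a b, ∀ e' ∈ Icc a b, ∀ x,
    condMean W e + condSD W e * x ∈ Ioo qMin qMax →
    condMean W e' + condSD W e' * x ∈ Ioo qMin qMax →
    shape W x e ≤ Real.exp (L * |e - e'|) * shape W x e'
  input_slow : ∀ e ∈ Icc a b, ∀ e' ∈ Icc a b, p e ≤ Real.exp (L * |e - e'|) * p e'

/-- The conditional density `f_{Q*|E*}(q*|e*)` of the transformed variables `Q* = F_Q(Q)` and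
`E* = F_E(E)`, where `F_E` is the distribution function of the density `p` of `E` and `F_Q` that of
the resulting density `f_Q` of `Q`. For `q*`, `e*` in `(0, 1)` it is
`f_{Q|E}(q|e) / f_Q(q)` with `F_Q(q) = q*` and `F_E(e) = e*`. -/
def starChannel (W : ℝ → ℝ → ℝ) (p : ℝ → ℝ) (qs es : ℝ) : ℝ :=
  (Ioo (0 : ℝ) 1 ×ˢ Ioo (0 : ℝ) 1).indicator
    (fun z : ℝ × ℝ => W (quantile (outputDensity W p) z.1) (quantile p z.2) /
      outputDensity W p (quantile (outputDensity W p) z.1)) (qs, es)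

/-- The conditional density `f_{E*|Q*}(e*|q*)` when `E*` is uniform on `(0, 1)`. -/
def starPosterior (W : ℝ → ℝ → ℝ) (p : ℝ → ℝ) (qs es : ℝ) : ℝ :=
  posterior (starChannel W p) uniformDensity qs es

/-- The mean of `E*` given `Q* = q*`, when `E*` is uniform. -/
def starMean (W : ℝ → ℝ → ℝ) (p : ℝ → ℝ) (qs : ℝ) : ℝ := ∫ es, es * starPosterior W p qs es

/-- The entropy `h(E*|q*)`, when `E*` is uniform. -/
def starEntropy (W : ℝ → ℝ → ℝ) (p : ℝ → ℝ) (qs : ℝ) : ℝ := entropy (starPosterior W p qs)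

end

end EnvChannel

/-! Near an interior point the channel is almost a shift channel. Fix `q`, let `e₀` be the point of
`[a, b]` with `m(e₀) = q`, and write `s = σ_max`, `φ = φ(·|e₀)`, `z = (q - m(e)) / σ(e)`. Only
values `e` within order `s` of `e₀` matter, and over such a range `m'`, `σ`, `φ(x|·)` and the
optimal density `p` change by a fraction of order `s`. Whether `e` varies with `q` fixed, or `q`
with `e` fixed, the standardised coordinate `z` then has density `φ` up to `O(s)`.

Integrating over `e`, with `m'(e₀) / σ(e₀) de` playing the part of `dz`, gives `f_Q(q) = p(e₀) /
m'(e₀)` up to a factor `1 + O(s)` (`exists_logNear_outputDensity`). Put `κ = σ(e₀) p(e₀) / m'(e₀)`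
and `J = ∫ φ log φ`. Near `e₀` the ratio `f_{Q|E} / f_Q` is then about `φ(z) / κ`, and two
quantities take the same value: with `q` fixed, `-log 2 · h(E*|q*)`, the relative entropy of the
posterior of `E` to `p`, is `J - log κ + O(s)` (`exists_abs_posterior_sub_le`); with `e` fixed, the
relative entropy of `f_{Q|E}(·|e)` to `f_Q` is `J - log κ + O(s)`. Optimality of `p` makes the
average of this relative entropy over any set of inputs equal to `log 2 · C`
(`IsCapacityAchieving.setIntegral_eq`), whence `log 2 · C = J - log κ + O(s)`
(`exists_abs_capacity_sub_le`). Comparison gives the second claim, and the third follows from it by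
the triangle inequality.

For the mean, the posterior of `E` has width of order `s` about `e₀` and `F_E` is Lipschitz on `[a,
b]`, so the posterior mean of `F_E(E)` is `F_E(e₀) + O(s)` (`exists_abs_posteriorMean_sub_le`).
Since `m` is monotone, `Q ≤ q` and `E ≤ e₀` are almost the same event, so `F_E(e₀) = F_Q(q) + O(s) =
q* + O(s)` (`abs_cdf_output_sub_le`).

Outside the central range, Chebyshev's inequality and the cubic decay of `φ` make all contributions
`O(s)`. The constants stay uniform because slow change on `[a, b]`, the length of the range of `Q`
and the mass `2δ` bound `m'` above and `p` above and below (`IsSlowChange.slowRegime`). -/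

namespace EnvChannel

/-! ### Densities on a bounded interval: moments and Chebyshev's inequality. -/

/-- A probability density on the line that vanishes off `(l, r)`. -/
structure IsDensityOn (l r : ℝ) (g : ℝ → ℝ) : Prop where
  measurable : Measurable g
  nonneg : ∀ x, 0 ≤ g x
  support : ∀ x, x ∉ Ioo l r → g x = 0
  integral_eq_one : ∫ x, g x = 1

namespace IsDensityOn

variable {l r : ℝ} {g : ℝ → ℝ}

lemma integrable (hg : IsDensityOn l r g) : Integrable g :=
  .of_integral_ne_zero (by rw [hg.integral_eq_one]; exact one_ne_zero)

lemma lt (hg : IsDensityOn l r g) : l < r := by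
  by_contra h
  have h0 : g = 0 := by
    funext x
    exact hg.support x (by rw [Ioo_eq_empty h]; exact notMem_empty x)
  have := hg.integral_eq_one
  simp [h0] at this

lemma integrable_mul_of_bound (hg : IsDensityOn l r g) {u : ℝ → ℝ} (hu : Measurable u) (C : ℝ)
    (hC : ∀ x ∈ Ioo l r, |u x| ≤ C) : Integrable (fun x => u x * g x) := by
  refine Integrable.mono' (hg.integrable.const_mul C)
    (hu.mul hg.measurable).aestronglyMeasurable (Filter.Eventually.of_forall fun x => ?_)
  by_cases hx : x ∈ Ioo l r
  · rw [Real.norm_eq_abs, abs_mul, abs_of_nonneg (hg.nonneg x)]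
    exact mul_le_mul_of_nonneg_right (hC x hx) (hg.nonneg x)
  · simp [hg.support x hx]

lemma integrable_id_mul (hg : IsDensityOn l r g) : Integrable (fun x => x * g x) := by
  refine hg.integrable_mul_of_bound measurable_id (max |l| |r|) fun x hx => ?_
  exact abs_le_max_abs_abs hx.1.le hx.2.le

lemma integrable_sq_mul (hg : IsDensityOn l r g) (c : ℝ) :
    Integrable (fun x => (x - c) ^ 2 * g x) := by
  refine hg.integrable_mul_of_bound (by fun_prop) ((max |l| |r| + |c|) ^ 2) fun x hx => ?_
  rw [abs_pow]
  have h1 : |x - c| ≤ |x| + |c| := abs_sub _ _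
  have h2 := abs_le_max_abs_abs hx.1.le hx.2.le
  gcongr
  exact h1.trans (by simpa using h2)

lemma mean_mem (hg : IsDensityOn l r g) : (∫ x, x * g x) ∈ Icc l r := by
  constructor
  · have : ∫ x, l * g x ≤ ∫ x, x * g x := by
      refine integral_mono (hg.integrable.const_mul l) hg.integrable_id_mul fun x => ?_
      by_cases hx : x ∈ Ioo l r
      · exact mul_le_mul_of_nonneg_right hx.1.le (hg.nonneg x)
      · simp [hg.support x hx]
    rwa [integral_const_mul, hg.integral_eq_one, mul_one] at this
  · have : ∫ x, x * g x ≤ ∫ x, r * g x := by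
      refine integral_mono hg.integrable_id_mul (hg.integrable.const_mul r) fun x => ?_
      by_cases hx : x ∈ Ioo l r
      · exact mul_le_mul_of_nonneg_right hx.2.le (hg.nonneg x)
      · simp [hg.support x hx]
    rwa [integral_const_mul, hg.integral_eq_one, mul_one] at this

/-- A law with a density cannot concentrate on the single point `c`. -/
lemma variance_pos (hg : IsDensityOn l r g) (c : ℝ) : 0 < ∫ x, (x - c) ^ 2 * g x := by
  have hnn : 0 ≤ fun x => (x - c) ^ 2 * g x := fun x => mul_nonneg (sq_nonneg _) (hg.nonneg x)
  refine lt_of_le_of_ne (integral_nonneg hnn) fun h => ?_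
  have h0 := (integral_eq_zero_iff_of_nonneg hnn (hg.integrable_sq_mul c)).1 h.symm
  have h1 : g =ᵐ[volume] 0 := by
    filter_upwards [h0, (measure_eq_zero_iff_ae_notMem.1 (measure_singleton c : volume {c} = 0))]
      with x hx hxc
    have hxc' : x - c ≠ 0 := sub_ne_zero.2 (by simpa using hxc)
    simpa [hxc'] using hx
  have := hg.integral_eq_one
  rw [integral_congr_ae h1] at this
  simp at this

lemma variance_le (hg : IsDensityOn l r g) {c : ℝ} (hc : c ∈ Icc l r) :
    ∫ x, (x - c) ^ 2 * g x ≤ (r - l) ^ 2 := by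
  have : ∫ x, (x - c) ^ 2 * g x ≤ ∫ x, (r - l) ^ 2 * g x := by
    refine integral_mono (hg.integrable_sq_mul c) (hg.integrable.const_mul _) fun x => ?_
    by_cases hx : x ∈ Ioo l r
    · refine mul_le_mul_of_nonneg_right ?_ (hg.nonneg x)
      rw [sq_le_sq, abs_of_nonneg (sub_nonneg.2 (hc.1.trans hc.2)), abs_le]
      constructor <;> linarith [hx.1, hx.2, hc.1, hc.2]
    · simp [hg.support x hx]
  rwa [integral_const_mul, hg.integral_eq_one, mul_one] at this

/-- Chebyshev's inequality, for a measurable set at distance at least `d` from `c`. -/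
lemma setIntegral_le_of_far (hg : IsDensityOn l r g) {c d v : ℝ} (hd : 0 < d)
    (hv : ∫ x, (x - c) ^ 2 * g x ≤ v) {S : Set ℝ} (hS : MeasurableSet S)
    (hfar : ∀ x ∈ S, d ≤ |x - c|) : ∫ x in S, g x ≤ v / d ^ 2 := by
  rw [le_div_iff₀ (by positivity), mul_comm, ← integral_const_mul]
  refine le_trans ?_ hv
  refine le_trans (setIntegral_mono_on (hg.integrable.integrableOn.const_mul _)
    (hg.integrable_sq_mul c).integrableOn hS fun x hx => ?_)
    (setIntegral_le_integral (hg.integrable_sq_mul c)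
      (Filter.Eventually.of_forall fun x => mul_nonneg (sq_nonneg _) (hg.nonneg x)))
  refine mul_le_mul_of_nonneg_right ?_ (hg.nonneg x)
  rw [← sq_abs (x - c)]
  exact pow_le_pow_left₀ hd.le (hfar x hx) 2

lemma setIntegral_le_one (hg : IsDensityOn l r g) (S : Set ℝ) : ∫ x in S, g x ≤ 1 := by
  rw [← hg.integral_eq_one]
  exact setIntegral_le_integral hg.integrable (Filter.Eventually.of_forall hg.nonneg)

lemma setIntegral_nonneg (hg : IsDensityOn l r g) (S : Set ℝ) : 0 ≤ ∫ x in S, g x :=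
  integral_nonneg hg.nonneg

lemma setIntegral_add_compl (hg : IsDensityOn l r g) {S : Set ℝ} (hS : MeasurableSet S) :
    (∫ x in S, g x) + ∫ x in Sᶜ, g x = 1 := by
  rw [integral_add_compl hS hg.integrable, hg.integral_eq_one]

end IsDensityOn

/-! ### Elementary bounds for logarithms. -/

section Log

/-- The square root is what matters for small `t`: when `t = O(s ^ 2)` it makes the entropy
contribution `O(s)`. The term `t ^ 2` only covers `t > 1`. -/
lemma abs_mul_log_le {t : ℝ} (ht : 0 ≤ t) : |t * Real.log t| ≤ 2 * Real.sqrt t + t ^ 2 := by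
  rcases ht.eq_or_lt with rfl | h0
  · simp
  rcases le_or_gt t 1 with h1 | h1
  · have h := Real.abs_log_mul_self_rpow_lt t (1 / 2) h0 h1 (by norm_num)
    rw [← Real.sqrt_eq_rpow] at h
    have h2 : |t * Real.log t| = |Real.log t * Real.sqrt t| * Real.sqrt t := by
      rw [abs_mul, abs_mul, abs_of_pos h0, abs_of_nonneg (Real.sqrt_nonneg t), mul_assoc,
        Real.mul_self_sqrt ht, mul_comm]
    rw [h2]
    rw [show (1 : ℝ) / (1 / 2) = 2 by norm_num] at h
    have := mul_le_mul_of_nonneg_right h.le (Real.sqrt_nonneg t)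
    nlinarith [sq_nonneg t]
  · have hl : 0 ≤ Real.log t := Real.log_nonneg h1.le
    rw [abs_of_nonneg (mul_nonneg ht hl)]
    have := Real.log_le_sub_one_of_pos h0
    nlinarith [Real.sqrt_nonneg t]

lemma abs_mul_log_le_of_le {t B : ℝ} (ht : 0 ≤ t) (hB : t ≤ B) :
    |t * Real.log t| ≤ 2 * Real.sqrt B + B ^ 2 := by
  refine (abs_mul_log_le ht).trans ?_
  have := Real.sqrt_le_sqrt hB
  have := pow_le_pow_left₀ ht hB 2
  linarith

lemma abs_log_le_add_inv {t : ℝ} (ht : 0 < t) : |Real.log t| ≤ t + t⁻¹ := by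
  rw [abs_le]
  have h1 := Real.log_le_sub_one_of_pos ht
  have h2 := Real.log_le_sub_one_of_pos (inv_pos.2 ht)
  rw [Real.log_inv] at h2
  have := inv_pos.2 ht
  constructor <;> linarith

end Log

/-! ### The conditional law of `Q` and its standardisation. -/

namespace IsChannel

variable {eMin eMax qMin qMax : ℝ} {W : ℝ → ℝ → ℝ}

lemma isDensityOn (hW : IsChannel eMin eMax qMin qMax W) {e : ℝ} (he : e ∈ Ioo eMin eMax) :
    IsDensityOn qMin qMax (fun q => W q e) where
  measurable := hW.measurable.comp (measurable_id.prodMk measurable_const)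
  nonneg := hW.nonneg e he
  support := hW.support e he
  integral_eq_one := hW.integral_eq_one e he

lemma condMean_mem (hW : IsChannel eMin eMax qMin qMax W) {e : ℝ} (he : e ∈ Ioo eMin eMax) :
    condMean W e ∈ Icc qMin qMax := (hW.isDensityOn he).mean_mem

lemma condSD_pos (hW : IsChannel eMin eMax qMin qMax W) {e : ℝ} (he : e ∈ Ioo eMin eMax) :
    0 < condSD W e := Real.sqrt_pos.2 ((hW.isDensityOn he).variance_pos _)

lemma condSD_sq (hW : IsChannel eMin eMax qMin qMax W) {e : ℝ} (he : e ∈ Ioo eMin eMax) :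
    condSD W e ^ 2 = ∫ q, (q - condMean W e) ^ 2 * W q e :=
  Real.sq_sqrt ((hW.isDensityOn he).variance_pos _).le

lemma condSD_le_maxSD (hW : IsChannel eMin eMax qMin qMax W) {e : ℝ} (he : e ∈ Ioo eMin eMax) :
    condSD W e ≤ maxSD eMin eMax W := by
  -- The length of the range of `Q` bounds every standard deviation, so the supremum is a genuine
  -- one and not the default value of `sSup`.
  refine le_csSup ⟨qMax - qMin, ?_⟩ (mem_image_of_mem _ he)
  rintro _ ⟨e', he', rfl⟩
  refine Real.sqrt_le_iff.2 ⟨(sub_pos.2 (hW.isDensityOn he').lt).le, ?_⟩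
  exact (hW.isDensityOn he').variance_le (hW.condMean_mem he')

lemma variance_le_maxSD (hW : IsChannel eMin eMax qMin qMax W) {e : ℝ}
    (he : e ∈ Ioo eMin eMax) :
    ∫ q, (q - condMean W e) ^ 2 * W q e ≤ maxSD eMin eMax W ^ 2 := by
  rw [← hW.condSD_sq he]
  exact pow_le_pow_left₀ (hW.condSD_pos he).le (hW.condSD_le_maxSD he) 2

/-- Chebyshev's inequality for the conditional law of `Q`. -/
lemma setIntegral_le_of_far (hW : IsChannel eMin eMax qMin qMax W) {e : ℝ}
    (he : e ∈ Ioo eMin eMax) {d : ℝ} (hd : 0 < d) {S : Set ℝ} (hS : MeasurableSet S)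
    (hfar : ∀ q ∈ S, d ≤ |q - condMean W e|) :
    ∫ q in S, W q e ≤ maxSD eMin eMax W ^ 2 / d ^ 2 :=
  (hW.isDensityOn he).setIntegral_le_of_far hd (hW.variance_le_maxSD he) hS hfar

lemma apply_eq_shape_div (hW : IsChannel eMin eMax qMin qMax W) {e : ℝ}
    (he : e ∈ Ioo eMin eMax) (q : ℝ) :
    W q e = shape W ((q - condMean W e) / condSD W e) e / condSD W e := by
  have h := (hW.condSD_pos he).ne'
  rw [shape, mul_div_cancel₀ _ h, mul_div_cancel_left₀ _ h]
  congr 1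
  ring

lemma shape_nonneg (hW : IsChannel eMin eMax qMin qMax W) {e : ℝ} (he : e ∈ Ioo eMin eMax)
    (x : ℝ) : 0 ≤ shape W x e :=
  mul_nonneg (hW.condSD_pos he).le (hW.nonneg e he _)

lemma measurable_shape (hW : IsChannel eMin eMax qMin qMax W) {e : ℝ} (he : e ∈ Ioo eMin eMax) :
    Measurable (fun x => shape W x e) :=
  ((hW.isDensityOn he).measurable.comp
    ((measurable_id.const_mul (condSD W e)).const_add (condMean W e))).const_mul (condSD W e)

/-- The change of variable `q = m(e) + σ(e) x`. -/
lemma integral_standardise (hW : IsChannel eMin eMax qMin qMax W) {e : ℝ}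
    (he : e ∈ Ioo eMin eMax) (F : ℝ → ℝ) :
    ∫ q, F q = ∫ x, condSD W e * F (condMean W e + condSD W e * x) := by
  have h := hW.condSD_pos he
  rw [integral_const_mul, Measure.integral_comp_mul_left (fun y => F (condMean W e + y)),
    integral_add_left_eq_self F, smul_eq_mul, abs_of_pos (inv_pos.2 h), ← mul_assoc,
    mul_inv_cancel₀ h.ne', one_mul]

lemma integral_shape (hW : IsChannel eMin eMax qMin qMax W) {e : ℝ} (he : e ∈ Ioo eMin eMax) :
    ∫ x, shape W x e = 1 := by
  rw [← hW.integral_eq_one e he]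
  exact (hW.integral_standardise he fun q => W q e).symm

lemma integrable_shape (hW : IsChannel eMin eMax qMin qMax W) {e : ℝ} (he : e ∈ Ioo eMin eMax) :
    Integrable (fun x => shape W x e) :=
  .of_integral_ne_zero (by rw [hW.integral_shape he]; exact one_ne_zero)

end IsChannel

namespace IsInputDensity

lemma isDensityOn {eMin eMax : ℝ} {p : ℝ → ℝ} (hp : IsInputDensity eMin eMax p) :
    IsDensityOn eMin eMax p := ⟨hp.measurable, hp.nonneg, hp.support, hp.integral_eq_one⟩

end IsInputDensity

/-! ### Output density and mutual information of a bounded channel. -/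

/-- A channel with a bounded conditional density, together with an input density. -/
structure IsBoundedPair (eMin eMax qMin qMax B : ℝ) (W : ℝ → ℝ → ℝ) (p : ℝ → ℝ) : Prop where
  channel : IsChannel eMin eMax qMin qMax W
  input : IsInputDensity eMin eMax p
  bound : ∀ e ∈ Ioo eMin eMax, ∀ q, W q e ≤ B

namespace IsBoundedPair

variable {eMin eMax qMin qMax B : ℝ} {W : ℝ → ℝ → ℝ} {p : ℝ → ℝ}

lemma measurable_joint (h : IsBoundedPair eMin eMax qMin qMax B W p) :
    Measurable (fun z : ℝ × ℝ => W z.1 z.2 * p z.2) :=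
  h.channel.measurable.mul (h.input.measurable.comp measurable_snd)

lemma joint_nonneg (h : IsBoundedPair eMin eMax qMin qMax B W p) (q e : ℝ) :
    0 ≤ W q e * p e := by
  by_cases he : e ∈ Ioo eMin eMax
  · exact mul_nonneg (h.channel.nonneg e he q) (h.input.nonneg e)
  · simp [h.input.support e he]

lemma joint_le (h : IsBoundedPair eMin eMax qMin qMax B W p) (q e : ℝ) :
    W q e * p e ≤ B * p e := by
  by_cases he : e ∈ Ioo eMin eMax
  · exact mul_le_mul_of_nonneg_right (h.bound e he q) (h.input.nonneg e)
  · simp [h.input.support e he]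

lemma integrable_joint (h : IsBoundedPair eMin eMax qMin qMax B W p) :
    Integrable (fun z : ℝ × ℝ => W z.1 z.2 * p z.2) (volume.prod volume) := by
  rw [integrable_prod_iff' h.measurable_joint.aestronglyMeasurable]
  constructor
  · refine Filter.Eventually.of_forall fun e => ?_
    by_cases he : e ∈ Ioo eMin eMax
    · exact (h.channel.isDensityOn he).integrable.mul_const (p e)
    · simp [h.input.support e he]
  · refine h.input.isDensityOn.integrable.congr (Filter.Eventually.of_forall fun e => ?_)
    simp only [Real.norm_eq_abs, abs_of_nonneg (h.joint_nonneg _ e)]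
    by_cases he : e ∈ Ioo eMin eMax
    · rw [integral_mul_const, h.channel.integral_eq_one e he, one_mul]
    · simp [h.input.support e he]

lemma integrable_section (h : IsBoundedPair eMin eMax qMin qMax B W p) (q : ℝ) :
    Integrable (fun e => W q e * p e) := by
  refine Integrable.mono' (h.input.isDensityOn.integrable.const_mul B)
    (h.measurable_joint.comp measurable_prodMk_left).aestronglyMeasurable
    (Filter.Eventually.of_forall fun e => ?_)
  rw [Real.norm_eq_abs, abs_of_nonneg (h.joint_nonneg q e)]
  exact h.joint_le q e

lemma outputDensity_nonneg (h : IsBoundedPair eMin eMax qMin qMax B W p) (q : ℝ) :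
    0 ≤ outputDensity W p q := integral_nonneg (h.joint_nonneg q)

lemma setIntegral_le_outputDensity (h : IsBoundedPair eMin eMax qMin qMax B W p) (q : ℝ)
    (N : Set ℝ) : ∫ e in N, W q e * p e ≤ outputDensity W p q :=
  setIntegral_le_integral (h.integrable_section q) (Filter.Eventually.of_forall (h.joint_nonneg q))

lemma isDensityOn_output (h : IsBoundedPair eMin eMax qMin qMax B W p) :
    IsDensityOn qMin qMax (outputDensity W p) where
  measurable := (StronglyMeasurable.integral_prod_right'
    (f := fun z : ℝ × ℝ => W z.1 z.2 * p z.2) h.measurable_joint.stronglyMeasurable).measurable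
  nonneg := h.outputDensity_nonneg
  support := fun q hq => by
    refine integral_eq_zero_of_ae (Filter.Eventually.of_forall fun e => ?_)
    by_cases he : e ∈ Ioo eMin eMax
    · simp [h.channel.support e he q hq]
    · simp [h.input.support e he]
  integral_eq_one := by
    unfold outputDensity
    rw [integral_integral_swap (f := fun q e => W q e * p e) h.integrable_joint,
      ← h.input.integral_eq_one]
    refine integral_congr_ae (Filter.Eventually.of_forall fun e => ?_)
    by_cases he : e ∈ Ioo eMin eMax
    · simp [integral_mul_const, h.channel.integral_eq_one e he]
    · simp [h.input.support e he]

lemma outputDensity_le (h : IsBoundedPair eMin eMax qMin qMax B W p) (q : ℝ) :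
    outputDensity W p q ≤ B := by
  have := integral_mono (h.integrable_section q) (h.input.isDensityOn.integrable.const_mul B)
    (h.joint_le q)
  rwa [integral_const_mul, h.input.integral_eq_one, mul_one] at this

end IsBoundedPair

/-- `f log f` is integrable for a bounded density on a bounded interval. -/
lemma IsDensityOn.integrable_mul_log {l r B : ℝ} {g : ℝ → ℝ} (hg : IsDensityOn l r g)
    (hB : ∀ x, g x ≤ B) : Integrable (fun x => g x * Real.log (g x)) := by
  refine Integrable.mono' (g := (Ioo l r).indicator fun _ => 2 * Real.sqrt B + B ^ 2)
    ((integrable_indicator_iff measurableSet_Ioo).2 (integrableOn_const (by simp)))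
    (hg.measurable.mul (Real.measurable_log.comp hg.measurable)).aestronglyMeasurable
    (Filter.Eventually.of_forall fun x => ?_)
  by_cases hx : x ∈ Ioo l r
  · rw [indicator_of_mem hx, Real.norm_eq_abs]
    exact abs_mul_log_le_of_le (hg.nonneg x) (hB x)
  · simp [hg.support x hx, indicator_of_notMem hx]

lemma IsDensityOn.abs_integral_mul_log_le {l r B : ℝ} {g : ℝ → ℝ} (hg : IsDensityOn l r g)
    (hB : ∀ x, g x ≤ B) :
    |∫ x, g x * Real.log (g x)| ≤ (r - l) * (2 * Real.sqrt B + B ^ 2) := by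
  have hi : Integrable ((Ioo l r).indicator fun _ : ℝ => 2 * Real.sqrt B + B ^ 2) :=
    (integrable_indicator_iff measurableSet_Ioo).2 (integrableOn_const (by simp))
  rw [← Real.norm_eq_abs]
  refine (norm_integral_le_of_norm_le hi (Filter.Eventually.of_forall fun x => ?_)).trans ?_
  · by_cases hx : x ∈ Ioo l r
    · rw [indicator_of_mem hx, Real.norm_eq_abs]
      exact abs_mul_log_le_of_le (hg.nonneg x) (hB x)
    · simp [hg.support x hx, indicator_of_notMem hx]
  · rw [integral_indicator measurableSet_Ioo, setIntegral_const, smul_eq_mul, Real.volume_real_Ioo,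
      max_eq_left (sub_pos.2 hg.lt).le]

lemma entropy_eq_neg_div (g : ℝ → ℝ) :
    entropy g = -(∫ x, g x * Real.log (g x)) / Real.log 2 := by
  unfold entropy Real.logb
  rw [neg_div, ← integral_div]
  simp only [mul_div_assoc]

namespace IsBoundedPair

variable {eMin eMax qMin qMax B : ℝ} {W : ℝ → ℝ → ℝ} {p : ℝ → ℝ}

lemma measurable_condInfo (hW : IsChannel eMin eMax qMin qMax W) :
    Measurable (fun e => ∫ q, W q e * Real.log (W q e)) :=
  (StronglyMeasurable.integral_prod_left'
    (f := fun z : ℝ × ℝ => W z.1 z.2 * Real.log (W z.1 z.2))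
    (hW.measurable.mul (Real.measurable_log.comp hW.measurable)).stronglyMeasurable).measurable

lemma integrable_condInfo (h : IsBoundedPair eMin eMax qMin qMax B W p) :
    Integrable (fun e => (∫ q, W q e * Real.log (W q e)) * p e) :=
  h.input.isDensityOn.integrable_mul_of_bound (measurable_condInfo h.channel) _ fun e he =>
    (h.channel.isDensityOn he).abs_integral_mul_log_le (h.bound e he)

/-- The first term is linear in `p`, so optimality needs an expansion of the output term only. -/
lemma log_two_mul_mutualInfo (h : IsBoundedPair eMin eMax qMin qMax B W p) :
    Real.log 2 * mutualInfo W p = (∫ e, (∫ q, W q e * Real.log (W q e)) * p e) -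
      ∫ q, outputDensity W p q * Real.log (outputDensity W p q) := by
  have h2 : Real.log 2 ≠ 0 := (Real.log_pos one_lt_two).ne'
  unfold mutualInfo
  rw [← integral_const_mul]
  have : ∀ e, Real.log 2 * ((entropy (outputDensity W p) - entropy fun q => W q e) * p e) =
      (∫ q, W q e * Real.log (W q e)) * p e -
        (∫ q, outputDensity W p q * Real.log (outputDensity W p q)) * p e := fun e => by
    rw [entropy_eq_neg_div, entropy_eq_neg_div]
    field_simp
    ring
  simp only [this]
  rw [integral_sub h.integrable_condInfo (h.input.isDensityOn.integrable.const_mul _),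
    integral_const_mul, h.input.integral_eq_one, mul_one]

/-- The factor `log f_Q` is unbounded where `f_Q` is small, so no constant dominates it. Integrating
over `e` first leaves `f_Q |log f_Q|`, which is bounded on a bounded interval. -/
lemma integrable_joint_mul_log_output (h : IsBoundedPair eMin eMax qMin qMax B W p) :
    Integrable (fun z : ℝ × ℝ => W z.1 z.2 * p z.2 * Real.log (outputDensity W p z.1))
      (volume.prod volume) := by
  have hm : Measurable fun z : ℝ × ℝ =>
      W z.1 z.2 * p z.2 * Real.log (outputDensity W p z.1) :=
    h.measurable_joint.mul
      (Real.measurable_log.comp (h.isDensityOn_output.measurable.comp measurable_fst))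
  rw [integrable_prod_iff hm.aestronglyMeasurable]
  refine ⟨Filter.Eventually.of_forall fun q =>
    (h.integrable_section q).mul_const (Real.log (outputDensity W p q)), ?_⟩
  refine (h.isDensityOn_output.integrable_mul_log h.outputDensity_le).norm.congr
    (Filter.Eventually.of_forall fun q => ?_)
  simp only [norm_mul _ (Real.log _)]
  rw [integral_mul_const]
  congr 1
  rw [Real.norm_of_nonneg (h.outputDensity_nonneg q)]
  exact integral_congr_ae (Filter.Eventually.of_forall fun e =>
    (Real.norm_of_nonneg (h.joint_nonneg q e)).symm)

lemma integrable_joint_mul_log (h : IsBoundedPair eMin eMax qMin qMax B W p) :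
    Integrable (fun z : ℝ × ℝ => W z.1 z.2 * p z.2 * Real.log (W z.1 z.2))
      (volume.prod volume) := by
  have hm : Measurable fun z : ℝ × ℝ => W z.1 z.2 * p z.2 * Real.log (W z.1 z.2) :=
    h.measurable_joint.mul (Real.measurable_log.comp h.channel.measurable)
  have hi : Integrable ((Ioo qMin qMax).indicator fun _ : ℝ => 2 * Real.sqrt B + B ^ 2) :=
    (integrable_indicator_iff measurableSet_Ioo).2 (integrableOn_const (by simp))
  refine Integrable.mono' (hi.mul_prod h.input.isDensityOn.integrable)
    hm.aestronglyMeasurable (Filter.Eventually.of_forall fun z => ?_)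
  by_cases he : z.2 ∈ Ioo eMin eMax
  · by_cases hq : z.1 ∈ Ioo qMin qMax
    · rw [indicator_of_mem hq, mul_right_comm, norm_mul, Real.norm_of_nonneg (h.input.nonneg _)]
      exact mul_le_mul_of_nonneg_right (abs_mul_log_le_of_le (h.channel.nonneg _ he _)
        (h.bound _ he _)) (h.input.nonneg _)
    · simp [h.channel.support _ he _ hq, indicator_of_notMem hq]
  · simp [h.input.support _ he]

/-- The tangent line of `log` at `f` bounds `log (f + t u)` from above, and `|u| ≤ f` turns the
second-order error into `t ^ 2 f`. This one-sided estimate suffices for the first-order condition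
because `t` may have either sign. -/
lemma perturbed_log_le {f u t : ℝ} (hf : 0 ≤ f) (hu : |u| ≤ f) (ht : |t| ≤ 1 / 2) :
    (f + t * u) * Real.log (f + t * u) ≤ (f + t * u) * Real.log f + t * u + t ^ 2 * f := by
  rcases hf.eq_or_lt with rfl | hf
  · have : u = 0 := abs_nonpos_iff.1 hu
    simp [this]
  have htu : |t * u| ≤ 1 / 2 * f := by
    rw [abs_mul]
    exact mul_le_mul ht hu (abs_nonneg u) (by norm_num)
  have hpos : 0 < f + t * u := by linarith [(abs_le.1 htu).1]
  have h1 : Real.log (f + t * u) ≤ Real.log f + t * u / f := by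
    have := Real.log_le_sub_one_of_pos (div_pos hpos hf)
    rw [Real.log_div hpos.ne' hf.ne', add_div, div_self hf.ne'] at this
    linarith
  have h2 : u ^ 2 / f ≤ f := by
    rw [div_le_iff₀ hf, ← sq, ← sq_abs u]
    exact pow_le_pow_left₀ (abs_nonneg u) hu 2
  calc _ ≤ (f + t * u) * (Real.log f + t * u / f) := mul_le_mul_of_nonneg_left h1 hpos.le
    _ = (f + t * u) * Real.log f + t * u + t ^ 2 * (u ^ 2 / f) := by field_simp; ring
    _ ≤ _ := by gcongr

lemma outputDensity_perturb (h : IsBoundedPair eMin eMax qMin qMax B W p) {N : Set ℝ}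
    (hN : MeasurableSet N) (t P q : ℝ) :
    outputDensity W (fun e => (1 + t * (N.indicator 1 e - P)) * p e) q =
      outputDensity W p q + t * ((∫ e in N, W q e * p e) - P * outputDensity W p q) := by
  have h1 : ∀ e, W q e * ((1 + t * (N.indicator 1 e - P)) * p e) =
      (1 - t * P) * (W q e * p e) + t * N.indicator (fun e => W q e * p e) e := fun e => by
    by_cases he : e ∈ N
    · simp only [indicator_of_mem he, Pi.one_apply]; ring
    · simp only [indicator_of_notMem he]; ring
  unfold outputDensity
  simp only [h1]
  rw [integral_add ((h.integrable_section q).const_mul _)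
    (((h.integrable_section q).indicator hN).const_mul _), integral_const_mul,
    integral_const_mul, integral_indicator hN]
  ring

end IsBoundedPair

/-! ### Optimality of the input density. -/

/-- The input densities obtained from `p` by changing the weight of a set. -/
lemma IsInputDensity.perturb {eMin eMax : ℝ} {p : ℝ → ℝ} (hp : IsInputDensity eMin eMax p)
    {N : Set ℝ} (hN : MeasurableSet N) {t : ℝ} (ht : |t| ≤ 1 / 2) :
    IsInputDensity eMin eMax
      (fun e => (1 + t * (N.indicator 1 e - ∫ e in N, p e)) * p e) where
  measurable := ((((measurable_one.indicator hN).sub_const _).const_mul _).const_add _).mul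
    hp.measurable
  nonneg := fun e => by
    refine mul_nonneg ?_ (hp.nonneg e)
    have h0 := hp.isDensityOn.setIntegral_nonneg N
    have h1 := hp.isDensityOn.setIntegral_le_one N
    have h2 : |N.indicator (1 : ℝ → ℝ) e - ∫ e in N, p e| ≤ 1 := by
      by_cases he : e ∈ N
      · rw [indicator_of_mem he, Pi.one_apply, abs_le]; constructor <;> linarith
      · rw [indicator_of_notMem he, abs_le]; constructor <;> linarith
    have h3 : |t * (N.indicator (1 : ℝ → ℝ) e - ∫ e in N, p e)| ≤ 1 / 2 * 1 := by
      rw [abs_mul]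
      exact mul_le_mul ht h2 (abs_nonneg _) (by norm_num)
    linarith [(abs_le.1 h3).1]
  support := fun e he => by simp [hp.support e he]
  integral_eq_one := by
    have hi := hp.isDensityOn.integrable
    have h1 : ∀ e, (1 + t * (N.indicator 1 e - ∫ e in N, p e)) * p e =
        (1 - t * ∫ e in N, p e) * p e + t * N.indicator p e := fun e => by
      by_cases he : e ∈ N
      · simp only [indicator_of_mem he, Pi.one_apply]; ring
      · simp only [indicator_of_notMem he]; ring
    simp only [h1]
    rw [integral_add (hi.const_mul _) ((hi.indicator hN).const_mul _), integral_const_mul,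
      integral_const_mul, integral_indicator hN, hp.integral_eq_one]
    ring

/-- A real number whose product with every small `t` is at most `t ^ 2` vanishes. -/
lemma eq_zero_of_forall_mul_le_sq {x : ℝ} (h : ∀ t : ℝ, |t| ≤ 1 / 2 → t * x ≤ t ^ 2) : x = 0 := by
  by_contra hx
  have hx' : 0 < |x| := abs_pos.2 hx
  -- Taking `t = ± r` with the sign of `x` gives `r |x| ≤ r ^ 2`, contrary to `0 < r ≤ |x| / 2`.
  set r := min (1 / 2) (|x| / 2) with hr
  have hr0 : 0 < r := by positivity
  have hr1 : r ≤ 1 / 2 := min_le_left _ _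
  have hr2 : r ≤ |x| / 2 := min_le_right _ _
  have h1 := h r (by rwa [abs_of_pos hr0])
  have h2 := h (-r) (by rwa [abs_neg, abs_of_pos hr0])
  rcases abs_cases x with ⟨h3, _⟩ | ⟨h3, _⟩ <;> nlinarith

/-- The first-order condition for a capacity-achieving density. -/
lemma IsCapacityAchieving.setIntegral_eq {eMin eMax qMin qMax B : ℝ} {W : ℝ → ℝ → ℝ} {p : ℝ → ℝ}
    (hp : IsCapacityAchieving eMin eMax W p) (h : IsBoundedPair eMin eMax qMin qMax B W p)
    {N : Set ℝ} (hN : MeasurableSet N) :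
    ∫ e in N, (∫ q, W q e * p e * (Real.log (W q e) - Real.log (outputDensity W p q))) =
      Real.log 2 * mutualInfo W p * ∫ e in N, p e := by
  set f := outputDensity W p with hf
  set P := ∫ e in N, p e with hP
  set c : ℝ → ℝ := fun e => ∫ q, W q e * Real.log (W q e) with hc
  set g : ℝ → ℝ := fun q => ∫ e in N, W q e * p e with hg
  have hfd : IsDensityOn qMin qMax f := h.isDensityOn_output
  have hcp : Integrable fun e => c e * p e := h.integrable_condInfo
  have hgf : ∀ q, g q ≤ f q := fun q => h.setIntegral_le_outputDensity q N
  have hg0 : ∀ q, 0 ≤ g q := fun q => integral_nonneg (h.joint_nonneg q)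
  have hP0 : 0 ≤ P := h.input.isDensityOn.setIntegral_nonneg N
  have hP1 : P ≤ 1 := h.input.isDensityOn.setIntegral_le_one N
  -- Restricting the second variable to `N` lets Fubini exchange the integral over `q` with the one
  -- over `N`.
  have hsw : Integrable (fun z : ℝ × ℝ => W z.1 z.2 * p z.2)
      (volume.prod (volume.restrict N)) := by
    have := h.integrable_joint.integrableOn (s := univ ×ˢ N)
    rwa [IntegrableOn, ← Measure.prod_restrict, Measure.restrict_univ] at this
  have hswl : Integrable (fun z : ℝ × ℝ => W z.1 z.2 * p z.2 * Real.log (f z.1))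
      (volume.prod (volume.restrict N)) := by
    have := h.integrable_joint_mul_log_output.integrableOn (s := univ ×ˢ N)
    rwa [IntegrableOn, ← Measure.prod_restrict, Measure.restrict_univ] at this
  have hswW : Integrable (fun z : ℝ × ℝ => W z.1 z.2 * p z.2 * Real.log (W z.1 z.2))
      (volume.prod (volume.restrict N)) := by
    have := h.integrable_joint_mul_log.integrableOn (s := univ ×ˢ N)
    rwa [IntegrableOn, ← Measure.prod_restrict, Measure.restrict_univ] at this
  have hgint : Integrable g := hsw.integral_prod_left
  have hglint : Integrable fun q => g q * Real.log (f q) := by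
    refine hswl.integral_prod_left.congr (Filter.Eventually.of_forall fun q => ?_)
    simp only [hg]
    rw [integral_mul_const]
  have hflint : Integrable fun q => f q * Real.log (f q) :=
    hfd.integrable_mul_log h.outputDensity_le
  have hgtot : ∫ q, g q = P := by
    rw [hg, integral_integral_swap (f := fun q e => W q e * p e) hsw]
    refine integral_congr_ae (Filter.Eventually.of_forall fun e => ?_)
    by_cases he : e ∈ Ioo eMin eMax
    · simp [integral_mul_const, h.channel.integral_eq_one e he]
    · simp [h.input.support e he]
  have hLHS : ∫ e in N, (∫ q, W q e * p e * (Real.log (W q e) - Real.log (f q))) =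
      (∫ e in N, c e * p e) - ∫ q, g q * Real.log (f q) := by
    have h1 : ∫ q, g q * Real.log (f q) =
        ∫ e in N, ∫ q, W q e * p e * Real.log (f q) := by
      rw [← integral_integral_swap (f := fun q e => W q e * p e * Real.log (f q)) hswl]
      simp only [hg, integral_mul_const]
    rw [h1, ← integral_sub hcp.integrableOn hswl.integral_prod_right]
    refine integral_congr_ae ?_
    filter_upwards [hswl.prod_left_ae, hswW.prod_left_ae] with e h2 h3
    simp only [mul_sub]
    rw [integral_sub h3 h2, hc, ← integral_mul_const]
    congr 2
    funext q
    ring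
  -- The bracket is the derivative at `t = 0` of the mutual information along the perturbed
  -- densities. Optimality at `t = 0`, with an error of at most `t ^ 2 ∫ f = t ^ 2` in the output
  -- entropy, bounds its product with `t`.
  have hopt : ∀ t : ℝ, |t| ≤ 1 / 2 → t * ((∫ e in N, c e * p e) - (∫ q, g q * Real.log (f q)) -
      Real.log 2 * mutualInfo W p * P) ≤ t ^ 2 := by
    intro t ht
    have hpt := h.input.perturb hN ht
    have hle := hp.2 _ hpt
    set pt : ℝ → ℝ := fun e => (1 + t * (N.indicator 1 e - ∫ e in N, p e)) * p e with hptdef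
    have hbt : IsBoundedPair eMin eMax qMin qMax B W pt := ⟨h.channel, hpt, h.bound⟩
    have hle2 := mul_le_mul_of_nonneg_left hle (Real.log_pos one_lt_two).le
    rw [hbt.log_two_mul_mutualInfo] at hle2
    have e1 : ∫ e, (∫ q, W q e * Real.log (W q e)) * pt e =
        (1 - t * P) * (∫ e, c e * p e) + t * ∫ e in N, c e * p e := by
      rw [← integral_indicator hN]
      refine Eq.trans (integral_congr_ae (Filter.Eventually.of_forall fun e => ?_))
        ((integral_add (hcp.const_mul (1 - t * P)) ((hcp.indicator hN).const_mul t)).trans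
          (by rw [integral_const_mul, integral_const_mul]))
      by_cases he : e ∈ N
      · simp only [hptdef, indicator_of_mem he, Pi.one_apply]; ring
      · simp only [hptdef, indicator_of_notMem he]; ring
    have e2 : ∀ q, outputDensity W pt q = f q + t * (g q - P * f q) := fun q =>
      h.outputDensity_perturb hN t P q
    have hu : Integrable fun q => g q - P * f q := hgint.sub (hfd.integrable.const_mul P)
    have hul : Integrable fun q => (f q + t * (g q - P * f q)) * Real.log (f q) := by
      have := (hflint.const_mul (1 - t * P)).add (hglint.const_mul t)
      refine this.congr (Filter.Eventually.of_forall fun q => ?_)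
      simp only [Pi.add_apply]; ring
    have e3 : ∫ q, outputDensity W pt q * Real.log (outputDensity W pt q) ≤
        (1 - t * P) * (∫ q, f q * Real.log (f q)) + t * (∫ q, g q * Real.log (f q)) + t ^ 2 := by
      have e4 : ∫ q, outputDensity W pt q * Real.log (outputDensity W pt q) ≤
          ∫ q, ((f q + t * (g q - P * f q)) * Real.log (f q) + t * (g q - P * f q)
            + t ^ 2 * f q) := by
        refine integral_mono (hbt.isDensityOn_output.integrable_mul_log hbt.outputDensity_le)
          ((hul.add (hu.const_mul t)).add (hfd.integrable.const_mul _)) fun q => ?_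
        simp only [e2]
        refine IsBoundedPair.perturbed_log_le (hfd.nonneg q) ?_ ht
        rw [abs_le]
        have := hgf q
        have := hg0 q
        have h5 : P * f q ≤ f q := mul_le_of_le_one_left (hfd.nonneg q) hP1
        have h6 : 0 ≤ P * f q := mul_nonneg hP0 (hfd.nonneg q)
        constructor <;> linarith
      refine e4.trans (le_of_eq ?_)
      have hadd : Integrable fun q => (f q + t * (g q - P * f q)) * Real.log (f q)
          + t * (g q - P * f q) := hul.add (hu.const_mul t)
      rw [integral_add hadd (hfd.integrable.const_mul _),
        integral_add hul (hu.const_mul t), integral_const_mul, integral_const_mul,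
        integral_sub hgint (hfd.integrable.const_mul P), integral_const_mul, hgtot,
        hfd.integral_eq_one]
      have e5 : ∫ q, (f q + t * (g q - P * f q)) * Real.log (f q) =
          (1 - t * P) * (∫ q, f q * Real.log (f q)) + t * (∫ q, g q * Real.log (f q)) := by
        refine Eq.trans (integral_congr_ae (Filter.Eventually.of_forall fun q => ?_))
          ((integral_add (hflint.const_mul (1 - t * P)) (hglint.const_mul t)).trans
            (by rw [integral_const_mul, integral_const_mul]))
        simp only
        ring
      rw [e5]
      ring
    have e6 := h.log_two_mul_mutualInfo
    rw [e1, e6] at hle2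
    rw [e6]
    nlinarith
  have := eq_zero_of_forall_mul_le_sq hopt
  rw [hLHS]
  linarith

/-! ### Distribution and quantile functions. -/

namespace IsDensityOn

variable {l r : ℝ} {g : ℝ → ℝ}

lemma cdf_mono (hg : IsDensityOn l r g) : Monotone (cdf g) := fun _ _ hxy =>
  setIntegral_mono_set hg.integrable.integrableOn
    (Filter.Eventually.of_forall hg.nonneg) (Iic_subset_Iic.2 hxy).eventuallyLE

lemma cdf_sub (hg : IsDensityOn l r g) (x y : ℝ) : cdf g y - cdf g x = ∫ t in x..y, g t :=
  intervalIntegral.integral_Iic_sub_Iic hg.integrable.integrableOn hg.integrable.integrableOn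

lemma continuous_cdf (hg : IsDensityOn l r g) : Continuous (cdf g) := by
  have h : cdf g = fun x => cdf g 0 + ∫ t in (0 : ℝ)..x, g t := by
    funext x
    rw [← hg.cdf_sub]
    ring
  rw [h]
  exact continuous_const.add (intervalIntegral.continuous_primitive
    (fun _ _ => hg.integrable.intervalIntegrable) 0)

lemma cdf_nonneg (hg : IsDensityOn l r g) (x : ℝ) : 0 ≤ cdf g x := hg.setIntegral_nonneg _

lemma cdf_le_one (hg : IsDensityOn l r g) (x : ℝ) : cdf g x ≤ 1 := hg.setIntegral_le_one _

lemma cdf_left (hg : IsDensityOn l r g) {x : ℝ} (hx : x ≤ l) : cdf g x = 0 := by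
  refine (setIntegral_congr_fun measurableSet_Iic (g := fun _ => (0 : ℝ)) fun t ht => ?_).trans
    (by simp)
  exact hg.support t fun h => absurd h.1 (not_lt.2 ((mem_Iic.1 ht).trans hx))

lemma cdf_right (hg : IsDensityOn l r g) {x : ℝ} (hx : r ≤ x) : cdf g x = 1 := by
  have h := hg.setIntegral_add_compl (measurableSet_Iic (a := x))
  have h0 : ∫ t in (Iic x)ᶜ, g t = 0 := by
    refine (setIntegral_congr_fun measurableSet_Iic.compl (g := fun _ => (0 : ℝ))
      fun t ht => ?_).trans (by simp)
    rw [compl_Iic, mem_Ioi] at ht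
    exact hg.support t fun h => absurd h.2 (not_lt.2 (hx.trans ht.le))
  rw [h0, add_zero] at h
  exact h

/-- The infimum is attained because the distribution function is continuous. The restriction to `0 <
u < 1` makes the defining set bounded below and nonempty. -/
lemma quantile_le_iff (hg : IsDensityOn l r g) {u : ℝ} (hu : u ∈ Ioo (0 : ℝ) 1) (x : ℝ) :
    quantile g u ≤ x ↔ u ≤ cdf g x := by
  have hbdd : BddBelow {x | u ≤ cdf g x} := by
    refine ⟨l, fun y hy => ?_⟩
    by_contra h
    rw [mem_ofPred_eq, hg.cdf_left (not_le.1 h).le] at hy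
    exact absurd hy (not_le.2 hu.1)
  constructor
  · intro h
    have hmem : quantile g u ∈ {x | u ≤ cdf g x} :=
      (isClosed_le continuous_const hg.continuous_cdf).csInf_mem
        ⟨r, by rw [mem_ofPred_eq, hg.cdf_right le_rfl]; exact hu.2.le⟩ hbdd
    exact le_trans hmem (hg.cdf_mono h)
  · exact fun h => csInf_le hbdd h

lemma cdf_quantile (hg : IsDensityOn l r g) {u : ℝ} (hu : u ∈ Ioo (0 : ℝ) 1) :
    cdf g (quantile g u) = u := by
  refine le_antisymm ?_ ((hg.quantile_le_iff hu _).1 le_rfl)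
  obtain ⟨x, -, hx⟩ := intermediate_value_Icc hg.lt.le hg.continuous_cdf.continuousOn
    (show u ∈ Icc (cdf g l) (cdf g r) by
      rw [hg.cdf_left le_rfl, hg.cdf_right le_rfl]; exact Ioo_subset_Icc_self hu)
  exact (hg.cdf_mono ((hg.quantile_le_iff hu x).2 hx.ge)).trans hx.le

lemma aemeasurable_quantile (hg : IsDensityOn l r g) :
    AEMeasurable (quantile g) (volume.restrict (Ioo (0 : ℝ) 1)) := by
  refine aemeasurable_restrict_of_monotoneOn measurableSet_Ioo fun u hu v hv huv => ?_
  rw [hg.quantile_le_iff hu, hg.cdf_quantile hv]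
  exact huv

/-- The quantile function transports the uniform law to the law with density `g`. -/
lemma map_quantile (hg : IsDensityOn l r g) :
    (volume.restrict (Ioo (0 : ℝ) 1)).map (quantile g) =
      volume.withDensity fun x => ENNReal.ofReal (g x) := by
  have : IsFiniteMeasure ((volume.restrict (Ioo (0 : ℝ) 1)).map (quantile g)) :=
    Measure.isFiniteMeasure_map _ _
  have : IsFiniteMeasure (volume.withDensity fun x => ENNReal.ofReal (g x)) :=
    isFiniteMeasure_withDensity_ofReal hg.integrable.2
  -- Both finite measures give the half-line up to `x` the mass `cdf g x`.
  refine Measure.ext_of_Iic _ _ fun x => ?_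
  rw [Measure.map_apply_of_aemeasurable hg.aemeasurable_quantile measurableSet_Iic,
    withDensity_apply _ measurableSet_Iic,
    ← ofReal_integral_eq_lintegral_ofReal hg.integrable.integrableOn
      (Filter.Eventually.of_forall hg.nonneg),
    Measure.restrict_apply₀' measurableSet_Ioo.nullMeasurableSet]
  have h1 : quantile g ⁻¹' Iic x ∩ Ioo 0 1 = Iic (cdf g x) ∩ Ioo 0 1 := by
    ext u
    simp only [mem_inter_iff, mem_preimage, mem_Iic]
    exact and_congr_left fun hu => hg.quantile_le_iff hu x
  rw [h1, measure_congr ((ae_eq_refl _).inter Ioo_ae_eq_Ioc), inter_comm, Ioc_inter_Iic,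
    Real.volume_Ioc, min_eq_right (hg.cdf_le_one x), sub_zero]
  rfl

lemma integral_comp_quantile (hg : IsDensityOn l r g) {G : ℝ → ℝ} (hG : Measurable G) :
    ∫ u in Ioo (0 : ℝ) 1, G (quantile g u) = ∫ x, G x * g x := by
  rw [← integral_map hg.aemeasurable_quantile hG.aestronglyMeasurable, hg.map_quantile,
    integral_withDensity_eq_integral_toReal_smul hg.measurable.ennreal_ofReal
      (Filter.Eventually.of_forall fun _ => ENNReal.ofReal_lt_top)]
  refine integral_congr_ae (Filter.Eventually.of_forall fun x => ?_)
  simp only [ENNReal.toReal_ofReal (hg.nonneg x), smul_eq_mul, mul_comm]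

end IsDensityOn

/-! ### The posterior of `E*` in the original coordinates. -/

namespace IsBoundedPair

variable {eMin eMax qMin qMax B : ℝ} {W : ℝ → ℝ → ℝ} {p : ℝ → ℝ}

/-- The normalising constant in Bayes' rule is one: the quantile function carries the uniform law to
`p`, so the denominator integrates to `f_Q(q) / f_Q(q)`. -/
lemma starPosterior_eq (h : IsBoundedPair eMin eMax qMin qMax B W p) {qs q : ℝ}
    (hqs : qs ∈ Ioo (0 : ℝ) 1) (hq : quantile (outputDensity W p) qs = q)
    (hf : 0 < outputDensity W p q) :
    starPosterior W p qs =
      (Ioo (0 : ℝ) 1).indicator fun u => W q (quantile p u) / outputDensity W p q := by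
  have h1 : ∀ u, starChannel W p qs u * uniformDensity u =
      (Ioo (0 : ℝ) 1).indicator (fun u => W q (quantile p u) / outputDensity W p q) u := by
    intro u
    by_cases hu : u ∈ Ioo (0 : ℝ) 1
    · rw [starChannel, uniformDensity, indicator_of_mem (mk_mem_prod hqs hu),
        indicator_of_mem hu, indicator_of_mem hu, hq, Pi.one_apply, mul_one]
    · rw [uniformDensity, indicator_of_notMem hu, indicator_of_notMem hu, mul_zero]
  have hm : Measurable fun e => W q e / outputDensity W p q :=
    (h.channel.measurable.comp measurable_prodMk_left).div_const _
  have h2 : outputDensity (starChannel W p) uniformDensity qs = 1 := by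
    have : outputDensity (starChannel W p) uniformDensity qs =
        ∫ u in Ioo (0 : ℝ) 1, W q (quantile p u) / outputDensity W p q := by
      rw [← integral_indicator measurableSet_Ioo]
      exact integral_congr_ae (Filter.Eventually.of_forall h1)
    rw [this, h.input.isDensityOn.integral_comp_quantile hm]
    simp only [div_mul_eq_mul_div]
    rw [integral_div]
    exact div_self hf.ne'
  funext u
  rw [starPosterior, posterior, h2, div_one, h1]

lemma starMean_eq (h : IsBoundedPair eMin eMax qMin qMax B W p) {qs q : ℝ}
    (hqs : qs ∈ Ioo (0 : ℝ) 1) (hq : quantile (outputDensity W p) qs = q)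
    (hf : 0 < outputDensity W p q) :
    starMean W p qs = ∫ e, cdf p e * (W q e / outputDensity W p q) * p e := by
  have hp := h.input.isDensityOn
  have hm : Measurable fun e => cdf p e * (W q e / outputDensity W p q) :=
    hp.continuous_cdf.measurable.mul
      ((h.channel.measurable.comp measurable_prodMk_left).div_const _)
  rw [← hp.integral_comp_quantile hm, starMean, h.starPosterior_eq hqs hq hf,
    ← integral_indicator measurableSet_Ioo]
  refine integral_congr_ae (Filter.Eventually.of_forall fun u => ?_)
  by_cases hu : u ∈ Ioo (0 : ℝ) 1
  · simp only [indicator_of_mem hu, hp.cdf_quantile hu]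
  · simp only [indicator_of_notMem hu, mul_zero]

/-- In the variable `e` the entropy becomes minus the relative entropy of the posterior of `E` to
its prior `p`. -/
lemma log_two_mul_starEntropy (h : IsBoundedPair eMin eMax qMin qMax B W p) {qs q : ℝ}
    (hqs : qs ∈ Ioo (0 : ℝ) 1) (hq : quantile (outputDensity W p) qs = q)
    (hf : 0 < outputDensity W p q) :
    Real.log 2 * starEntropy W p qs = -∫ e, W q e / outputDensity W p q *
      Real.log (W q e / outputDensity W p q) * p e := by
  have hp := h.input.isDensityOn
  have hm0 : Measurable fun e => W q e / outputDensity W p q :=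
    (h.channel.measurable.comp measurable_prodMk_left).div_const _
  have hm := hm0.mul (Real.measurable_log.comp hm0)
  have h2 : Real.log 2 ≠ 0 := (Real.log_pos one_lt_two).ne'
  rw [starEntropy, entropy_eq_neg_div, mul_div_cancel₀ _ h2, h.starPosterior_eq hqs hq hf]
  congr 1
  refine Eq.trans ?_ (hp.integral_comp_quantile hm)
  rw [← integral_indicator measurableSet_Ioo]
  refine integral_congr_ae (Filter.Eventually.of_forall fun u => ?_)
  by_cases hu : u ∈ Ioo (0 : ℝ) 1
  · simp only [indicator_of_mem hu]
  · simp only [indicator_of_notMem hu, zero_mul]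

end IsBoundedPair

/-! ### Calculus of multiplicative errors. -/

/-- `x` agrees with `y` up to a factor between `exp (-ε)` and `exp ε`. -/
def LogNear (ε x y : ℝ) : Prop := Real.exp (-ε) * y ≤ x ∧ x ≤ Real.exp ε * y

namespace LogNear

variable {ε ε' x x' y y' : ℝ}

lemma mono (h : LogNear ε x y) (hε : ε ≤ ε') (hy : 0 ≤ y) : LogNear ε' x y :=
  ⟨le_trans (by gcongr) h.1, h.2.trans (by gcongr)⟩

lemma mul (h : LogNear ε x y) (h' : LogNear ε' x' y') (hy : 0 ≤ y) (hy' : 0 ≤ y') :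
    LogNear (ε + ε') (x * x') (y * y') := by
  have hx : 0 ≤ x := le_trans (by positivity) h.1
  constructor
  · rw [neg_add, Real.exp_add, mul_mul_mul_comm]
    exact mul_le_mul h.1 h'.1 (by positivity) hx
  · rw [Real.exp_add, mul_mul_mul_comm]
    exact mul_le_mul h.2 h'.2 (le_trans (by positivity) h'.1) (by positivity)

lemma pos (h : LogNear ε x y) (hy : 0 < y) : 0 < x := lt_of_lt_of_le (by positivity) h.1

lemma inv (h : LogNear ε x y) (hy : 0 < y) : LogNear ε x⁻¹ y⁻¹ := by
  have hx := h.pos hy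
  constructor
  · rw [Real.exp_neg, ← mul_inv]
    exact inv_anti₀ hx h.2
  · have := inv_anti₀ (by positivity) h.1
    rwa [mul_inv, ← Real.exp_neg, neg_neg] at this

lemma div (h : LogNear ε x y) (h' : LogNear ε' x' y') (hy : 0 ≤ y) (hy' : 0 < y') :
    LogNear (ε + ε') (x / x') (y / y') := by
  rw [div_eq_mul_inv, div_eq_mul_inv]
  exact h.mul (h'.inv hy') hy (inv_nonneg.2 hy'.le)

lemma trans {z : ℝ} (h : LogNear ε x y) (h' : LogNear ε' y z) : LogNear (ε + ε') x z := by
  constructor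
  · rw [neg_add, Real.exp_add, mul_assoc]
    exact (mul_le_mul_of_nonneg_left h'.1 (Real.exp_pos _).le).trans h.1
  · rw [Real.exp_add, mul_assoc]
    exact h.2.trans (mul_le_mul_of_nonneg_left h'.2 (Real.exp_pos _).le)

lemma of_abs_sub_le (h : |x - y| ≤ ε * y) (hy : 0 ≤ y) (hε : 0 ≤ ε) (hε' : ε ≤ 1 / 2) :
    LogNear (2 * ε) x y := by
  have h2 : 1 + 2 * ε ≤ Real.exp (2 * ε) := by linarith [Real.add_one_le_exp (2 * ε)]
  -- This amounts to `(1 - ε) (1 + 2 ε) ≥ 1`, which is where `ε ≤ 1 / 2` enters.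
  have h3 : Real.exp (-(2 * ε)) ≤ 1 - ε := by
    rw [Real.exp_neg, inv_le_comm₀ (Real.exp_pos _) (by linarith)]
    refine le_trans ?_ h2
    rw [inv_le_iff_one_le_mul₀ (by linarith)]
    nlinarith
  rw [abs_le] at h
  constructor
  · nlinarith [mul_le_mul_of_nonneg_right h3 hy]
  · nlinarith [mul_le_mul_of_nonneg_right h2 hy]

lemma refl (y : ℝ) : LogNear 0 y y := by simp [LogNear]

lemma of_abs_log_sub_le (hx : 0 < x) (hy : 0 < y) (h : |Real.log x - Real.log y| ≤ ε) :
    LogNear ε x y := by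
  rw [abs_le] at h
  constructor
  · calc Real.exp (-ε) * y = Real.exp (-ε + Real.log y) := by rw [Real.exp_add, Real.exp_log hy]
      _ ≤ Real.exp (Real.log x) := Real.exp_le_exp.2 (by linarith)
      _ = x := Real.exp_log hx
  · calc x = Real.exp (Real.log x) := (Real.exp_log hx).symm
      _ ≤ Real.exp (ε + Real.log y) := Real.exp_le_exp.2 (by linarith)
      _ = Real.exp ε * y := by rw [Real.exp_add, Real.exp_log hy]

lemma abs_log_sub_le (h : LogNear ε x y) (hy : 0 < y) : |Real.log x - Real.log y| ≤ ε := by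
  have hx := h.pos hy
  have h1 := Real.log_le_log (by positivity) h.1
  have h2 := Real.log_le_log hx h.2
  rw [Real.log_mul (Real.exp_ne_zero _) hy.ne', Real.log_exp] at h1 h2
  rw [abs_le]
  constructor <;> linarith

lemma abs_sub_le (h : LogNear ε x y) (hy : 0 ≤ y) : |x - y| ≤ ε * Real.exp ε * y := by
  have h1 : Real.exp ε - 1 ≤ ε * Real.exp ε := by
    have := Real.add_one_le_exp (-ε)
    have h2 : Real.exp (-ε) * Real.exp ε = 1 := by rw [← Real.exp_add]; simp
    nlinarith [Real.exp_pos ε]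
  have h3 : 1 - Real.exp (-ε) ≤ Real.exp ε - 1 := by
    have h2 : Real.exp (-ε) * Real.exp ε = 1 := by rw [← Real.exp_add]; simp
    nlinarith [sq_nonneg (Real.exp ε - 1), Real.exp_pos ε, Real.exp_pos (-ε),
      sq_nonneg (Real.exp ε - Real.exp (-ε)), sq_nonneg (Real.exp ε + Real.exp (-ε) - 2)]
  rw [abs_le]
  constructor
  · nlinarith [h.1, mul_le_mul_of_nonneg_right h1 hy, mul_le_mul_of_nonneg_right h3 hy]
  · nlinarith [h.2, mul_le_mul_of_nonneg_right h1 hy]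

/-- Multiplicative errors in the weight and additive errors in the logarithm. -/
lemma abs_mul_sub_mul_log_le {v l t : ℝ} (hw : LogNear ε x v) (hv : 0 ≤ v)
    (hl : 0 < v → |l - Real.log t| ≤ ε) :
    |x * l - v * Real.log t| ≤ ε * Real.exp ε * (v * (1 + |Real.log t|)) := by
  -- If `v = 0` then `x = 0` too, so nothing is asked of the logarithm there; this covers points
  -- where the densities vanish.
  rcases hv.eq_or_lt with rfl | hv
  · have : x = 0 := le_antisymm (by simpa using hw.2) (by simpa using hw.1)
    simp [this]
  have h1 := hw.abs_sub_le hv.le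
  have h2 := hl hv
  have h3 : x * l - v * Real.log t = (x - v) * Real.log t + x * (l - Real.log t) := by ring
  have hx := hw.pos hv
  have hε : 0 ≤ ε := (abs_nonneg _).trans h2
  calc |x * l - v * Real.log t| ≤ |x - v| * |Real.log t| + x * |l - Real.log t| := by
        rw [h3]
        refine (abs_add_le _ _).trans ?_
        rw [abs_mul, abs_mul, abs_of_pos hx]
    _ ≤ ε * Real.exp ε * v * |Real.log t| + Real.exp ε * v * ε := by
        gcongr
        exact hw.2
    _ = _ := by ring

end LogNear

/-! ### Integrability of the error weight and tails. -/

/-- A function that decays like `|x| ^ (-3)` has a finite entropy integral, even with an extra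
factor `1 + |x|`. -/
lemma mul_one_add_abs_log_le {K t x : ℝ} (hK : 1 ≤ K) (ht : 0 ≤ t) (h : t ≤ K / (1 + |x|) ^ 3) :
    (1 + |x|) * (t * (1 + |Real.log t|)) ≤ (7 + K) * K * (1 + |x|) ^ (-(3 / 2) : ℝ) := by
  set y := 1 + |x| with hy
  have hy1 : 1 ≤ y := by rw [hy]; linarith [abs_nonneg x]
  have hy0 : 0 < y := by linarith
  have hK0 : 0 ≤ K := by linarith
  have h52 : K / y ^ 3 ≤ K * y ^ (-(5 / 2) : ℝ) := by
    rw [div_eq_mul_inv, ← Real.rpow_natCast y 3, ← Real.rpow_neg hy0.le]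
    refine mul_le_mul_of_nonneg_left (Real.rpow_le_rpow_of_exponent_le hy1 ?_) hK0
    norm_num
  have ht1 : t ≤ K * y ^ (-(5 / 2) : ℝ) := h.trans h52
  have hr0 : 0 ≤ y ^ (-(5 / 2) : ℝ) := by positivity
  have hr1 : y ^ (-(5 / 2) : ℝ) ≤ 1 := Real.rpow_le_one_of_one_le_of_nonpos hy1 (by norm_num)
  have key : t * (1 + |Real.log t|) ≤ (7 + K) * K * y ^ (-(5 / 2) : ℝ) := by
    rcases ht.eq_or_lt with rfl | h0
    · simp only [zero_mul]; positivity
    rcases le_or_gt t 1 with h1 | h1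
    -- The logarithm costs a power `t ^ (1/6)`. The remaining `t ^ (5/6)` decays like `y ^ (-5/2)`,
    -- so after multiplication by `y` the exponent `-3/2` is still integrable.
    · have h2 := (Real.abs_log_mul_self_rpow_lt t (1 / 6) h0 h1 (by norm_num)).le
      rw [abs_mul, abs_of_nonneg (Real.rpow_nonneg ht _)] at h2
      have h3 : t = t ^ (1 / 6 : ℝ) * t ^ (5 / 6 : ℝ) := by
        rw [← Real.rpow_add h0]; norm_num
      have h4 : t ^ (5 / 6 : ℝ) ≤ K * y ^ (-(5 / 2) : ℝ) := by
        calc t ^ (5 / 6 : ℝ) ≤ (K / y ^ 3) ^ (5 / 6 : ℝ) :=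
              Real.rpow_le_rpow ht h (by norm_num)
          _ = K ^ (5 / 6 : ℝ) * y ^ (-(5 / 2) : ℝ) := by
              rw [Real.div_rpow hK0 (by positivity), ← Real.rpow_natCast y 3,
                ← Real.rpow_mul hy0.le, div_eq_mul_inv, ← Real.rpow_neg hy0.le]
              norm_num
          _ ≤ K * y ^ (-(5 / 2) : ℝ) := by
              refine mul_le_mul_of_nonneg_right ?_ hr0
              calc K ^ (5 / 6 : ℝ) ≤ K ^ (1 : ℝ) :=
                    Real.rpow_le_rpow_of_exponent_le hK (by norm_num)
                _ = K := Real.rpow_one K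
      have h5 : t * |Real.log t| ≤ 6 * (K * y ^ (-(5 / 2) : ℝ)) := by
        calc t * |Real.log t| = |Real.log t| * t ^ (1 / 6 : ℝ) * t ^ (5 / 6 : ℝ) := by
              rw [mul_assoc, ← h3, mul_comm]
          _ ≤ 6 * (K * y ^ (-(5 / 2) : ℝ)) := by
              refine mul_le_mul (h2.trans (by norm_num)) h4 (by positivity) (by norm_num)
      nlinarith [mul_nonneg (mul_nonneg hK0 hK0) hr0]
    · have h2 : |Real.log t| ≤ K := by
        rw [abs_of_nonneg (Real.log_nonneg h1.le)]
        have := Real.log_le_sub_one_of_pos h0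
        have : K * y ^ (-(5 / 2) : ℝ) ≤ K := mul_le_of_le_one_right hK0 hr1
        linarith
      calc t * (1 + |Real.log t|) ≤ K * y ^ (-(5 / 2) : ℝ) * (1 + K) := by gcongr
        _ ≤ _ := by nlinarith [mul_nonneg hK0 hr0]
  calc y * (t * (1 + |Real.log t|)) ≤ y * ((7 + K) * K * y ^ (-(5 / 2) : ℝ)) := by gcongr
    _ = (7 + K) * K * (y ^ (1 : ℝ) * y ^ (-(5 / 2) : ℝ)) := by rw [Real.rpow_one]; ring
    _ = _ := by rw [← Real.rpow_add hy0]; norm_num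

/-- The bound on `∫ (1 + |x|) φ (1 + |log φ|)` for a density with `φ ≤ K / (1 + |x|) ^ 3`. -/
noncomputable def tailConst (K : ℝ) : ℝ := ∫ x : ℝ, (7 + K) * K * (1 + |x|) ^ (-(3 / 2) : ℝ)

lemma integrable_tail (K : ℝ) :
    Integrable fun x : ℝ => (7 + K) * K * (1 + |x|) ^ (-(3 / 2) : ℝ) := by
  have := integrable_one_add_norm (E := ℝ) (μ := volume) (r := 3 / 2)
    (by rw [Module.finrank_self]; norm_num)
  exact this.const_mul _

/-- The weight that dominates all errors in the standardised coordinate. -/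
noncomputable def errWeight (φ : ℝ → ℝ) (x : ℝ) : ℝ := (1 + |x|) * (φ x * (1 + |Real.log (φ x)|))

section Weight

variable {K : ℝ} {φ : ℝ → ℝ}

lemma tailConst_nonneg (hK : 1 ≤ K) : 0 ≤ tailConst K :=
  integral_nonneg fun x => by
    have := abs_nonneg x
    have : 0 ≤ K := by linarith
    simp only [Pi.zero_apply]
    positivity

lemma errWeight_nonneg (h0 : ∀ x, 0 ≤ φ x) (x : ℝ) : 0 ≤ errWeight φ x := by
  have := h0 x
  unfold errWeight
  positivity

lemma integrable_errWeight (hK : 1 ≤ K) (hm : Measurable φ) (h0 : ∀ x, 0 ≤ φ x)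
    (h : ∀ x, φ x ≤ K / (1 + |x|) ^ 3) : Integrable (errWeight φ) := by
  refine Integrable.mono' (integrable_tail K) ?_ (Filter.Eventually.of_forall fun x => ?_)
  · unfold errWeight
    have := Real.measurable_log.comp hm
    have h2 : Measurable fun x => |Real.log (φ x)| := by
      simpa [Real.norm_eq_abs] using this.norm
    exact ((measurable_norm.const_add 1).mul (hm.mul (h2.const_add 1))).aestronglyMeasurable
  · rw [Real.norm_of_nonneg (errWeight_nonneg h0 x)]
    exact mul_one_add_abs_log_le hK (h0 x) (h x)

lemma integral_errWeight_le (hK : 1 ≤ K) (hm : Measurable φ) (h0 : ∀ x, 0 ≤ φ x)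
    (h : ∀ x, φ x ≤ K / (1 + |x|) ^ 3) : ∫ x, errWeight φ x ≤ tailConst K :=
  integral_mono (integrable_errWeight hK hm h0 h) (integrable_tail K) fun x =>
    mul_one_add_abs_log_le hK (h0 x) (h x)

/-- The extra factor `1 + |x|` in the weight serves two purposes: relative errors at `x` are of
order `s (1 + |x|)`, and it pays for the truncation of integrals. -/
lemma abs_mul_log_le_errWeight (h0 : ∀ x, 0 ≤ φ x) (x : ℝ) :
    |φ x * Real.log (φ x)| ≤ errWeight φ x := by
  have h1 := h0 x
  rw [abs_mul, abs_of_nonneg h1]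
  unfold errWeight
  have h2 : φ x * |Real.log (φ x)| ≤ φ x * (1 + |Real.log (φ x)|) := by gcongr; linarith
  exact h2.trans (le_mul_of_one_le_left (by positivity) (by linarith [abs_nonneg x]))

lemma one_add_abs_mul_le_errWeight (h0 : ∀ x, 0 ≤ φ x) (x : ℝ) :
    (1 + |x|) * φ x ≤ errWeight φ x := by
  have h1 := h0 x
  unfold errWeight
  have h2 : φ x ≤ φ x * (1 + |Real.log (φ x)|) :=
    le_mul_of_one_le_right h1 (by linarith [abs_nonneg (Real.log (φ x))])
  gcongr

lemma integrable_mul_log_of_errWeight (hK : 1 ≤ K) (hm : Measurable φ) (h0 : ∀ x, 0 ≤ φ x)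
    (h : ∀ x, φ x ≤ K / (1 + |x|) ^ 3) : Integrable fun x => φ x * Real.log (φ x) :=
  Integrable.mono' (integrable_errWeight hK hm h0 h)
    (hm.mul (Real.measurable_log.comp hm)).aestronglyMeasurable
    (Filter.Eventually.of_forall fun x => abs_mul_log_le_errWeight h0 x)

/-- Truncating `∫ G` to `[-T, T]` costs `O(1 / T)` if `(1 + |x|) |G|` is bounded by the weight. -/
lemma abs_integral_sub_setIntegral_le (hK : 1 ≤ K) (hm : Measurable φ) (h0 : ∀ x, 0 ≤ φ x)
    (h : ∀ x, φ x ≤ K / (1 + |x|) ^ 3) {G : ℝ → ℝ} (hGi : Integrable G)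
    (hG : ∀ x, (1 + |x|) * |G x| ≤ errWeight φ x) {T : ℝ} (hT : 0 < T) :
    |(∫ x, G x) - ∫ x in Icc (-T) T, G x| ≤ tailConst K / T := by
  rw [← integral_add_compl (measurableSet_Icc (a := -T) (b := T)) hGi, add_sub_cancel_left,
    le_div_iff₀ hT, mul_comm]
  have hw := integrable_errWeight hK hm h0 h
  calc T * |∫ x in (Icc (-T) T)ᶜ, G x| ≤ T * ∫ x in (Icc (-T) T)ᶜ, |G x| := by
        gcongr
        exact abs_integral_le_integral_abs
    _ = ∫ x in (Icc (-T) T)ᶜ, T * |G x| := (integral_const_mul _ _).symm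
    _ ≤ ∫ x in (Icc (-T) T)ᶜ, errWeight φ x := by
        refine setIntegral_mono_on (hGi.abs.integrableOn.const_mul T) hw.integrableOn
          measurableSet_Icc.compl fun x hx => ?_
        have hx' : T < |x| := by
          rw [mem_compl_iff, mem_Icc, ← abs_le] at hx
          exact not_le.1 hx
        refine le_trans ?_ (hG x)
        gcongr
        linarith
    _ ≤ ∫ x, errWeight φ x :=
        setIntegral_le_integral hw (Filter.Eventually.of_forall (errWeight_nonneg h0))
    _ ≤ tailConst K := integral_errWeight_le hK hm h0 h

end Weight

/-! ### First consequences of the slow-change regime. -/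

/-- The slow-change regime together with its elementary consequences: the widths are positive and
comparable to `s = σ_max`, and on `[a, b]` the derivative of the mean and the input density are
bounded above and below. -/
structure SlowRegime (eMin eMax qMin qMax a b K L M P₀ P₁ s : ℝ) (W : ℝ → ℝ → ℝ) (p : ℝ → ℝ) :
    Prop where
  channel : IsChannel eMin eMax qMin qMax W
  input : IsInputDensity eMin eMax p
  slow : IsSlowChange eMin eMax qMin qMax a b K L W p
  left_lt : eMin < a
  lt : a < b
  lt_right : b < eMax
  one_le : 1 ≤ K
  nonneg : 0 ≤ L
  maxSD_eq : maxSD eMin eMax W = s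
  pos : 0 < s
  deriv_le : ∀ e ∈ Icc a b, deriv (condMean W) e ≤ M
  input_pos : 0 < P₀
  input_ge : ∀ e ∈ Icc a b, P₀ ≤ p e
  input_le : ∀ e ∈ Icc a b, p e ≤ P₁

namespace SlowRegime

variable {eMin eMax qMin qMax a b K L M P₀ P₁ s : ℝ} {W : ℝ → ℝ → ℝ} {p : ℝ → ℝ}

lemma K_pos (h : SlowRegime eMin eMax qMin qMax a b K L M P₀ P₁ s W p) : 0 < K :=
  zero_lt_one.trans_le h.one_le

lemma mem_Ioo (h : SlowRegime eMin eMax qMin qMax a b K L M P₀ P₁ s W p) {e : ℝ}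
    (he : e ∈ Icc a b) : e ∈ Ioo eMin eMax :=
  ⟨h.left_lt.trans_le he.1, he.2.trans_lt h.lt_right⟩

lemma sd_pos (h : SlowRegime eMin eMax qMin qMax a b K L M P₀ P₁ s W p) {e : ℝ}
    (he : e ∈ Ioo eMin eMax) : 0 < condSD W e := h.channel.condSD_pos he

lemma sd_le (h : SlowRegime eMin eMax qMin qMax a b K L M P₀ P₁ s W p) {e : ℝ}
    (he : e ∈ Ioo eMin eMax) : condSD W e ≤ s :=
  h.maxSD_eq ▸ h.channel.condSD_le_maxSD he

lemma le_sd (h : SlowRegime eMin eMax qMin qMax a b K L M P₀ P₁ s W p) {e : ℝ}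
    (he : e ∈ Ioo eMin eMax) : s ≤ K * condSD W e :=
  h.maxSD_eq ▸ h.slow.sd_comparable e he

lemma shape_nonneg (h : SlowRegime eMin eMax qMin qMax a b K L M P₀ P₁ s W p) {e : ℝ}
    (he : e ∈ Ioo eMin eMax) (x : ℝ) : 0 ≤ shape W x e := h.channel.shape_nonneg he x

lemma cond_le (h : SlowRegime eMin eMax qMin qMax a b K L M P₀ P₁ s W p) {e : ℝ}
    (he : e ∈ Ioo eMin eMax) (q : ℝ) : W q e ≤ K ^ 2 / s := by
  have h1 := h.sd_pos he
  have h2 := h.slow.shape_le e he ((q - condMean W e) / condSD W e)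
  rw [h.channel.apply_eq_shape_div he q, div_le_div_iff₀ h1 h.pos]
  have h3 : shape W ((q - condMean W e) / condSD W e) e ≤ K := by
    refine h2.trans (div_le_self h.K_pos.le (one_le_pow₀ ?_))
    linarith [abs_nonneg ((q - condMean W e) / condSD W e)]
  calc _ ≤ K * (K * condSD W e) := mul_le_mul h3 (h.le_sd he) h.pos.le h.K_pos.le
    _ = _ := by ring

lemma isBoundedPair (h : SlowRegime eMin eMax qMin qMax a b K L M P₀ P₁ s W p) :
    IsBoundedPair eMin eMax qMin qMax (K ^ 2 / s) W p :=
  ⟨h.channel, h.input, fun _ he q => h.cond_le he q⟩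

/-- The factor `1 / σ` is absorbed by the cubic decay: `(1 / σ) K (σ / d) ^ 3 = K σ ^ 2 / d ^ 3`.
Hence distant inputs contribute to second order in `s`. -/
lemma cond_le_of_far (h : SlowRegime eMin eMax qMin qMax a b K L M P₀ P₁ s W p) {e : ℝ}
    (he : e ∈ Ioo eMin eMax) {q d : ℝ} (hd : 0 < d) (hq : d ≤ |q - condMean W e|) :
    W q e ≤ K * s ^ 2 / d ^ 3 := by
  have h1 := h.sd_pos he
  have hK := h.K_pos
  have h2 := h.slow.shape_le e he ((q - condMean W e) / condSD W e)
  rw [abs_div, abs_of_pos h1] at h2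
  have h3 : K / (1 + |q - condMean W e| / condSD W e) ^ 3 ≤ K / (d / condSD W e) ^ 3 := by
    gcongr
    have : d / condSD W e ≤ |q - condMean W e| / condSD W e := by gcongr
    linarith
  rw [h.channel.apply_eq_shape_div he q, div_le_iff₀ h1]
  refine h2.trans (h3.trans ?_)
  have := h.sd_le he
  calc K / (d / condSD W e) ^ 3 = K * condSD W e ^ 2 / d ^ 3 * condSD W e := by field_simp
    _ ≤ K * s ^ 2 / d ^ 3 * condSD W e := by gcongr

lemma continuousOn_mean (h : SlowRegime eMin eMax qMin qMax a b K L M P₀ P₁ s W p) :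
    ContinuousOn (condMean W) (Icc a b) := fun e he =>
  (h.slow.mean_diff e he).continuousAt.continuousWithinAt

lemma continuousOn_sd (h : SlowRegime eMin eMax qMin qMax a b K L M P₀ P₁ s W p) :
    ContinuousOn (condSD W) (Icc a b) := fun e he =>
  (h.slow.sd_diff e he).continuousAt.continuousWithinAt

lemma sub_le_mul_mean_sub (h : SlowRegime eMin eMax qMin qMax a b K L M P₀ P₁ s W p) {e e' : ℝ}
    (he : e ∈ Icc a b) (he' : e' ∈ Icc a b) (hle : e ≤ e') :
    e' - e ≤ K * (condMean W e' - condMean W e) := by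
  have := (convex_Icc a b).mul_sub_le_image_sub_of_le_deriv h.continuousOn_mean
    (fun x hx => (h.slow.mean_diff x (interior_subset hx)).differentiableWithinAt)
    (fun x hx => h.slow.mean_deriv_ge x (interior_subset hx)) e he e' he' hle
  have hK := h.K_pos
  rw [div_mul_eq_mul_div, one_mul, div_le_iff₀ hK] at this
  linarith

lemma mean_sub_le_mul_sub (h : SlowRegime eMin eMax qMin qMax a b K L M P₀ P₁ s W p) {e e' : ℝ}
    (he : e ∈ Icc a b) (he' : e' ∈ Icc a b) (hle : e ≤ e') :
    condMean W e' - condMean W e ≤ M * (e' - e) :=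
  (convex_Icc a b).image_sub_le_mul_sub_of_deriv_le h.continuousOn_mean
    (fun x hx => (h.slow.mean_diff x (interior_subset hx)).differentiableWithinAt)
    (fun x hx => h.deriv_le x (interior_subset hx)) e he e' he' hle

lemma abs_sub_le (h : SlowRegime eMin eMax qMin qMax a b K L M P₀ P₁ s W p) {e e' : ℝ}
    (he : e ∈ Icc a b) (he' : e' ∈ Icc a b) :
    |e - e'| ≤ K * |condMean W e - condMean W e'| := by
  have hK := h.K_pos
  rcases le_total e e' with hle | hle
  · rw [abs_sub_comm, abs_of_nonneg (sub_nonneg.2 hle), abs_sub_comm]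
    exact (h.sub_le_mul_mean_sub he he' hle).trans (by gcongr; exact le_abs_self _)
  · rw [abs_of_nonneg (sub_nonneg.2 hle)]
    exact (h.sub_le_mul_mean_sub he' he hle).trans (by gcongr; exact le_abs_self _)

lemma deriv_pos (h : SlowRegime eMin eMax qMin qMax a b K L M P₀ P₁ s W p) {e : ℝ}
    (he : e ∈ Icc a b) : 0 < deriv (condMean W) e :=
  lt_of_lt_of_le (one_div_pos.2 h.K_pos) (h.slow.mean_deriv_ge e he)

lemma M_pos (h : SlowRegime eMin eMax qMin qMax a b K L M P₀ P₁ s W p) : 0 < M :=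
  (h.deriv_pos (left_mem_Icc.2 h.lt.le)).trans_le (h.deriv_le a (left_mem_Icc.2 h.lt.le))

lemma input_apply_pos (h : SlowRegime eMin eMax qMin qMax a b K L M P₀ P₁ s W p) {e : ℝ}
    (he : e ∈ Icc a b) : 0 < p e := h.input_pos.trans_le (h.input_ge e he)

lemma P₁_pos (h : SlowRegime eMin eMax qMin qMax a b K L M P₀ P₁ s W p) : 0 < P₁ :=
  (h.input_apply_pos (left_mem_Icc.2 h.lt.le)).trans_le (h.input_le a (left_mem_Icc.2 h.lt.le))

/-- The one-sided hypothesis is symmetric in the two points, so exchanging them gives the other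
side. -/
lemma logNear_of_slow {f : ℝ → ℝ}
    (hf : ∀ e ∈ Icc a b, ∀ e' ∈ Icc a b, f e ≤ Real.exp (L * |e - e'|) * f e') {e e' : ℝ}
    (he : e ∈ Icc a b) (he' : e' ∈ Icc a b) : LogNear (L * |e - e'|) (f e) (f e') := by
  refine ⟨?_, hf e he e' he'⟩
  have := hf e' he' e he
  rw [abs_sub_comm] at this
  rw [Real.exp_neg, inv_mul_le_iff₀ (Real.exp_pos _)]
  exact this

lemma logNear_deriv (h : SlowRegime eMin eMax qMin qMax a b K L M P₀ P₁ s W p) {e e' : ℝ}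
    (he : e ∈ Icc a b) (he' : e' ∈ Icc a b) :
    LogNear (L * |e - e'|) (deriv (condMean W) e) (deriv (condMean W) e') :=
  logNear_of_slow h.slow.mean_deriv_slow he he'

lemma logNear_input (h : SlowRegime eMin eMax qMin qMax a b K L M P₀ P₁ s W p) {e e' : ℝ}
    (he : e ∈ Icc a b) (he' : e' ∈ Icc a b) : LogNear (L * |e - e'|) (p e) (p e') :=
  logNear_of_slow h.slow.input_slow he he'

lemma logNear_shape (h : SlowRegime eMin eMax qMin qMax a b K L M P₀ P₁ s W p) {e e' x : ℝ}
    (he : e ∈ Icc a b) (he' : e' ∈ Icc a b)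
    (hx : condMean W e + condSD W e * x ∈ Ioo qMin qMax)
    (hx' : condMean W e' + condSD W e' * x ∈ Ioo qMin qMax) :
    LogNear (L * |e - e'|) (shape W x e) (shape W x e') := by
  refine ⟨?_, h.slow.shape_slow e he e' he' x hx hx'⟩
  have := h.slow.shape_slow e' he' e he x hx' hx
  rw [abs_sub_comm] at this
  rw [Real.exp_neg, inv_mul_le_iff₀ (Real.exp_pos _)]
  exact this

/-- The logarithm of `σ` has derivative at most `L` in absolute value, so the mean value inequality
applies. -/
lemma logNear_sd (h : SlowRegime eMin eMax qMin qMax a b K L M P₀ P₁ s W p) {e e' : ℝ}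
    (he : e ∈ Icc a b) (he' : e' ∈ Icc a b) :
    LogNear (L * |e - e'|) (condSD W e) (condSD W e') := by
  refine LogNear.of_abs_log_sub_le (h.sd_pos (h.mem_Ioo he)) (h.sd_pos (h.mem_Ioo he')) ?_
  have hd : ∀ x ∈ Icc a b, HasDerivWithinAt (fun e => Real.log (condSD W e))
      (deriv (condSD W) x / condSD W x) (Icc a b) x := fun x hx =>
    ((h.slow.sd_diff x hx).hasDerivAt.log (h.sd_pos (h.mem_Ioo hx)).ne').hasDerivWithinAt
  have := (convex_Icc a b).norm_image_sub_le_of_norm_hasDerivWithin_le (C := L) hd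
    (fun x hx => by
      rw [Real.norm_eq_abs, abs_div, abs_of_pos (h.sd_pos (h.mem_Ioo hx)),
        div_le_iff₀ (h.sd_pos (h.mem_Ioo hx))]
      exact h.slow.sd_slow x hx) he' he
  simpa [Real.norm_eq_abs] using this

lemma setIntegral_le_of_far (h : SlowRegime eMin eMax qMin qMax a b K L M P₀ P₁ s W p) {e : ℝ}
    (he : e ∈ Ioo eMin eMax) {d : ℝ} (hd : 0 < d) {S : Set ℝ} (hS : MeasurableSet S)
    (hfar : ∀ q ∈ S, d ≤ |q - condMean W e|) : ∫ q in S, W q e ≤ s ^ 2 / d ^ 2 :=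
  h.maxSD_eq ▸ h.channel.setIntegral_le_of_far he hd hS hfar

lemma mean_le_of_le (h : SlowRegime eMin eMax qMin qMax a b K L M P₀ P₁ s W p) {e e' : ℝ}
    (he : e ∈ Ioo eMin eMax) (he' : e' ∈ Ioo eMin eMax) (hle : e ≤ e') :
    condMean W e ≤ condMean W e' := h.slow.mean_mono he he' hle

end SlowRegime

/-- `q` is the mean `m(e)` of `Q` for some `e` in `[a, b]`, at distance at least `c` inside the
interval from `m(a)` to `m(b)`. -/
structure IsInner (a b c : ℝ) (W : ℝ → ℝ → ℝ) (q e : ℝ) : Prop where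
  mem : e ∈ Icc a b
  mean_eq : condMean W e = q
  left : condMean W a + c ≤ q
  right : q ≤ condMean W b - c

namespace SlowRegime

variable {eMin eMax qMin qMax a b c K L M P₀ P₁ s : ℝ} {W : ℝ → ℝ → ℝ} {p : ℝ → ℝ}

lemma exists_isInner (h : SlowRegime eMin eMax qMin qMax a b K L M P₀ P₁ s W p) {q : ℝ}
    (hc : 0 ≤ c) (hl : condMean W a + c ≤ q) (hr : q ≤ condMean W b - c) :
    ∃ e, IsInner a b c W q e := by
  obtain ⟨e, he, hq⟩ := intermediate_value_Icc h.lt.le h.continuousOn_mean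
    (show q ∈ Icc (condMean W a) (condMean W b) by constructor <;> linarith)
  exact ⟨e, he, hq, hl, hr⟩

lemma mean_mem_range (h : SlowRegime eMin eMax qMin qMax a b K L M P₀ P₁ s W p) {e : ℝ}
    (he : e ∈ Icc a b) : condMean W e ∈ Icc qMin qMax := h.channel.condMean_mem (h.mem_Ioo he)

/-- Points at distance less than `c` from an inner point lie in the range of `Q`. -/
lemma mem_range_of_isInner (h : SlowRegime eMin eMax qMin qMax a b K L M P₀ P₁ s W p) {q e q' : ℝ}
    (hi : IsInner a b c W q e) (hq' : |q' - q| < c) : q' ∈ Ioo qMin qMax := by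
  have h1 := (h.mean_mem_range (left_mem_Icc.2 h.lt.le)).1
  have h2 := (h.mean_mem_range (right_mem_Icc.2 h.lt.le)).2
  rw [abs_lt] at hq'
  constructor <;> linarith [hi.left, hi.right]

/-- Values of `E` outside `[a, b]` have means far from an inner point. -/
lemma le_abs_sub_of_notMem (h : SlowRegime eMin eMax qMin qMax a b K L M P₀ P₁ s W p)
    -- Monotonicity of `m` on the whole range of `E` is what controls inputs outside `[a, b]`, where
    -- no slow change is assumed.
    {q e e' : ℝ} (hi : IsInner a b c W q e) (he' : e' ∈ Ioo eMin eMax) (hn : e' ∉ Icc a b) :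
    c ≤ |q - condMean W e'| := by
  rcases lt_or_ge e' a with hlt | hge
  · have := h.mean_le_of_le he' (h.mem_Ioo (left_mem_Icc.2 h.lt.le)) hlt.le
    exact le_trans (by linarith [hi.left]) (le_abs_self _)
  · have hlt : b < e' := by
      by_contra hb
      exact hn ⟨hge, not_lt.1 hb⟩
    have := h.mean_le_of_le (h.mem_Ioo (right_mem_Icc.2 h.lt.le)) he' hlt.le
    exact le_trans (by linarith [hi.right]) (neg_le_abs _)

end SlowRegime

/-! ### The standardised coordinate as a variable of integration. -/

/-- The standardised coordinate of `q` given `E = e`. -/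
noncomputable def stdCoord (W : ℝ → ℝ → ℝ) (q e : ℝ) : ℝ := (q - condMean W e) / condSD W e

/-- Minus the derivative of `stdCoord W q` at `e`. -/
noncomputable def stdSlope (W : ℝ → ℝ → ℝ) (q e : ℝ) : ℝ :=
  (deriv (condMean W) e + stdCoord W q e * deriv (condSD W) e) / condSD W e

/-- The values of `E` in `[a, b]` for which `q` is within `T` standard deviations of the mean. -/
def nearSet (W : ℝ → ℝ → ℝ) (a b q T : ℝ) : Set ℝ := Icc a b ∩ stdCoord W q ⁻¹' Icc (-T) T

/-- A radius `r` around an inner point that is small enough for the standardised coordinate to be a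
monotone function of `e`. -/
structure IsRadius (K L c r : ℝ) : Prop where
  pos : 0 < r
  mul_lt : K * r < c
  slope : K * L * r ≤ 1 / 2

namespace SlowRegime

variable {eMin eMax qMin qMax a b c r K L M P₀ P₁ s : ℝ} {W : ℝ → ℝ → ℝ} {p : ℝ → ℝ}
  {q e₀ e : ℝ}

lemma mul_stdCoord (h : SlowRegime eMin eMax qMin qMax a b K L M P₀ P₁ s W p)
    (he : e ∈ Ioo eMin eMax) (q : ℝ) : condSD W e * stdCoord W q e = q - condMean W e :=
  mul_div_cancel₀ _ (h.sd_pos he).ne'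

lemma abs_sub_mean (h : SlowRegime eMin eMax qMin qMax a b K L M P₀ P₁ s W p)
    (he : e ∈ Ioo eMin eMax) (q : ℝ) :
    |q - condMean W e| = condSD W e * |stdCoord W q e| := by
  rw [← h.mul_stdCoord he, abs_mul, abs_of_pos (h.sd_pos he)]

lemma continuousOn_stdCoord (h : SlowRegime eMin eMax qMin qMax a b K L M P₀ P₁ s W p) (q : ℝ) :
    ContinuousOn (stdCoord W q) (Icc a b) :=
  (continuousOn_const.sub h.continuousOn_mean).div h.continuousOn_sd fun _ he =>
    (h.sd_pos (h.mem_Ioo he)).ne'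

lemma measurableSet_nearSet (h : SlowRegime eMin eMax qMin qMax a b K L M P₀ P₁ s W p)
    (q T : ℝ) : MeasurableSet (nearSet W a b q T) :=
  ((h.continuousOn_stdCoord q).preimage_isClosed_of_isClosed isClosed_Icc
    isClosed_Icc).measurableSet

lemma mul_abs_stdCoord_le (h : SlowRegime eMin eMax qMin qMax a b K L M P₀ P₁ s W p)
    (he : e ∈ nearSet W a b q (r / s)) : s * |stdCoord W q e| ≤ r := by
  have := abs_le.2 he.2
  rwa [le_div_iff₀ h.pos, mul_comm] at this

lemma abs_sub_mean_le (h : SlowRegime eMin eMax qMin qMax a b K L M P₀ P₁ s W p)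
    (he : e ∈ Ioo eMin eMax) (q : ℝ) : |q - condMean W e| ≤ s * |stdCoord W q e| := by
  rw [h.abs_sub_mean he]
  have := h.sd_le he
  gcongr

lemma hasDerivAt_stdCoord (h : SlowRegime eMin eMax qMin qMax a b K L M P₀ P₁ s W p)
    (he : e ∈ Icc a b) (q : ℝ) : HasDerivAt (stdCoord W q) (-stdSlope W q e) e := by
  have hσ := (h.sd_pos (h.mem_Ioo he)).ne'
  refine HasDerivAt.congr_deriv (((h.slow.mean_diff e he).hasDerivAt.const_sub q).div
    (h.slow.sd_diff e he).hasDerivAt hσ) ?_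
  unfold stdSlope stdCoord
  field_simp
  ring

/-- The varying width perturbs the slope by at most `L |q - m(e)|`, which is small relative to `m' ≥
1 / K`. -/
lemma logNear_slope_num (h : SlowRegime eMin eMax qMin qMax a b K L M P₀ P₁ s W p)
    (he : e ∈ Icc a b) (hq : K * L * |q - condMean W e| ≤ 1 / 2) :
    LogNear (2 * (K * L * |q - condMean W e|))
      (deriv (condMean W) e + stdCoord W q e * deriv (condSD W) e) (deriv (condMean W) e) := by
  set η := K * L * |q - condMean W e| with hη
  set μ := deriv (condMean W) e with hμ
  have hK := h.K_pos
  have hμ0 : 0 < μ := h.deriv_pos he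
  have hη0 : 0 ≤ η := by have := h.nonneg; positivity
  have h1 : |stdCoord W q e * deriv (condSD W) e| ≤ η * μ := by
    rw [abs_mul]
    calc |stdCoord W q e| * |deriv (condSD W) e| ≤ |stdCoord W q e| * (L * condSD W e) := by
          gcongr
          exact h.slow.sd_slow e he
      _ = L * |q - condMean W e| := by rw [h.abs_sub_mean (h.mem_Ioo he)]; ring
      _ = η * (1 / K) := by rw [hη]; field_simp
      _ ≤ η * μ := by
          gcongr
          exact h.slow.mean_deriv_ge e he
  exact LogNear.of_abs_sub_le (by rwa [add_sub_cancel_left]) hμ0.le hη0 hq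

lemma stdSlope_pos (h : SlowRegime eMin eMax qMin qMax a b K L M P₀ P₁ s W p)
    (he : e ∈ Icc a b) (hq : K * L * |q - condMean W e| ≤ 1 / 2) : 0 < stdSlope W q e :=
  div_pos ((h.logNear_slope_num he hq).pos (h.deriv_pos he)) (h.sd_pos (h.mem_Ioo he))

lemma KL_abs_sub_mean_le (h : SlowRegime eMin eMax qMin qMax a b K L M P₀ P₁ s W p)
    (hr : IsRadius K L c r) (he : e ∈ nearSet W a b q (r / s)) :
    K * L * |q - condMean W e| ≤ 1 / 2 := by
  refine le_trans ?_ hr.slope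
  have hK := h.K_pos
  have hL := h.nonneg
  gcongr
  exact (h.abs_sub_mean_le (h.mem_Ioo he.1) q).trans (h.mul_abs_stdCoord_le he)

/-- A negative derivative gives strict monotonicity on an interval only, and the near set is not
known to be one. It is therefore enlarged to the set where `|m(e) - q| ≤ r`, an interval because `m`
is monotone, on which the slope is still positive. -/
lemma injOn_stdCoord (h : SlowRegime eMin eMax qMin qMax a b K L M P₀ P₁ s W p)
    (hr : IsRadius K L c r) : InjOn (stdCoord W q) (nearSet W a b q (r / s)) := by
  set D := Icc a b ∩ condMean W ⁻¹' Icc (q - r) (q + r) with hD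
  have hsub : nearSet W a b q (r / s) ⊆ D := fun e he => by
    refine ⟨he.1, ?_⟩
    have := (h.abs_sub_mean_le (h.mem_Ioo he.1) q).trans (h.mul_abs_stdCoord_le he)
    rw [abs_le] at this
    constructor <;> linarith
  have hconv : Convex ℝ D := by
    refine OrdConnected.convex ⟨fun x hx y hy z hz => ?_⟩
    have hzI : z ∈ Icc a b := ⟨hx.1.1.trans hz.1, hz.2.trans hy.1.2⟩
    exact ⟨hzI, hx.2.1.trans (h.mean_le_of_le (h.mem_Ioo hx.1) (h.mem_Ioo hzI) hz.1),
      (h.mean_le_of_le (h.mem_Ioo hzI) (h.mem_Ioo hy.1) hz.2).trans hy.2.2⟩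
  refine ((strictAntiOn_of_deriv_neg hconv
    ((h.continuousOn_stdCoord q).mono inter_subset_left) fun e he => ?_).injOn).mono hsub
  have he' := interior_subset he
  rw [(h.hasDerivAt_stdCoord he'.1 q).deriv, neg_lt_zero]
  refine h.stdSlope_pos he'.1 (le_trans ?_ hr.slope)
  have hK := h.K_pos
  have hL := h.nonneg
  gcongr
  rw [abs_le]
  constructor <;> linarith [he'.2.1, he'.2.2]

/-- The margin `c` puts the coordinate above `r / s` at `a` and below `-(r / s)` at `b`; the
intermediate value theorem supplies everything between. -/
lemma image_stdCoord (h : SlowRegime eMin eMax qMin qMax a b K L M P₀ P₁ s W p)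
    (hi : IsInner a b c W q e₀) (hr : IsRadius K L c r) :
    stdCoord W q '' nearSet W a b q (r / s) = Icc (-(r / s)) (r / s) := by
  refine Subset.antisymm (fun _ ⟨e, he, hx⟩ => hx ▸ he.2) fun x hx => ?_
  have hrc : r ≤ c := (le_mul_of_one_le_left hr.pos.le h.one_le).trans hr.mul_lt.le
  have ha := left_mem_Icc.2 h.lt.le
  have hb := right_mem_Icc.2 h.lt.le
  have h1 : r / s ≤ stdCoord W q a := by
    refine (div_le_div_of_nonneg_left hr.pos.le (h.sd_pos (h.mem_Ioo ha))
      (h.sd_le (h.mem_Ioo ha))).trans ?_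
    exact div_le_div_of_nonneg_right (by linarith [hi.left]) (h.sd_pos (h.mem_Ioo ha)).le
  have h2 : stdCoord W q b ≤ -(r / s) := by
    rw [le_neg, stdCoord, ← neg_div]
    refine (div_le_div_of_nonneg_left hr.pos.le (h.sd_pos (h.mem_Ioo hb))
      (h.sd_le (h.mem_Ioo hb))).trans ?_
    exact div_le_div_of_nonneg_right (by linarith [hi.right]) (h.sd_pos (h.mem_Ioo hb)).le
  obtain ⟨e, he, hex⟩ := intermediate_value_Icc' h.lt.le (h.continuousOn_stdCoord q)
    (show x ∈ Icc (stdCoord W q b) (stdCoord W q a) from ⟨h2.trans hx.1, hx.2.trans h1⟩)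
  exact ⟨e, ⟨he, by rw [mem_preimage, hex]; exact hx⟩, hex⟩

/-- The change of variable from `e` to the standardised coordinate. -/
lemma setIntegral_nearSet (h : SlowRegime eMin eMax qMin qMax a b K L M P₀ P₁ s W p)
    (hi : IsInner a b c W q e₀) (hr : IsRadius K L c r) (G : ℝ → ℝ) :
    ∫ x in Icc (-(r / s)) (r / s), G x =
      ∫ e in nearSet W a b q (r / s), stdSlope W q e * G (stdCoord W q e) := by
  rw [← h.image_stdCoord hi hr, integral_image_eq_integral_abs_deriv_smul
    (h.measurableSet_nearSet q _)
    (fun e he => (h.hasDerivAt_stdCoord he.1 q).hasDerivWithinAt) (h.injOn_stdCoord hr)]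
  refine setIntegral_congr_fun (h.measurableSet_nearSet q _) fun e he => ?_
  simp only [abs_neg, smul_eq_mul]
  rw [abs_of_pos (h.stdSlope_pos he.1 (h.KL_abs_sub_mean_le hr he))]

lemma integrableOn_nearSet (h : SlowRegime eMin eMax qMin qMax a b K L M P₀ P₁ s W p)
    (hr : IsRadius K L c r) {G : ℝ → ℝ} (hG : Integrable G) :
    IntegrableOn (fun e => stdSlope W q e * G (stdCoord W q e)) (nearSet W a b q (r / s)) := by
  have h1 : IntegrableOn G (stdCoord W q '' nearSet W a b q (r / s)) := hG.integrableOn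
  rw [integrableOn_image_iff_integrableOn_abs_deriv_smul (h.measurableSet_nearSet q _)
    (fun e he => (h.hasDerivAt_stdCoord he.1 q).hasDerivWithinAt) (h.injOn_stdCoord hr)] at h1
  refine h1.congr_fun (fun e he => ?_) (h.measurableSet_nearSet q _)
  simp only [abs_neg, smul_eq_mul]
  rw [abs_of_pos (h.stdSlope_pos he.1 (h.KL_abs_sub_mean_le hr he))]

/-- Inside `[a, b]` the coordinate exceeds `r / s` while `σ ≥ s / K`; outside `[a, b]` monotonicity
of `m` already gives the distance `c ≥ r`. -/
lemma le_abs_sub_of_notMem_nearSet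
    (h : SlowRegime eMin eMax qMin qMax a b K L M P₀ P₁ s W p)
    (hi : IsInner a b c W q e₀) (hr : IsRadius K L c r) (he : e ∈ Ioo eMin eMax)
    (hn : e ∉ nearSet W a b q (r / s)) : r / K ≤ |q - condMean W e| := by
  have hK := h.K_pos
  by_cases hab : e ∈ Icc a b
  · have h1 : r / s < |stdCoord W q e| := by
      by_contra hle
      exact hn ⟨hab, abs_le.1 (not_lt.1 hle)⟩
    rw [h.abs_sub_mean he]
    rw [div_lt_iff₀ h.pos] at h1
    rw [div_le_iff₀ hK]
    have h2 := mul_le_mul_of_nonneg_left (h.le_sd he) (abs_nonneg (stdCoord W q e))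
    linarith
  · refine le_trans ?_ (h.le_abs_sub_of_notMem hi he hab)
    have hrc : r ≤ c := (le_mul_of_one_le_left hr.pos.le h.one_le).trans hr.mul_lt.le
    exact (div_le_self hr.pos.le h.one_le).trans hrc

lemma abs_sub_center_le (h : SlowRegime eMin eMax qMin qMax a b K L M P₀ P₁ s W p)
    (hi : IsInner a b c W q e₀) (he : e ∈ Icc a b) :
    |e - e₀| ≤ K * (s * |stdCoord W q e|) := by
  refine (h.abs_sub_le he hi.mem).trans ?_
  have hK := h.K_pos
  gcongr
  rw [hi.mean_eq, abs_sub_comm]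
  exact h.abs_sub_mean_le (h.mem_Ioo he) q

lemma logNear_shape_nearSet (h : SlowRegime eMin eMax qMin qMax a b K L M P₀ P₁ s W p)
    (hi : IsInner a b c W q e₀) (hr : IsRadius K L c r)
    (he : e ∈ nearSet W a b q (r / s)) :
    LogNear (L * |e - e₀|) (shape W (stdCoord W q e) e) (shape W (stdCoord W q e) e₀) := by
  have hK := h.K_pos
  refine h.logNear_shape he.1 hi.mem ?_ ?_
  · rw [h.mul_stdCoord (h.mem_Ioo he.1), add_sub_cancel]
    refine h.mem_range_of_isInner hi ?_
    rw [sub_self, abs_zero]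
    exact (mul_pos hK hr.pos).trans hr.mul_lt
  · refine h.mem_range_of_isInner hi ?_
    have h1 := h.mul_abs_stdCoord_le he
    have h2 := mul_le_mul_of_nonneg_right (h.sd_le (h.mem_Ioo hi.mem))
      (abs_nonneg (stdCoord W q e))
    rw [hi.mean_eq, add_sub_cancel_left, abs_mul, abs_of_pos (h.sd_pos (h.mem_Ioo hi.mem))]
    have h3 : r ≤ K * r := le_mul_of_one_le_left hr.pos.le h.one_le
    linarith [hr.mul_lt]

/-- On the near set, the joint density is that of the standardised variable. -/
lemma logNear_joint (h : SlowRegime eMin eMax qMin qMax a b K L M P₀ P₁ s W p)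
    (hi : IsInner a b c W q e₀) (hr : IsRadius K L c r)
    (he : e ∈ nearSet W a b q (r / s)) :
    LogNear (5 * K * L * (s * |stdCoord W q e|)) (W q e * p e)
      (p e₀ / deriv (condMean W) e₀ *
        (stdSlope W q e * shape W (stdCoord W q e) e₀)) := by
  have hK := h.K_pos
  have hL := h.nonneg
  have hs := h.pos
  have heI := h.mem_Ioo he.1
  have hnum := h.logNear_slope_num he.1 (h.KL_abs_sub_mean_le hr he)
  have hnum0 := hnum.pos (h.deriv_pos he.1)
  have hslope := h.stdSlope_pos he.1 (h.KL_abs_sub_mean_le hr he)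
  have hφ0 := h.shape_nonneg (h.mem_Ioo hi.mem) (stdCoord W q e)
  have h1 := (((h.logNear_shape_nearSet hi hr he).mul (h.logNear_input he.1 hi.mem) hφ0
    (h.input_apply_pos hi.mem).le).div (hnum.trans (h.logNear_deriv he.1 hi.mem))
    (mul_nonneg hφ0 (h.input_apply_pos hi.mem).le) (h.deriv_pos hi.mem)).mul
    (LogNear.refl (stdSlope W q e))
    (div_nonneg (mul_nonneg hφ0 (h.input_apply_pos hi.mem).le) (h.deriv_pos hi.mem).le)
    hslope.le
  have e1 : shape W (stdCoord W q e) e * p e /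
      (deriv (condMean W) e + stdCoord W q e * deriv (condSD W) e) * stdSlope W q e =
      W q e * p e := by
    rw [h.channel.apply_eq_shape_div heI q]
    have hσ := (h.sd_pos heI).ne'
    have := hnum0.ne'
    change shape W (stdCoord W q e) e * p e /
      (deriv (condMean W) e + stdCoord W q e * deriv (condSD W) e) *
      ((deriv (condMean W) e + stdCoord W q e * deriv (condSD W) e) / condSD W e) =
      shape W (stdCoord W q e) e / condSD W e * p e
    field_simp
  have e2 : shape W (stdCoord W q e) e₀ * p e₀ / deriv (condMean W) e₀ * stdSlope W q e =
      p e₀ / deriv (condMean W) e₀ * (stdSlope W q e * shape W (stdCoord W q e) e₀) := by ring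
  rw [e1, e2] at h1
  refine h1.mono ?_ (mul_nonneg (div_nonneg (h.input_apply_pos hi.mem).le
    (h.deriv_pos hi.mem).le) (mul_nonneg hslope.le hφ0))
  -- The constant `5` collects one `K L s |z|` each from the shape, the input density and `m'`, and
  -- two from the slope.
  have h2 := h.abs_sub_center_le hi he.1
  have h3 := mul_le_mul_of_nonneg_left h2 hL
  have h4 := mul_le_mul_of_nonneg_left (h.abs_sub_mean_le heI q) (mul_nonneg hK.le hL)
  nlinarith

/-- The joint density carries the Jacobian of `z`; inside the logarithm the conditional density is
needed without it. Here the shape and the width each contribute one `K L s |z|`. -/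
lemma logNear_cond (h : SlowRegime eMin eMax qMin qMax a b K L M P₀ P₁ s W p)
    (hi : IsInner a b c W q e₀) (hr : IsRadius K L c r)
    (he : e ∈ nearSet W a b q (r / s)) :
    LogNear (2 * K * L * (s * |stdCoord W q e|)) (condSD W e₀ * W q e)
      (shape W (stdCoord W q e) e₀) := by
  have hL := h.nonneg
  have heI := h.mem_Ioo he.1
  have hσ := h.sd_pos heI
  have hφ0 := h.shape_nonneg (h.mem_Ioo hi.mem) (stdCoord W q e)
  have h1 := (h.logNear_shape_nearSet hi hr he).mul (h.logNear_sd hi.mem he.1) hφ0 hσ.le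
  have h2 := h1.div (LogNear.refl (condSD W e)) (mul_nonneg hφ0 hσ.le) hσ
  rw [mul_div_cancel_right₀ _ hσ.ne'] at h2
  have e1 : shape W (stdCoord W q e) e * condSD W e₀ / condSD W e = condSD W e₀ * W q e := by
    rw [h.channel.apply_eq_shape_div heI q]
    unfold stdCoord
    ring
  rw [e1] at h2
  refine h2.mono ?_ hφ0
  have h3 := mul_le_mul_of_nonneg_left (h.abs_sub_center_le hi he.1) hL
  rw [abs_sub_comm e₀ e]
  linarith

end SlowRegime

lemma exists_isRadius {K L c : ℝ} (hK : 1 ≤ K) (hL : 0 ≤ L) (hc : 0 < c) :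
    ∃ r, IsRadius K L c r := by
  have hK0 : 0 < K := by linarith
  refine ⟨min (c / (2 * K)) (1 / (2 * K * (L + 1))), by positivity, ?_, ?_⟩
  · calc K * min (c / (2 * K)) (1 / (2 * K * (L + 1))) ≤ K * (c / (2 * K)) := by
          gcongr; exact min_le_left _ _
      _ = c / 2 := by field_simp
      _ < c := by linarith
  · calc K * L * min (c / (2 * K)) (1 / (2 * K * (L + 1))) ≤
          K * (L + 1) * (1 / (2 * K * (L + 1))) := by
          gcongr
          · linarith
          · exact min_le_right _ _
      _ = 1 / 2 := by field_simp

/-! ### The output density at an inner point. -/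

namespace SlowRegime

variable {eMin eMax qMin qMax a b c r K L M P₀ P₁ s : ℝ} {W : ℝ → ℝ → ℝ} {p : ℝ → ℝ}
  {q e₀ e : ℝ}

lemma setIntegral_joint_le_of_far (h : SlowRegime eMin eMax qMin qMax a b K L M P₀ P₁ s W p)
    {d : ℝ} (hd : 0 < d) {S : Set ℝ} (hS : MeasurableSet S)
    (hfar : ∀ e ∈ S, e ∈ Ioo eMin eMax → d ≤ |q - condMean W e|) :
    ∫ e in S, W q e * p e ≤ K * s ^ 2 / d ^ 3 := by
  have hK := h.K_pos
  have hp := h.input.isDensityOn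
  calc ∫ e in S, W q e * p e ≤ ∫ e in S, K * s ^ 2 / d ^ 3 * p e := by
        refine setIntegral_mono_on (h.isBoundedPair.integrable_section q).integrableOn
          (hp.integrable.integrableOn.const_mul _) hS fun e he => ?_
        by_cases heI : e ∈ Ioo eMin eMax
        · exact mul_le_mul_of_nonneg_right (h.cond_le_of_far heI hd (hfar e he heI))
            (hp.nonneg e)
        · simp [hp.support e heI]
    _ = K * s ^ 2 / d ^ 3 * ∫ e in S, p e := integral_const_mul _ _
    _ ≤ K * s ^ 2 / d ^ 3 * 1 := by
        gcongr
        exact hp.setIntegral_le_one S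
    _ = _ := mul_one _

lemma measurable_shape (h : SlowRegime eMin eMax qMin qMax a b K L M P₀ P₁ s W p)
    (he : e ∈ Ioo eMin eMax) : Measurable fun x => shape W x e := h.channel.measurable_shape he

lemma integrable_shapeWeight (h : SlowRegime eMin eMax qMin qMax a b K L M P₀ P₁ s W p)
    (he : e ∈ Ioo eMin eMax) : Integrable (errWeight fun x => shape W x e) :=
  integrable_errWeight h.one_le (h.measurable_shape he) (h.shape_nonneg he) (h.slow.shape_le e he)

lemma integral_shapeWeight_le (h : SlowRegime eMin eMax qMin qMax a b K L M P₀ P₁ s W p)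
    (he : e ∈ Ioo eMin eMax) : ∫ x, errWeight (fun x => shape W x e) x ≤ tailConst K :=
  integral_errWeight_le h.one_le (h.measurable_shape he) (h.shape_nonneg he)
    (h.slow.shape_le e he)

/-- If two functions on the near set differ by at most `D` times the weight, their integrals differ
by at most `D` times a constant. -/
lemma abs_setIntegral_nearSet_sub_le
    (h : SlowRegime eMin eMax qMin qMax a b K L M P₀ P₁ s W p)
    (hi : IsInner a b c W q e₀) (hr : IsRadius K L c r) {F G : ℝ → ℝ} {D : ℝ} (hD : 0 ≤ D)
    (hF : IntegrableOn F (nearSet W a b q (r / s))) (hG : Integrable G)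
    (hFG : ∀ e ∈ nearSet W a b q (r / s), |F e - stdSlope W q e * G (stdCoord W q e)| ≤
      D * (stdSlope W q e * errWeight (fun x => shape W x e₀) (stdCoord W q e))) :
    |(∫ e in nearSet W a b q (r / s), F e) - ∫ x in Icc (-(r / s)) (r / s), G x| ≤
      D * tailConst K := by
  have hm := h.measurableSet_nearSet q (r / s)
  have hw := h.integrable_shapeWeight (h.mem_Ioo hi.mem)
  rw [h.setIntegral_nearSet hi hr, ← integral_sub hF (h.integrableOn_nearSet hr hG)]
  calc _ ≤ ∫ e in nearSet W a b q (r / s), |F e - stdSlope W q e * G (stdCoord W q e)| :=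
        abs_integral_le_integral_abs
    _ ≤ ∫ e in nearSet W a b q (r / s),
        D * (stdSlope W q e * errWeight (fun x => shape W x e₀) (stdCoord W q e)) :=
        setIntegral_mono_on (hF.sub (h.integrableOn_nearSet hr hG)).abs
          ((h.integrableOn_nearSet hr hw).const_mul D) hm hFG
    _ = D * ∫ x in Icc (-(r / s)) (r / s), errWeight (fun x => shape W x e₀) x := by
        rw [integral_const_mul, h.setIntegral_nearSet hi hr]
    _ ≤ D * tailConst K := by
        gcongr
        exact (setIntegral_le_integral hw (Filter.Eventually.of_forall
          (errWeight_nonneg (h.shape_nonneg (h.mem_Ioo hi.mem))))).trans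
          (h.integral_shapeWeight_le (h.mem_Ioo hi.mem))

/-- On the near set the substitution `e ↦ z` turns the joint density into `p(e₀) / m'(e₀)` times
`φ(z|e₀)`, whose total mass is one. The three errors come from slow change, from cutting `φ` off at
`r / s`, and from inputs off the near set. -/
lemma abs_outputDensity_sub_le (h : SlowRegime eMin eMax qMin qMax a b K L M P₀ P₁ s W p)
    (hi : IsInner a b c W q e₀) (hr : IsRadius K L c r) :
    |outputDensity W p q - p e₀ / deriv (condMean W) e₀| ≤
      p e₀ / deriv (condMean W) e₀ * (5 * K * L * s * Real.exp (5 * K * L * r) * tailConst K) +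
      p e₀ / deriv (condMean W) e₀ * (tailConst K / (r / s)) + K * s ^ 2 / (r / K) ^ 3 := by
  set θ := p e₀ / deriv (condMean W) e₀ with hθ
  set N := nearSet W a b q (r / s) with hN
  have hK := h.K_pos
  have hL := h.nonneg
  have hs := h.pos
  have heI := h.mem_Ioo hi.mem
  have hθ0 : 0 < θ := div_pos (h.input_apply_pos hi.mem) (h.deriv_pos hi.mem)
  have hm : MeasurableSet N := h.measurableSet_nearSet q (r / s)
  have hint := h.isBoundedPair.integrable_section q
  have hφi := h.channel.integrable_shape heI
  have hsplit : outputDensity W p q = (∫ e in N, W q e * p e) + ∫ e in Nᶜ, W q e * p e :=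
    (integral_add_compl hm hint).symm
  have hnear := h.abs_setIntegral_nearSet_sub_le hi hr (F := fun e => W q e * p e)
    (G := fun x => θ * shape W x e₀)
    (D := θ * (5 * K * L * s * Real.exp (5 * K * L * r))) (by positivity)
    hint.integrableOn (hφi.const_mul θ) fun e he => by
      have h1 := h.logNear_joint hi hr he
      have hsl := h.stdSlope_pos he.1 (h.KL_abs_sub_mean_le hr he)
      have hφ0 := h.shape_nonneg heI (stdCoord W q e)
      have h2 := h1.abs_sub_le (by positivity)
      have h3 := h.mul_abs_stdCoord_le he
      rw [← hθ] at h2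
      rw [mul_left_comm (stdSlope W q e)]
      refine h2.trans ?_
      have h4 := one_add_abs_mul_le_errWeight (h.shape_nonneg heI) (stdCoord W q e)
      have h5 : Real.exp (5 * K * L * (s * |stdCoord W q e|)) ≤ Real.exp (5 * K * L * r) := by
        gcongr
      calc _ ≤ 5 * K * L * (s * (1 + |stdCoord W q e|)) * Real.exp (5 * K * L * r) *
              (θ * (stdSlope W q e * shape W (stdCoord W q e) e₀)) := by
            gcongr
            linarith
        _ = θ * (5 * K * L * s * Real.exp (5 * K * L * r)) *
              (stdSlope W q e * ((1 + |stdCoord W q e|) * shape W (stdCoord W q e) e₀)) := by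
            ring
        _ ≤ _ := by gcongr
  have htail := abs_integral_sub_setIntegral_le h.one_le (h.measurable_shape heI)
    (h.shape_nonneg heI) (h.slow.shape_le e₀ heI) hφi (fun x => by
      rw [abs_of_nonneg (h.shape_nonneg heI x)]
      exact one_add_abs_mul_le_errWeight (h.shape_nonneg heI) x) (div_pos hr.pos hs)
  rw [h.channel.integral_shape heI] at htail
  have hfar := h.setIntegral_joint_le_of_far (q := q) (div_pos hr.pos hK) hm.compl
    (fun e he heI => h.le_abs_sub_of_notMem_nearSet hi hr heI he)
  have hfar0 : 0 ≤ ∫ e in Nᶜ, W q e * p e := integral_nonneg (h.isBoundedPair.joint_nonneg q)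
  rw [integral_const_mul] at hnear
  have htail' := mul_le_mul_of_nonneg_left htail hθ0.le
  rw [← abs_of_pos hθ0, ← abs_mul, abs_of_pos hθ0] at htail'
  rw [hsplit]
  rw [abs_le] at *
  constructor <;> linarith [hnear.1, hnear.2, htail'.1, htail'.2]

end SlowRegime

/-- Near an inner point the density of `Q` is `p / m'`, up to a factor `1 + O(s)`. -/
lemma exists_logNear_outputDensity {K L M P₀ r : ℝ} (hK : 1 ≤ K) (hL : 0 ≤ L) (hM : 0 < M)
    (hP₀ : 0 < P₀) (hr : 0 < r) :
    ∃ A s₀ : ℝ, 0 < A ∧ 0 < s₀ ∧ ∀ {eMin eMax qMin qMax a b c P₁ s : ℝ} {W : ℝ → ℝ → ℝ}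
      {p : ℝ → ℝ} {q e₀ : ℝ}, SlowRegime eMin eMax qMin qMax a b K L M P₀ P₁ s W p →
      IsInner a b c W q e₀ → IsRadius K L c r → s ≤ s₀ →
      LogNear (A * s) (outputDensity W p q) (p e₀ / deriv (condMean W) e₀) := by
  have hK0 : 0 < K := by linarith
  have hΓ := tailConst_nonneg hK
  -- The contribution of distant inputs is an absolute error; the factor `M / P₀` makes it relative,
  -- since the main term is at least `P₀ / M`.
  set A := 5 * K * L * Real.exp (5 * K * L * r) * tailConst K + tailConst K / r +
    K / (r / K) ^ 3 * (M / P₀) with hA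
  have hA0 : 0 < A := by positivity
  refine ⟨2 * A, min 1 (1 / (2 * A)), by positivity, by positivity, ?_⟩
  intro eMin eMax qMin qMax a b c P₁ s W p q e₀ h hi hrad hs
  have hs0 := h.pos
  have hs1 : s ≤ 1 := hs.trans (min_le_left _ _)
  have hsA : A * s ≤ 1 / 2 := by
    have : A * s ≤ A * (1 / (2 * A)) := by
      gcongr
      exact hs.trans (min_le_right _ _)
    refine this.trans (le_of_eq ?_)
    field_simp
  have hθ0 : 0 < p e₀ / deriv (condMean W) e₀ :=
    div_pos (h.input_apply_pos hi.mem) (h.deriv_pos hi.mem)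
  have hθ : P₀ / M ≤ p e₀ / deriv (condMean W) e₀ :=
    div_le_div₀ (h.input_apply_pos hi.mem).le (h.input_ge _ hi.mem) (h.deriv_pos hi.mem)
      (h.deriv_le _ hi.mem)
  rw [mul_assoc]
  refine LogNear.of_abs_sub_le ((h.abs_outputDensity_sub_le hi hrad).trans ?_) hθ0.le
    (by positivity) hsA
  set θ := p e₀ / deriv (condMean W) e₀
  have h1 : K * s ^ 2 / (r / K) ^ 3 ≤ K / (r / K) ^ 3 * (M / P₀) * s * θ := by
    calc K * s ^ 2 / (r / K) ^ 3 = K / (r / K) ^ 3 * (M / P₀) * (s * s) * (P₀ / M) := by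
          field_simp
      _ ≤ K / (r / K) ^ 3 * (M / P₀) * (s * 1) * θ := by gcongr
      _ = _ := by ring
  have h2 : tailConst K / (r / s) = tailConst K / r * s := by field_simp
  rw [h2]
  calc _ ≤ θ * (5 * K * L * s * Real.exp (5 * K * L * r) * tailConst K) +
        θ * (tailConst K / r * s) + K / (r / K) ^ 3 * (M / P₀) * s * θ := by gcongr
    _ = A * s * θ := by rw [hA]; ring

namespace SlowRegime

variable {eMin eMax qMin qMax a b c r K L M P₀ P₁ s : ℝ} {W : ℝ → ℝ → ℝ} {p : ℝ → ℝ}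
  {q e₀ e : ℝ}

lemma outputScale_pos (h : SlowRegime eMin eMax qMin qMax a b K L M P₀ P₁ s W p)
    (he : e ∈ Icc a b) : 0 < p e / deriv (condMean W) e :=
  div_pos (h.input_apply_pos he) (h.deriv_pos he)

lemma le_outputScale (h : SlowRegime eMin eMax qMin qMax a b K L M P₀ P₁ s W p)
    (he : e ∈ Icc a b) : P₀ / M ≤ p e / deriv (condMean W) e :=
  div_le_div₀ (h.input_apply_pos he).le (h.input_ge _ he) (h.deriv_pos he) (h.deriv_le _ he)

lemma outputScale_le (h : SlowRegime eMin eMax qMin qMax a b K L M P₀ P₁ s W p)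
    (he : e ∈ Icc a b) : p e / deriv (condMean W) e ≤ K * P₁ := by
  have hK := h.K_pos
  have := div_le_div₀ h.P₁_pos.le (h.input_le e he) (one_div_pos.2 hK)
    (h.slow.mean_deriv_ge e he)
  refine this.trans (le_of_eq ?_)
  field_simp

/-- A logarithmic bound holds, but `1 / s` is enough: this logarithm is only ever multiplied by
quantities of order `s ^ 2`. -/
lemma abs_log_scale_le (h : SlowRegime eMin eMax qMin qMax a b K L M P₀ P₁ s W p)
    (he : e ∈ Icc a b) (hs : s ≤ 1) :
    |Real.log (condSD W e * (p e / deriv (condMean W) e))| ≤ (K * P₁ + K * M / P₀) / s := by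
  have hσ := h.sd_pos (h.mem_Ioo he)
  have hσs := h.sd_le (h.mem_Ioo he)
  have hK := h.K_pos
  have hs0 := h.pos
  have hM := h.M_pos
  have hP₀ := h.input_pos
  have hP₁ := h.P₁_pos
  have h1 := h.outputScale_pos he
  have h2 := h.le_outputScale he
  have h3 := h.outputScale_le he
  set θ := p e / deriv (condMean W) e
  have h4 : s / K ≤ condSD W e := by
    rw [div_le_iff₀ hK, mul_comm]
    exact h.le_sd (h.mem_Ioo he)
  refine (abs_log_le_add_inv (mul_pos hσ h1)).trans ?_
  rw [add_div]
  refine add_le_add ?_ ?_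
  · calc condSD W e * θ ≤ 1 * (K * P₁) := by gcongr; linarith
      _ = K * P₁ / 1 := by ring
      _ ≤ K * P₁ / s := by gcongr
  · calc (condSD W e * θ)⁻¹ ≤ (s / K * (P₀ / M))⁻¹ := by gcongr
      _ = K * M / P₀ / s := by field_simp

end SlowRegime

/-! ### Entropy of the posterior. -/

/-- The relative entropy of the posterior of `E*` with respect to the uniform law, at an inner
point, in terms of the standardised conditional density. -/
lemma exists_abs_posterior_sub_le {K L M P₀ P₁ r : ℝ} (hK : 1 ≤ K) (hL : 0 ≤ L) (hM : 0 < M)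
    (hP₀ : 0 < P₀) (hP₁ : 0 < P₁) (hr : 0 < r) :
    ∃ A s₀ : ℝ, 0 < A ∧ 0 < s₀ ∧ ∀ {eMin eMax qMin qMax a b c s : ℝ} {W : ℝ → ℝ → ℝ}
      {p : ℝ → ℝ} {q e₀ : ℝ}, SlowRegime eMin eMax qMin qMax a b K L M P₀ P₁ s W p →
      IsInner a b c W q e₀ → IsRadius K L c r → s ≤ s₀ →
      |(∫ e, W q e / outputDensity W p q * Real.log (W q e / outputDensity W p q) * p e) +
        Real.log (condSD W e₀ * (p e₀ / deriv (condMean W) e₀)) -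
        ∫ x, shape W x e₀ * Real.log (shape W x e₀)| ≤ A * s := by
  have hK0 : 0 < K := by linarith
  have hΓ := tailConst_nonneg hK
  obtain ⟨A', s', hA', hs', hf⟩ := exists_logNear_outputDensity hK hL hM hP₀ hr
  set D := 5 * K * L + A' with hD
  -- Off the near set `f_{Q|E} / f_Q ≤ C₁ s ^ 2`; the factor `exp 1 * (M / P₀)` bounds `1 / f_Q(q)`
  -- once `A' s ≤ 1`.
  set C₁ := K / (r / K) ^ 3 * (Real.exp 1 * (M / P₀)) with hC₁
  set C₂ := K * P₁ + K * M / P₀ with hC₂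
  have hC₁0 : 0 < C₁ := by positivity
  have hC₂0 : 0 < C₂ := by positivity
  have hD0 : 0 < D := by positivity
  refine ⟨D * Real.exp (D * (r + 1)) * tailConst K + tailConst K / r +
    (2 * Real.sqrt C₁ + C₁ ^ 2 + C₁ * C₂), min s' (min 1 (1 / A')), by positivity,
    by positivity, ?_⟩
  intro eMin eMax qMin qMax a b c s W p q e₀ h hi hrad hs
  have hs0 := h.pos
  have hs1 : s ≤ 1 := hs.trans ((min_le_right _ _).trans (min_le_left _ _))
  have hsA : A' * s ≤ 1 := by
    have h1 : s ≤ 1 / A' := hs.trans ((min_le_right _ _).trans (min_le_right _ _))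
    rwa [le_div_iff₀ hA', mul_comm] at h1
  have hfθ := hf h hi hrad (hs.trans (min_le_left _ _))
  have hθ0 := h.outputScale_pos hi.mem
  have hθ := h.le_outputScale hi.mem
  have hκ := h.abs_log_scale_le hi.mem hs1
  have heI := h.mem_Ioo hi.mem
  have hσ0 := h.sd_pos heI
  have hf0 := hfθ.pos hθ0
  set θ := p e₀ / deriv (condMean W) e₀ with hθdef
  set κ := condSD W e₀ * θ with hκdef
  set f := outputDensity W p q with hfdef
  set N := nearSet W a b q (r / s) with hN
  have hm : MeasurableSet N := h.measurableSet_nearSet q (r / s)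
  have hp := h.input.isDensityOn
  have hWm : Measurable fun e => W q e := h.channel.measurable.comp measurable_prodMk_left
  have hum : Measurable fun e => W q e / f * (Real.log (W q e / f) + Real.log κ) :=
    (hWm.div_const f).mul ((Real.measurable_log.comp (hWm.div_const f)).add_const _)
  have hlog : ∀ u U : ℝ, 0 ≤ u → u ≤ U → |u * (Real.log u + Real.log κ)| ≤
      2 * Real.sqrt U + U ^ 2 + U * |Real.log κ| := fun u U hu hU => by
    rw [mul_add]
    refine (abs_add_le _ _).trans (add_le_add (abs_mul_log_le_of_le hu hU) ?_)
    rw [abs_mul, abs_of_nonneg hu]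
    gcongr
  have hint : Integrable fun e => W q e / f * (Real.log (W q e / f) + Real.log κ) * p e :=
    hp.integrable_mul_of_bound hum _ fun e he =>
      hlog _ (K ^ 2 / s / f) (div_nonneg (h.channel.nonneg e he q) hf0.le)
        (div_le_div_of_nonneg_right (h.cond_le he q) hf0.le)
  have hsec : Integrable fun e => W q e / f * p e := by
    refine ((h.isBoundedPair.integrable_section q).div_const f).congr
      (Filter.Eventually.of_forall fun e => ?_)
    simp only
    ring
  have hone : ∫ e, W q e / f * p e = 1 := by
    simp only [div_mul_eq_mul_div]
    rw [integral_div]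
    exact div_self hf0.ne'
  -- The posterior has mass one, so `log κ` can be moved into the integrand. There `log (W / f) +
  -- log κ` is close to `log φ`, with no large logarithm of the scale left.
  have hH : (∫ e, W q e / f * Real.log (W q e / f) * p e) + Real.log κ =
      ∫ e, W q e / f * (Real.log (W q e / f) + Real.log κ) * p e := by
    have h1 : ∀ e, W q e / f * Real.log (W q e / f) * p e =
        W q e / f * (Real.log (W q e / f) + Real.log κ) * p e -
          Real.log κ * (W q e / f * p e) := fun e => by ring
    simp only [h1]
    rw [integral_sub hint (hsec.const_mul _), integral_const_mul, hone]
    ring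
  have hG := integrable_mul_log_of_errWeight hK (h.measurable_shape heI) (h.shape_nonneg heI)
    (h.slow.shape_le e₀ heI)
  have hnear := h.abs_setIntegral_nearSet_sub_le hi hrad
    (F := fun e => W q e / f * (Real.log (W q e / f) + Real.log κ) * p e)
    (G := fun x => shape W x e₀ * Real.log (shape W x e₀))
    (D := D * Real.exp (D * (r + 1)) * s) (by positivity) hint.integrableOn hG fun e he => by
      have hsl := h.stdSlope_pos he.1 (h.KL_abs_sub_mean_le hrad he)
      have hφ0 := h.shape_nonneg heI (stdCoord W q e)
      have hz := h.mul_abs_stdCoord_le he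
      have hz0 := abs_nonneg (stdCoord W q e)
      set z := stdCoord W q e with hzdef
      have hε : 5 * K * L * (s * |z|) + A' * s ≤ D * (s * (1 + |z|)) := by
        rw [hD]
        nlinarith [mul_nonneg hA'.le (mul_nonneg hs0.le hz0), mul_nonneg (mul_nonneg hK0.le hL) hs0.le]
      have hw : LogNear (D * (s * (1 + |z|))) (W q e / f * p e)
          (stdSlope W q e * shape W z e₀) := by
        have h1 := (h.logNear_joint hi hrad he).div hfθ (by positivity) hθ0
        rw [mul_div_cancel_left₀ _ hθ0.ne', mul_div_right_comm] at h1
        exact h1.mono hε (by positivity)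
      have hl : 0 < stdSlope W q e * shape W z e₀ →
          |Real.log (W q e / f) + Real.log κ - Real.log (shape W z e₀)| ≤
            D * (s * (1 + |z|)) := fun hpos => by
        have hφpos : 0 < shape W z e₀ := pos_of_mul_pos_right hpos hsl.le
        have h1 := (h.logNear_cond hi hrad he).div hfθ hφ0 hθ0
        have h2 := h1.abs_log_sub_le (by positivity)
        have hWpos : 0 < W q e := by
          have := (h.logNear_cond hi hrad he).pos hφpos
          exact pos_of_mul_pos_right this hσ0.le
        rw [Real.log_div (mul_pos hσ0 hWpos).ne' hf0.ne', Real.log_mul hσ0.ne' hWpos.ne',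
          Real.log_div hφpos.ne' hθ0.ne'] at h2
        rw [Real.log_div hWpos.ne' hf0.ne', hκdef, Real.log_mul hσ0.ne' hθ0.ne']
        have h3 : 2 * K * L * (s * |z|) ≤ 5 * K * L * (s * |z|) := by gcongr; norm_num
        refine le_trans (le_of_eq ?_) (h2.trans ((add_le_add_left h3 _).trans hε))
        congr 1
        ring
      have h4 := hw.abs_mul_sub_mul_log_le (by positivity) hl
      have h5 : D * (s * (1 + |z|)) ≤ D * (r + 1) := by
        gcongr
        linarith
      rw [mul_right_comm, ← mul_assoc (stdSlope W q e)]
      refine h4.trans ?_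
      calc _ ≤ D * (s * (1 + |z|)) * Real.exp (D * (r + 1)) *
            (stdSlope W q e * shape W z e₀ * (1 + |Real.log (shape W z e₀)|)) := by gcongr
        _ = _ := by simp only [errWeight]; ring
  have htail := abs_integral_sub_setIntegral_le hK (h.measurable_shape heI)
    (h.shape_nonneg heI) (h.slow.shape_le e₀ heI) hG (fun x => by
      have := h.shape_nonneg heI x
      rw [abs_mul, abs_of_nonneg this]
      unfold errWeight
      gcongr
      linarith) (div_pos hr hs0)
  -- The square root in the bound for `t log t` turns `C₁ s ^ 2` into order `s`, and `|log κ| ≤ C₂ /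
  -- s` loses only one of the two powers.
  have hfar : |∫ e in Nᶜ, W q e / f * (Real.log (W q e / f) + Real.log κ) * p e| ≤
      (2 * Real.sqrt C₁ + C₁ ^ 2 + C₁ * C₂) * s := by
    have hflow : Real.exp (-1) * (P₀ / M) ≤ f := by
      refine le_trans ?_ hfθ.1
      gcongr
    have hpt : ∀ e ∈ Nᶜ, |W q e / f * (Real.log (W q e / f) + Real.log κ) * p e| ≤
        (2 * Real.sqrt C₁ + C₁ ^ 2 + C₁ * C₂) * s * p e := fun e he => by
      by_cases heI' : e ∈ Ioo eMin eMax
      · have hfar := h.le_abs_sub_of_notMem_nearSet hi hrad heI' he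
        have hW := h.cond_le_of_far heI' (div_pos hr hK0) hfar
        have hW0 := h.channel.nonneg e heI' q
        have hu : W q e / f ≤ C₁ * s ^ 2 := by
          rw [div_le_iff₀ hf0]
          calc W q e ≤ K * s ^ 2 / (r / K) ^ 3 := hW
            _ = C₁ * s ^ 2 * (Real.exp (-1) * (P₀ / M)) := by
                rw [hC₁, Real.exp_neg]
                field_simp
            _ ≤ C₁ * s ^ 2 * f := by gcongr
        rw [abs_mul, abs_of_nonneg (hp.nonneg e)]
        refine mul_le_mul_of_nonneg_right ?_ (hp.nonneg e)
        refine (hlog _ _ (div_nonneg hW0 hf0.le) hu).trans ?_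
        have e1 : Real.sqrt (C₁ * s ^ 2) = Real.sqrt C₁ * s := by
          rw [Real.sqrt_mul hC₁0.le, Real.sqrt_sq hs0.le]
        have e2 : (C₁ * s ^ 2) ^ 2 ≤ C₁ ^ 2 * s := by
          have : s ^ 4 ≤ s := by
            have := pow_le_pow_of_le_one hs0.le hs1 (show 1 ≤ 4 by norm_num)
            rwa [pow_one] at this
          calc (C₁ * s ^ 2) ^ 2 = C₁ ^ 2 * s ^ 4 := by ring
            _ ≤ _ := by gcongr
        have e3 : C₁ * s ^ 2 * |Real.log κ| ≤ C₁ * C₂ * s := by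
          calc C₁ * s ^ 2 * |Real.log κ| ≤ C₁ * s ^ 2 * (C₂ / s) := by gcongr
            _ = _ := by field_simp
        rw [e1]
        linarith
      · simp [hp.support e heI']
    calc _ ≤ ∫ e in Nᶜ, |W q e / f * (Real.log (W q e / f) + Real.log κ) * p e| :=
          abs_integral_le_integral_abs
      _ ≤ ∫ e in Nᶜ, (2 * Real.sqrt C₁ + C₁ ^ 2 + C₁ * C₂) * s * p e :=
          setIntegral_mono_on hint.abs.integrableOn (hp.integrable.integrableOn.const_mul _)
            hm.compl hpt
      _ = (2 * Real.sqrt C₁ + C₁ ^ 2 + C₁ * C₂) * s * ∫ e in Nᶜ, p e := integral_const_mul _ _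
      _ ≤ (2 * Real.sqrt C₁ + C₁ ^ 2 + C₁ * C₂) * s * 1 := by
          gcongr
          exact hp.setIntegral_le_one _
      _ = _ := mul_one _
  have e1 : tailConst K / (r / s) = tailConst K / r * s := by field_simp
  rw [e1] at htail
  rw [hH, ← integral_add_compl hm hint]
  rw [abs_le] at *
  constructor <;> linarith [hnear.1, hnear.2, htail.1, htail.2, hfar.1, hfar.2]

/-! ### Relative entropies at fixed input, and the capacity. -/

namespace IsBoundedPair

variable {eMin eMax qMin qMax B : ℝ} {W : ℝ → ℝ → ℝ} {p : ℝ → ℝ}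

lemma integral_joint_div_output (p : ℝ → ℝ) (q : ℝ) :
    ∫ e, W q e * p e / outputDensity W p q = outputDensity W p q / outputDensity W p q :=
  integral_div _ _

lemma integrable_joint_div_output (h : IsBoundedPair eMin eMax qMin qMax B W p) :
    Integrable (fun z : ℝ × ℝ => W z.1 z.2 * p z.2 / outputDensity W p z.1)
      (volume.prod volume) := by
  have hf := h.isDensityOn_output
  have hm : Measurable fun z : ℝ × ℝ => W z.1 z.2 * p z.2 / outputDensity W p z.1 :=
    h.measurable_joint.div (hf.measurable.comp measurable_fst)
  rw [integrable_prod_iff hm.aestronglyMeasurable]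
  refine ⟨Filter.Eventually.of_forall fun q =>
    (h.integrable_section q).div_const (outputDensity W p q), ?_⟩
  have hi : Integrable ((Ioo qMin qMax).indicator fun _ : ℝ => (1 : ℝ)) :=
    (integrable_indicator_iff measurableSet_Ioo).2 (integrableOn_const (by simp))
  refine Integrable.mono' hi hm.norm.stronglyMeasurable.integral_prod_right'.aestronglyMeasurable
    (Filter.Eventually.of_forall fun q => ?_)
  have h1 : ∀ e, ‖W q e * p e / outputDensity W p q‖ = W q e * p e / outputDensity W p q :=
    fun e => Real.norm_of_nonneg (div_nonneg (h.joint_nonneg q e) (hf.nonneg q))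
  simp only [h1]
  rw [integral_joint_div_output]
  by_cases hq : q ∈ Ioo qMin qMax
  · rw [indicator_of_mem hq, Real.norm_of_nonneg (div_nonneg (hf.nonneg q) (hf.nonneg q))]
    exact div_self_le_one _
  · simp [hf.support q hq, indicator_of_notMem hq]

/-- Integrating over `e` first leaves `f_Q / f_Q`, which is one or, by the convention for division
by zero, zero. For a single `e` the integral of `W / f_Q` has no such bound; only this average is
available. -/
lemma integral_integral_joint_div_output_le (h : IsBoundedPair eMin eMax qMin qMax B W p) :
    ∫ e, ∫ q, W q e * p e / outputDensity W p q ≤ qMax - qMin := by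
  have hf := h.isDensityOn_output
  rw [← integral_integral_swap (f := fun q e => W q e * p e / outputDensity W p q)
    h.integrable_joint_div_output]
  have hi : Integrable ((Ioo qMin qMax).indicator fun _ : ℝ => (1 : ℝ)) :=
    (integrable_indicator_iff measurableSet_Ioo).2 (integrableOn_const (by simp))
  calc ∫ q, ∫ e, W q e * p e / outputDensity W p q ≤
        ∫ q, (Ioo qMin qMax).indicator (fun _ : ℝ => (1 : ℝ)) q := by
        refine integral_mono h.integrable_joint_div_output.integral_prod_left hi fun q => ?_
        simp only [integral_joint_div_output]
        by_cases hq : q ∈ Ioo qMin qMax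
        · rw [indicator_of_mem hq]
          exact div_self_le_one _
        · simp [hf.support q hq, indicator_of_notMem hq]
    _ = qMax - qMin := by
        rw [integral_indicator measurableSet_Ioo, setIntegral_const, smul_eq_mul, mul_one,
          Real.volume_real_Ioo, max_eq_left (sub_pos.2 hf.lt).le]

end IsBoundedPair

/-- A lower bound for the integrand of a relative entropy. -/
lemma neg_le_mul_log_sub {w f s : ℝ} (hw : 0 ≤ w) (hf : 0 ≤ f) (hs : 0 < s) :
    -(w * |Real.log s|) - s * (f + 1) ≤ w * (Real.log w - Real.log f) := by
  rcases hw.eq_or_lt with rfl | hw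
  · have : 0 ≤ s * (f + 1) := by positivity
    simpa using this
  -- This is `log x ≤ x - 1` at `x = s g / w`. It is used with `g = f`, and with `g = 1` where `f =
  -- 0` and the logarithm takes its default value `0`; hence the bound with `f + 1`.
  have key : ∀ g : ℝ, 0 < g → w * (Real.log s + Real.log g) - s * g ≤ w * Real.log w := by
    intro g hg
    have h1 := Real.log_le_sub_one_of_pos (show 0 < s * g / w by positivity)
    rw [Real.log_div (by positivity) hw.ne', Real.log_mul hs.ne' hg.ne'] at h1
    have h2 := mul_le_mul_of_nonneg_left h1 hw.le
    have h3 : w * (s * g / w - 1) = s * g - w := by field_simp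
    rw [h3] at h2
    linarith
  have h4 : -(w * |Real.log s|) ≤ w * Real.log s := by
    have := mul_le_mul_of_nonneg_left (neg_abs_le (Real.log s)) hw.le
    linarith
  rcases hf.eq_or_lt with rfl | hf
  · have := key 1 one_pos
    rw [Real.log_one] at this
    rw [Real.log_zero]
    linarith
  · have := key f hf
    nlinarith

/-- An upper bound for the integrand of a relative entropy where the density is small. -/
lemma mul_log_sub_le {w f B : ℝ} (hw : 0 ≤ w) (hf : 0 ≤ f) (hwB : w ≤ B) (hB : B ≤ 1) :
    w * (Real.log w - Real.log f) ≤ B * (w / f) := by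
  rcases hw.eq_or_lt with rfl | hw
  · simp
  rcases hf.eq_or_lt with rfl | hf
  · simp only [Real.log_zero, sub_zero, div_zero, mul_zero]
    exact mul_nonpos_of_nonneg_of_nonpos hw.le (Real.log_nonpos hw.le (hwB.trans hB))
  · rw [← Real.log_div hw.ne' hf.ne']
    have h1 := Real.log_le_sub_one_of_pos (div_pos hw hf)
    calc w * Real.log (w / f) ≤ w * (w / f) := by gcongr; linarith
      _ ≤ B * (w / f) := by gcongr

namespace SlowRegime

variable {eMin eMax qMin qMax a b c r K L M P₀ P₁ s : ℝ} {W : ℝ → ℝ → ℝ} {p : ℝ → ℝ}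
  {q e₀ e : ℝ}

/-- The contribution to the relative entropy of values `q` far from the mean `m(e)`. -/
lemma setIntegral_far_bounds (h : SlowRegime eMin eMax qMin qMax a b K L M P₀ P₁ s W p)
    (he : e ∈ Ioo eMin eMax) {d lk : ℝ} (hd : 0 < d) (hB : K * s ^ 2 / d ^ 3 ≤ 1)
    {S : Set ℝ} (hS : MeasurableSet S) (hfar : ∀ q ∈ S, d ≤ |q - condMean W e|)
    (h1 : Integrable fun q => W q e * (Real.log (W q e) - Real.log (outputDensity W p q) + lk))
    (h2 : Integrable fun q => W q e / outputDensity W p q) :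
    (-(s ^ 2 / d ^ 2 * (|Real.log s| + |lk|)) - s * (1 + (qMax - qMin)) ≤
      ∫ q in S, W q e * (Real.log (W q e) - Real.log (outputDensity W p q) + lk)) ∧
    ∫ q in S, W q e * (Real.log (W q e) - Real.log (outputDensity W p q) + lk) ≤
      K * s ^ 2 / d ^ 3 * (∫ q, W q e / outputDensity W p q) + s ^ 2 / d ^ 2 * |lk| := by
  have hWd := h.channel.isDensityOn he
  have hf := h.isBoundedPair.isDensityOn_output
  have hmass := h.setIntegral_le_of_far he hd hS hfar
  have hK := h.K_pos
  have hs := h.pos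
  have hi : Integrable ((Ioo qMin qMax).indicator fun _ : ℝ => (1 : ℝ)) :=
    (integrable_indicator_iff measurableSet_Ioo).2 (integrableOn_const (by simp))
  constructor
  -- The first term integrates to Chebyshev's mass times the logarithms, the second to `s` times at
  -- most `1 + (qMax - qMin)`; the indicator replaces the constant `1` so that it stays integrable.
  · have hlow : ∀ q, -((|Real.log s| + |lk|) * W q e) -
        s * (outputDensity W p q + (Ioo qMin qMax).indicator (fun _ : ℝ => (1 : ℝ)) q) ≤
        W q e * (Real.log (W q e) - Real.log (outputDensity W p q) + lk) := fun q => by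
      by_cases hq : q ∈ Ioo qMin qMax
      · have h3 := neg_le_mul_log_sub (hWd.nonneg q) (hf.nonneg q) hs
        have h4 := mul_le_mul_of_nonneg_left (neg_abs_le lk) (hWd.nonneg q)
        rw [indicator_of_mem hq]
        linarith
      · simp [hWd.support q hq, hf.support q hq, indicator_of_notMem hq]
    have hg1 : Integrable fun q => -((|Real.log s| + |lk|) * W q e) :=
      (hWd.integrable.const_mul _).neg
    have hg2 : Integrable fun q => s * (outputDensity W p q +
        (Ioo qMin qMax).indicator (fun _ : ℝ => (1 : ℝ)) q) := (hf.integrable.add hi).const_mul s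
    have hg : Integrable fun q => -((|Real.log s| + |lk|) * W q e) -
        s * (outputDensity W p q + (Ioo qMin qMax).indicator (fun _ : ℝ => (1 : ℝ)) q) :=
      hg1.sub hg2
    refine le_trans ?_ (setIntegral_mono hg.integrableOn h1.integrableOn hlow)
    rw [integral_sub hg1.integrableOn hg2.integrableOn, integral_neg, integral_const_mul,
      integral_const_mul]
    have h5 : ∫ q in S, (outputDensity W p q +
        (Ioo qMin qMax).indicator (fun _ : ℝ => (1 : ℝ)) q) ≤ 1 + (qMax - qMin) := by
      refine (setIntegral_le_integral (hf.integrable.add hi)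
        (Filter.Eventually.of_forall fun q => ?_)).trans (le_of_eq ?_)
      · exact add_nonneg (hf.nonneg q) (indicator_nonneg (fun _ _ => zero_le_one) q)
      · refine (integral_add hf.integrable hi).trans ?_
        rw [hf.integral_eq_one, integral_indicator measurableSet_Ioo, setIntegral_const,
          smul_eq_mul, mul_one, Real.volume_real_Ioo, max_eq_left (sub_pos.2 hf.lt).le]
    have h6 := mul_le_mul_of_nonneg_left hmass
      (add_nonneg (abs_nonneg (Real.log s)) (abs_nonneg lk))
    have h7 := mul_le_mul_of_nonneg_left h5 hs.le
    linarith
  · have hup : ∀ q ∈ S, W q e * (Real.log (W q e) - Real.log (outputDensity W p q) + lk) ≤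
        K * s ^ 2 / d ^ 3 * (W q e / outputDensity W p q) + |lk| * W q e := fun q hq => by
      have h3 := mul_log_sub_le (hWd.nonneg q) (hf.nonneg q)
        (h.cond_le_of_far he hd (hfar q hq)) hB
      have h4 := mul_le_mul_of_nonneg_left (le_abs_self lk) (hWd.nonneg q)
      linarith
    have hg : Integrable fun q =>
        K * s ^ 2 / d ^ 3 * (W q e / outputDensity W p q) + |lk| * W q e :=
      (h2.const_mul _).add (hWd.integrable.const_mul _)
    refine (setIntegral_mono_on h1.integrableOn hg.integrableOn hS hup).trans ?_
    rw [integral_add (h2.const_mul _).integrableOn (hWd.integrable.const_mul _).integrableOn,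
      integral_const_mul, integral_const_mul]
    have h5 : ∫ q in S, W q e / outputDensity W p q ≤ ∫ q, W q e / outputDensity W p q :=
      setIntegral_le_integral h2 (Filter.Eventually.of_forall fun q =>
        div_nonneg (hWd.nonneg q) (hf.nonneg q))
    have h6 := mul_le_mul_of_nonneg_left hmass (abs_nonneg lk)
    have h7 : K * s ^ 2 / d ^ 3 * ∫ q in S, W q e / outputDensity W p q ≤
        K * s ^ 2 / d ^ 3 * ∫ q, W q e / outputDensity W p q := by gcongr
    linarith

lemma logNear_outputScale (h : SlowRegime eMin eMax qMin qMax a b K L M P₀ P₁ s W p) {e e' : ℝ}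
    (he : e ∈ Icc a b) (he' : e' ∈ Icc a b) :
    LogNear (2 * (L * |e - e'|)) (p e / deriv (condMean W) e)
      (p e' / deriv (condMean W) e') := by
  have := (h.logNear_input he he').div (h.logNear_deriv he he') (h.input_apply_pos he').le
    (h.deriv_pos he')
  rwa [← two_mul] at this

lemma integral_cond_eq_shape (h : SlowRegime eMin eMax qMin qMax a b K L M P₀ P₁ s W p)
    (he : e ∈ Ioo eMin eMax) (T : ℝ) (l : ℝ → ℝ) :
    ∫ q' in (fun q' => stdCoord W q' e) ⁻¹' Icc (-T) T, W q' e * l q' =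
      ∫ x in Icc (-T) T, shape W x e * l (condMean W e + condSD W e * x) := by
  have hσ := (h.sd_pos he).ne'
  have hmeas : Measurable fun q' => stdCoord W q' e :=
    (measurable_id.sub_const (condMean W e)).div_const (condSD W e)
  rw [← integral_indicator (hmeas measurableSet_Icc), h.channel.integral_standardise he,
    ← integral_indicator measurableSet_Icc]
  refine integral_congr_ae (Filter.Eventually.of_forall fun x => ?_)
  have hx : stdCoord W (condMean W e + condSD W e * x) e = x := by
    unfold stdCoord
    rw [add_sub_cancel_left, mul_div_cancel_left₀ _ hσ]
  by_cases hxT : x ∈ Icc (-T) T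
  · simp only
    rw [indicator_of_mem hxT, indicator_of_mem (by rwa [mem_preimage, hx]), shape, mul_assoc]
  · simp only
    rw [indicator_of_notMem hxT, indicator_of_notMem (by rwa [mem_preimage, hx]), mul_zero]

end SlowRegime

set_option maxHeartbeats 1000000 in
/-- For `e` slightly above an inner point, the contribution to the relative entropy of the values
`q` near the mean. -/
lemma exists_abs_setIntegral_near_sub_le {K L M P₀ c r : ℝ} (hK : 1 ≤ K) (hL : 0 ≤ L)
    (hM : 0 < M) (hP₀ : 0 < P₀) (hc : 0 < c) (hrad : IsRadius K L (c / 2) r) :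
    ∃ A s₀ : ℝ, 0 < A ∧ 0 < s₀ ∧ ∀ {eMin eMax qMin qMax a b P₁ s : ℝ} {W : ℝ → ℝ → ℝ}
      {p : ℝ → ℝ} {q e₀ e : ℝ}, SlowRegime eMin eMax qMin qMax a b K L M P₀ P₁ s W p →
      IsInner a b c W q e₀ → e ∈ Icc a b → e ∈ Icc e₀ (e₀ + s) → s ≤ s₀ →
      (Integrable fun q' => W q' e * (Real.log (W q' e) - Real.log (outputDensity W p q') +
        Real.log (condSD W e₀ * (p e₀ / deriv (condMean W) e₀)))) →
      |(∫ q' in (fun q' => stdCoord W q' e) ⁻¹' Icc (-(c / 4 / s)) (c / 4 / s),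
        W q' e * (Real.log (W q' e) - Real.log (outputDensity W p q') +
          Real.log (condSD W e₀ * (p e₀ / deriv (condMean W) e₀)))) -
        ∫ x, shape W x e₀ * Real.log (shape W x e₀)| ≤ A * s := by
  have hK0 : 0 < K := by linarith
  have hΓ := tailConst_nonneg hK
  obtain ⟨A', s', hA', hs', hf⟩ := exists_logNear_outputDensity hK hL hM hP₀ hrad.pos
  -- The terms come from the shape and the width at `e` against `e₀`, from the change of `p / m'`,
  -- and from the approximation of the output density.
  set D := 2 * L + 2 * L * K * (M + 1) + A' with hD
  have hD0 : 0 < D := by positivity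
  refine ⟨D * Real.exp (D * (1 + c)) * tailConst K + tailConst K / (c / 4) + 1,
    min s' (min 1 (c / (4 * M))), by positivity, by positivity, ?_⟩
  intro eMin eMax qMin qMax a b P₁ s W p q e₀ e h hi heab he hs hF
  have hs0 := h.pos
  have hss' : s ≤ s' := hs.trans (min_le_left _ _)
  have hs1 : s ≤ 1 := hs.trans ((min_le_right _ _).trans (min_le_left _ _))
  have hsM : M * s ≤ c / 4 := by
    have h1 : s ≤ c / (4 * M) := hs.trans ((min_le_right _ _).trans (min_le_right _ _))
    rw [le_div_iff₀ (by positivity)] at h1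
    linarith
  have heI := h.mem_Ioo heab
  have heI₀ := h.mem_Ioo hi.mem
  have hσ := h.sd_pos heI
  have hσ₀ := h.sd_pos heI₀
  have hθ0 := h.outputScale_pos hi.mem
  set T := c / 4 / s with hT
  have hT0 : 0 < T := by positivity
  rw [h.integral_cond_eq_shape heI]
  set lk := Real.log (condSD W e₀ * (p e₀ / deriv (condMean W) e₀)) with hlk
  set f := outputDensity W p with hfdef
  set F : ℝ → ℝ := fun x => shape W x e *
    (Real.log (W (condMean W e + condSD W e * x) e) -
      Real.log (f (condMean W e + condSD W e * x)) + lk) with hFdef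
  have hFi : Integrable F := by
    have h1 := ((hF.comp_add_left (condMean W e)).comp_mul_left' hσ.ne').const_mul (condSD W e)
    refine h1.congr (Filter.Eventually.of_forall fun x => ?_)
    simp only [hFdef, shape]
    ring
  have hG := integrable_mul_log_of_errWeight hK (h.measurable_shape heI₀) (h.shape_nonneg heI₀)
    (h.slow.shape_le e₀ heI₀)
  have hwi := h.integrable_shapeWeight heI₀
  have htail := abs_integral_sub_setIntegral_le hK (h.measurable_shape heI₀)
    (h.shape_nonneg heI₀) (h.slow.shape_le e₀ heI₀) hG (fun x => by
      have := h.shape_nonneg heI₀ x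
      rw [abs_mul, abs_of_nonneg this]
      unfold errWeight
      gcongr
      linarith) hT0
  have hpt : ∀ x ∈ Icc (-T) T, |F x - shape W x e₀ * Real.log (shape W x e₀)| ≤
      D * Real.exp (D * (1 + c)) * s * errWeight (fun x => shape W x e₀) x := fun x hx => by
    have hxT : |x| ≤ T := abs_le.2 hx
    have hsx : s * |x| ≤ c / 4 := by
      rwa [hT, le_div_iff₀ hs0, mul_comm] at hxT
    have hx0 := abs_nonneg x
    have hee₀ : |e - e₀| ≤ s := by
      rw [abs_of_nonneg (sub_nonneg.2 he.1)]
      linarith [he.2]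
    have hmm : |condMean W e - q| ≤ M * s := by
      rw [← hi.mean_eq, abs_of_nonneg (sub_nonneg.2 (h.mean_le_of_le heI₀ heI he.1))]
      refine (h.mean_sub_le_mul_sub hi.mem heab he.1).trans ?_
      gcongr
      linarith [he.2]
    set q' := condMean W e + condSD W e * x with hq'
    have hσx : |condSD W e * x| ≤ s * |x| := by
      rw [abs_mul, abs_of_pos hσ]
      have := h.sd_le heI
      gcongr
    have hσ₀x : |condSD W e₀ * x| ≤ s * |x| := by
      rw [abs_mul, abs_of_pos hσ₀]
      have := h.sd_le heI₀
      gcongr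
    have hqq : |q' - q| ≤ s * (M + |x|) := by
      have : q' - q = (condMean W e - q) + condSD W e * x := by rw [hq']; ring
      rw [this]
      refine (abs_add_le _ _).trans ?_
      linarith
    -- The truncation at `T = c / (4 s)` and `M s ≤ c / 4` each use a quarter of the margin, so `q'`
    -- keeps a margin `c / 2`.
    have hqq2 : |q' - q| ≤ c / 2 := by linarith
    -- The output density at `q'` is evaluated through the point `e'` whose mean is `q'`; slow
    -- change then carries `p / m'` from `e'` back to `e₀`.
    obtain ⟨e', hi'⟩ := h.exists_isInner (c := c / 2) (q := q') (by positivity)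
      (by linarith [(abs_le.1 hqq2).1, hi.left]) (by linarith [(abs_le.1 hqq2).2, hi.right])
    have hfq := hf h hi' hrad hss'
    have hθ' := h.outputScale_pos hi'.mem
    have hfpos := hfq.pos hθ'
    have h1 := hfq.abs_log_sub_le hθ'
    have h2 := (h.logNear_outputScale hi'.mem hi.mem).abs_log_sub_le hθ0
    have h3 : |e' - e₀| ≤ K * (s * (M + |x|)) := by
      refine (h.abs_sub_le hi'.mem hi.mem).trans ?_
      rw [hi'.mean_eq, hi.mean_eq]
      gcongr
    have h4 := (h.logNear_sd heab hi.mem).abs_log_sub_le hσ₀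
    have hsh := h.logNear_shape (x := x) heab hi.mem
      (h.mem_range_of_isInner hi (by linarith))
      (h.mem_range_of_isInner hi (by
        rw [hi.mean_eq, add_sub_cancel_left]
        linarith))
    have hφ0 := h.shape_nonneg heI₀ x
    have hLe : L * |e - e₀| ≤ L * s := by gcongr
    have hL3 : L * |e' - e₀| ≤ L * (K * (s * (M + |x|))) := by gcongr
    have hMx : M + |x| ≤ (M + 1) * (1 + |x|) := by nlinarith
    have hsMx : L * (K * (s * (M + |x|))) ≤ L * (K * (s * ((M + 1) * (1 + |x|)))) := by gcongr
    have hs1x : s ≤ s * (1 + |x|) := le_mul_of_one_le_right hs0.le (by linarith)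
    have hL1x : L * s ≤ L * (s * (1 + |x|)) := by gcongr
    have hA1x : A' * s ≤ A' * (s * (1 + |x|)) := by gcongr
    have hLK0 : 0 ≤ L * (K * (s * ((M + 1) * (1 + |x|)))) := by positivity
    have hε : L * s + L * s + 2 * (L * (K * (s * (M + |x|)))) + A' * s ≤
        D * (s * (1 + |x|)) := by
      rw [hD]
      nlinarith
    have hε1 : L * |e - e₀| ≤ D * (s * (1 + |x|)) := by
      refine hLe.trans (le_trans ?_ hε)
      have : 0 ≤ L * s := by positivity
      have : 0 ≤ A' * s := by positivity
      have : 0 ≤ L * (K * (s * (M + |x|))) := by positivity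
      linarith
    have h5 := (hsh.mono hε1 hφ0).abs_mul_sub_mul_log_le (t := shape W x e₀)
      (l := Real.log (W q' e) - Real.log (f q') + lk) hφ0 fun hpos => by
        have h6 := hsh.abs_log_sub_le hpos
        have hφe := hsh.pos hpos
        have hWe : Real.log (shape W x e) = Real.log (condSD W e) + Real.log (W q' e) := by
          have hW0 : W q' e ≠ 0 := by
            intro h0
            rw [shape, ← hq', h0, mul_zero] at hφe
            exact lt_irrefl _ hφe
          rw [shape, Real.log_mul hσ.ne' hW0]
        rw [hlk, Real.log_mul hσ₀.ne' hθ0.ne']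
        refine le_trans ?_ hε
        have h7 : |Real.log (shape W x e) - Real.log (shape W x e₀)| ≤ L * s := h6.trans hLe
        have h8 := h4.trans hLe
        have h9 : |Real.log (p e' / deriv (condMean W) e') -
            Real.log (p e₀ / deriv (condMean W) e₀)| ≤ 2 * (L * (K * (s * (M + |x|)))) :=
          h2.trans (by linarith)
        rw [hWe] at h7
        rw [abs_le] at *
        constructor <;> linarith [h1.1, h1.2, h7.1, h7.2, h8.1, h8.2, h9.1, h9.2]
    refine h5.trans ?_
    have h10 : D * (s * (1 + |x|)) ≤ D * (1 + c) := by
      gcongr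
      linarith
    calc _ ≤ D * (s * (1 + |x|)) * Real.exp (D * (1 + c)) *
          (shape W x e₀ * (1 + |Real.log (shape W x e₀)|)) := by gcongr
      _ = _ := by simp only [errWeight]; ring
  have hnear : |(∫ x in Icc (-T) T, F x) -
      ∫ x in Icc (-T) T, shape W x e₀ * Real.log (shape W x e₀)| ≤
      D * Real.exp (D * (1 + c)) * s * tailConst K := by
    rw [← integral_sub hFi.integrableOn hG.integrableOn]
    calc _ ≤ ∫ x in Icc (-T) T, |F x - shape W x e₀ * Real.log (shape W x e₀)| :=
          abs_integral_le_integral_abs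
      _ ≤ ∫ x in Icc (-T) T,
          D * Real.exp (D * (1 + c)) * s * errWeight (fun x => shape W x e₀) x :=
          setIntegral_mono_on (hFi.sub hG).abs.integrableOn (hwi.const_mul _).integrableOn
            measurableSet_Icc hpt
      _ = D * Real.exp (D * (1 + c)) * s *
          ∫ x in Icc (-T) T, errWeight (fun x => shape W x e₀) x := integral_const_mul _ _
      _ ≤ _ := by
          gcongr
          exact (setIntegral_le_integral hwi (Filter.Eventually.of_forall
            (errWeight_nonneg (h.shape_nonneg heI₀)))).trans (h.integral_shapeWeight_le heI₀)
  have e1 : tailConst K / T = tailConst K / (c / 4) * s := by rw [hT]; field_simp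
  rw [e1] at htail
  rw [abs_le] at *
  constructor <;> linarith [hnear.1, hnear.2, htail.1, htail.2]

/-- For almost every `e` slightly above an inner point, the relative entropy of the law of `Q` given
`E = e` with respect to the law of `Q`. -/
lemma exists_relEntropy_bounds {K L M P₀ P₁ c r qMin qMax : ℝ} (hK : 1 ≤ K) (hL : 0 ≤ L)
    (hM : 0 < M) (hP₀ : 0 < P₀) (hP₁ : 0 < P₁) (hc : 0 < c) (hq : qMin < qMax)
    (hrad : IsRadius K L (c / 2) r) :
    ∃ A s₀ : ℝ, 0 < A ∧ 0 < s₀ ∧ ∀ {eMin eMax a b s : ℝ} {W : ℝ → ℝ → ℝ}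
      {p : ℝ → ℝ} {q e₀ e : ℝ}, SlowRegime eMin eMax qMin qMax a b K L M P₀ P₁ s W p →
      IsInner a b c W q e₀ → e ∈ Icc a b → e ∈ Icc e₀ (e₀ + s) → s ≤ s₀ →
      (Integrable fun q' => W q' e * (Real.log (W q' e) - Real.log (outputDensity W p q'))) →
      (Integrable fun q' => W q' e / outputDensity W p q') →
      ((∫ x, shape W x e₀ * Real.log (shape W x e₀)) - A * s ≤
        (∫ q', W q' e * (Real.log (W q' e) - Real.log (outputDensity W p q'))) +
          Real.log (condSD W e₀ * (p e₀ / deriv (condMean W) e₀))) ∧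
      (∫ q', W q' e * (Real.log (W q' e) - Real.log (outputDensity W p q'))) +
          Real.log (condSD W e₀ * (p e₀ / deriv (condMean W) e₀)) ≤
        (∫ x, shape W x e₀ * Real.log (shape W x e₀)) + A * s +
          A * s ^ 2 * ∫ q', W q' e / outputDensity W p q' := by
  have hK0 : 0 < K := by linarith
  obtain ⟨A', s', hA', hs', hn⟩ := exists_abs_setIntegral_near_sub_le hK hL hM hP₀ hc hrad
  -- A coordinate beyond `c / (4 s)` and `σ ≥ s / K` place `q'` at distance at least `c / (4 K)`
  -- from the mean.
  set d := c / (4 * K) with hd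
  have hd0 : 0 < d := by positivity
  set C₂ := K * P₁ + K * M / P₀ with hC₂
  have hC₂0 : 0 < C₂ := by positivity
  have hR : 0 < qMax - qMin := sub_pos.2 hq
  refine ⟨A' + (2 + C₂) / d ^ 2 + (1 + (qMax - qMin)) + K / d ^ 3,
    min s' (min 1 (d ^ 3 / K)), by positivity, by positivity, ?_⟩
  intro eMin eMax a b s W p q e₀ e h hi heab he hs h1 h2
  have hs0 := h.pos
  have hss' : s ≤ s' := hs.trans (min_le_left _ _)
  have hs1 : s ≤ 1 := hs.trans ((min_le_right _ _).trans (min_le_left _ _))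
  have hsd : s ≤ d ^ 3 / K := hs.trans ((min_le_right _ _).trans (min_le_right _ _))
  have hss : s ^ 2 ≤ s := by nlinarith
  have hB : K * s ^ 2 / d ^ 3 ≤ 1 := by
    rw [div_le_one (by positivity)]
    rw [le_div_iff₀ hK0] at hsd
    nlinarith
  have heI := h.mem_Ioo heab
  have hWd := h.channel.isDensityOn heI
  have hlk := h.abs_log_scale_le hi.mem hs1
  set lk := Real.log (condSD W e₀ * (p e₀ / deriv (condMean W) e₀)) with hlkdef
  set J := ∫ x, shape W x e₀ * Real.log (shape W x e₀) with hJ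
  set f := outputDensity W p with hf
  have hls : |Real.log s| ≤ 2 / s := by
    refine (abs_log_le_add_inv hs0).trans ?_
    have h3 : 1 ≤ s⁻¹ := (one_le_inv₀ hs0).2 hs1
    rw [div_eq_mul_inv]
    linarith
  have hF : Integrable fun q' => W q' e * (Real.log (W q' e) - Real.log (f q') + lk) := by
    refine (h1.add (hWd.integrable.mul_const lk)).congr (Filter.Eventually.of_forall fun q' => ?_)
    simp only [Pi.add_apply]
    ring
  have hFint : ∫ q', W q' e * (Real.log (W q' e) - Real.log (f q') + lk) =
      (∫ q', W q' e * (Real.log (W q' e) - Real.log (f q'))) + lk := by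
    simp only [mul_add]
    rw [integral_add h1 (hWd.integrable.mul_const lk), integral_mul_const, hWd.integral_eq_one,
      one_mul]
  have hmeas : Measurable fun q' => stdCoord W q' e :=
    (measurable_id.sub_const (condMean W e)).div_const (condSD W e)
  set S := (fun q' => stdCoord W q' e) ⁻¹' Icc (-(c / 4 / s)) (c / 4 / s) with hS
  have hSm : MeasurableSet S := hmeas measurableSet_Icc
  have hnear := hn h hi heab he hss' hF
  have hfar := h.setIntegral_far_bounds heI (lk := lk) hd0 hB hSm.compl (fun q' hq' => by
    have h4 : c / 4 / s < |stdCoord W q' e| := by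
      by_contra hle
      exact hq' (abs_le.1 (not_lt.1 hle))
    rw [h.abs_sub_mean heI, hd]
    rw [div_lt_iff₀ hs0] at h4
    have h5 := mul_le_mul_of_nonneg_left (h.le_sd heI) (abs_nonneg (stdCoord W q' e))
    rw [div_le_iff₀ (by positivity)]
    linarith) hF h2
  have hsplit := integral_add_compl hSm hF
  rw [hFint] at hsplit
  have hm1 : s ^ 2 / d ^ 2 * (|Real.log s| + |lk|) ≤ (2 + C₂) / d ^ 2 * s := by
    calc s ^ 2 / d ^ 2 * (|Real.log s| + |lk|) ≤ s ^ 2 / d ^ 2 * (2 / s + C₂ / s) := by gcongr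
      _ = _ := by field_simp
  have hm2 : s ^ 2 / d ^ 2 * |lk| ≤ s ^ 2 / d ^ 2 * (|Real.log s| + |lk|) := by
    gcongr
    linarith [abs_nonneg (Real.log s)]
  have hV : 0 ≤ ∫ q', W q' e / f q' := integral_nonneg fun q' =>
    div_nonneg (hWd.nonneg q') (h.isBoundedPair.outputDensity_nonneg q')
  have hpos1 : 0 ≤ K / d ^ 3 * s := by positivity
  have hpos2 : 0 ≤ (1 + (qMax - qMin)) * s := by positivity
  have hpos3 : 0 ≤ (A' + (2 + C₂) / d ^ 2 + (1 + (qMax - qMin))) * s ^ 2 *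
    ∫ q', W q' e / f q' := by positivity
  have e1 : K * s ^ 2 / d ^ 3 = K / d ^ 3 * s ^ 2 := by ring
  rw [e1] at hfar
  obtain ⟨hn1, hn2⟩ := abs_le.1 hnear
  constructor
  · linarith [hfar.1]
  · linarith [hfar.2]

/-- The capacity in terms of the standardised conditional density at an inner point. -/
lemma exists_abs_capacity_sub_le {K L M P₀ P₁ c r qMin qMax : ℝ} (hK : 1 ≤ K) (hL : 0 ≤ L)
    (hM : 0 < M) (hP₀ : 0 < P₀) (hP₁ : 0 < P₁) (hc : 0 < c) (hq : qMin < qMax)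
    (hrad : IsRadius K L (c / 2) r) :
    ∃ A s₀ : ℝ, 0 < A ∧ 0 < s₀ ∧ ∀ {eMin eMax a b s : ℝ} {W : ℝ → ℝ → ℝ}
      {p : ℝ → ℝ} {q e₀ : ℝ}, SlowRegime eMin eMax qMin qMax a b K L M P₀ P₁ s W p →
      IsCapacityAchieving eMin eMax W p → IsInner a b c W q e₀ → s ≤ s₀ →
      |Real.log 2 * mutualInfo W p +
        Real.log (condSD W e₀ * (p e₀ / deriv (condMean W) e₀)) -
        ∫ x, shape W x e₀ * Real.log (shape W x e₀)| ≤ A * s := by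
  obtain ⟨A, s', hA, hs', hb⟩ := exists_relEntropy_bounds hK hL hM hP₀ hP₁ hc hq hrad
  have hR : 0 < qMax - qMin := sub_pos.2 hq
  refine ⟨A + A * (qMax - qMin) / P₀, min s' (c / M), by positivity, by positivity, ?_⟩
  intro eMin eMax a b s W p q e₀ h hcap hi hs
  have hs0 := h.pos
  have hss' : s ≤ s' := hs.trans (min_le_left _ _)
  have hsM : s ≤ c / M := hs.trans (min_le_right _ _)
  have hbp := h.isBoundedPair
  have hp := h.input.isDensityOn
  have hright : e₀ + s ≤ b := by
    have h1 := h.mean_sub_le_mul_sub hi.mem (right_mem_Icc.2 h.lt.le) hi.mem.2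
    rw [hi.mean_eq] at h1
    rw [le_div_iff₀ hM] at hsM
    have h2 : s * M ≤ (b - e₀) * M := by linarith [hi.right]
    have := le_of_mul_le_mul_right h2 hM
    linarith
  -- The optimality condition is an identity between integrals over sets, so `e₀` is thickened to an
  -- interval. Length `s` is short enough to change the relative entropy by `O(s)` only, and long
  -- enough that the error `s ^ 2 (qMax - qMin)`, divided by a mass of at least `P₀ s`, is still
  -- `O(s)`.
  set N := Icc e₀ (e₀ + s) with hN
  have hNm : MeasurableSet N := measurableSet_Icc
  have hNab : ∀ e ∈ N, e ∈ Icc a b := fun e he => ⟨hi.mem.1.trans he.1, he.2.trans hright⟩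
  set f := outputDensity W p with hf
  set lk := Real.log (condSD W e₀ * (p e₀ / deriv (condMean W) e₀)) with hlk
  set J := ∫ x, shape W x e₀ * Real.log (shape W x e₀) with hJ
  have hkkt := hcap.setIntegral_eq hbp hNm
  set X := Real.log 2 * mutualInfo W p with hX
  set P := ∫ e in N, p e with hP
  set G : ℝ → ℝ := fun e => ∫ q', W q' e * p e * (Real.log (W q' e) - Real.log (f q')) with hG
  set V : ℝ → ℝ := fun e => ∫ q', W q' e * p e / f q' with hV
  have hjoint : Integrable (fun z : ℝ × ℝ => W z.1 z.2 * p z.2 *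
      (Real.log (W z.1 z.2) - Real.log (f z.1))) (volume.prod volume) := by
    refine (hbp.integrable_joint_mul_log.sub hbp.integrable_joint_mul_log_output).congr
      (Filter.Eventually.of_forall fun z => ?_)
    simp only [Pi.sub_apply]
    ring
  have hGi : Integrable G := hjoint.integral_prod_right
  have hVi : Integrable V := hbp.integrable_joint_div_output.integral_prod_right
  have hpP : P₀ * s ≤ P := by
    have h1 : ∫ _ in N, P₀ ≤ P :=
      setIntegral_mono_on (integrableOn_const (by simp [hN])) hp.integrable.integrableOn hNm
        fun e he => h.input_ge e (hNab e he)
    rwa [setIntegral_const, hN, Real.volume_real_Icc, add_sub_cancel_left, max_eq_left hs0.le,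
      smul_eq_mul, mul_comm] at h1
  have hP0 : 0 < P := lt_of_lt_of_le (by positivity) hpP
  have hVle : ∫ e in N, V e ≤ qMax - qMin :=
    (setIntegral_le_integral hVi (Filter.Eventually.of_forall fun e => integral_nonneg fun q' =>
      div_nonneg (hbp.joint_nonneg q' e) (hbp.outputDensity_nonneg q'))).trans
      hbp.integral_integral_joint_div_output_le
  -- Fubini gives the two integrability conditions for almost every `e` only, which suffices after
  -- integration over `N`.
  have hae : ∀ᵐ e ∂(volume.restrict N), p e * (J - A * s) ≤ G e + lk * p e ∧
      G e + lk * p e ≤ p e * (J + A * s) + A * s ^ 2 * V e := by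
    filter_upwards [ae_restrict_of_ae hjoint.prod_left_ae,
      ae_restrict_of_ae hbp.integrable_joint_div_output.prod_left_ae,
      ae_restrict_mem hNm] with e h1 h2 he
    have hpe := h.input_apply_pos (hNab e he)
    have h3 : Integrable fun q' => W q' e * (Real.log (W q' e) - Real.log (f q')) := by
      refine (h1.const_mul (p e)⁻¹).congr (Filter.Eventually.of_forall fun q' => ?_)
      simp only
      field_simp
    have h4 : Integrable fun q' => W q' e / f q' := by
      refine (h2.const_mul (p e)⁻¹).congr (Filter.Eventually.of_forall fun q' => ?_)
      simp only
      rw [← hf, mul_comm (W q' e), mul_div_assoc, inv_mul_cancel_left₀ hpe.ne']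
    have h5 := hb h hi (hNab e he) he hss' h3 h4
    have h6 : G e = p e * ∫ q', W q' e * (Real.log (W q' e) - Real.log (f q')) := by
      rw [← integral_const_mul]
      refine integral_congr_ae (Filter.Eventually.of_forall fun q' => ?_)
      simp only
      ring
    have h7 : V e = p e * ∫ q', W q' e / f q' := by
      rw [← integral_const_mul]
      refine integral_congr_ae (Filter.Eventually.of_forall fun q' => ?_)
      simp only
      ring
    rw [h6, h7]
    have h8 := mul_le_mul_of_nonneg_left h5.1 hpe.le
    have h9 := mul_le_mul_of_nonneg_left h5.2 hpe.le
    constructor <;> linarith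
  have hpi : IntegrableOn p N := hp.integrable.integrableOn
  have hmid : ∫ e in N, (G e + lk * p e) = (X + lk) * P := by
    rw [integral_add hGi.integrableOn (hpi.const_mul lk), integral_const_mul, hkkt]
    ring
  have hlow : P * (J - A * s) ≤ (X + lk) * P := by
    rw [← hmid, hP, ← integral_mul_const]
    exact integral_mono_ae (hpi.mul_const _) (hGi.integrableOn.add (hpi.const_mul lk))
      (hae.mono fun e he => he.1)
  have hup : (X + lk) * P ≤ P * (J + A * s) + A * s ^ 2 * (qMax - qMin) := by
    calc (X + lk) * P ≤ ∫ e in N, (p e * (J + A * s) + A * s ^ 2 * V e) := by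
          rw [← hmid]
          exact integral_mono_ae (hGi.integrableOn.add (hpi.const_mul lk))
            ((hpi.mul_const _).add (hVi.integrableOn.const_mul _)) (hae.mono fun e he => he.2)
      _ = P * (J + A * s) + A * s ^ 2 * ∫ e in N, V e := by
          rw [integral_add (hpi.mul_const _) (hVi.integrableOn.const_mul _), integral_mul_const,
            integral_const_mul]
      _ ≤ _ := by gcongr
  have hlow' : J - A * s ≤ X + lk :=
    le_of_mul_le_mul_right (by linarith) hP0
  have hup' : X + lk ≤ J + A * s + A * (qMax - qMin) / P₀ * s := by
    refine le_of_mul_le_mul_right (hup.trans ?_) hP0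
    have h1 : A * s ^ 2 * (qMax - qMin) ≤ A * (qMax - qMin) / P₀ * s * P := by
      calc A * s ^ 2 * (qMax - qMin) = A * (qMax - qMin) / P₀ * s * (P₀ * s) := by field_simp
        _ ≤ _ := by gcongr
    linarith
  have hpos : 0 ≤ A * (qMax - qMin) / P₀ * s := by positivity
  rw [abs_le]
  constructor <;> linarith

/-! ### Comparison of the two distribution functions, and the posterior mean. -/

namespace IsBoundedPair

variable {eMin eMax qMin qMax B : ℝ} {W : ℝ → ℝ → ℝ} {p : ℝ → ℝ}

lemma integrable_condCdf_mul (h : IsBoundedPair eMin eMax qMin qMax B W p) (y : ℝ) :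
    Integrable fun e => (∫ q in Iic y, W q e) * p e := by
  have hm : Measurable fun e => ∫ q in Iic y, W q e :=
    (StronglyMeasurable.integral_prod_left' (f := fun z : ℝ × ℝ => W z.1 z.2)
      h.channel.measurable.stronglyMeasurable).measurable
  refine h.input.isDensityOn.integrable_mul_of_bound hm 1 fun e he => ?_
  rw [abs_of_nonneg ((h.channel.isDensityOn he).setIntegral_nonneg _)]
  exact (h.channel.isDensityOn he).setIntegral_le_one _

lemma cdf_outputDensity (h : IsBoundedPair eMin eMax qMin qMax B W p) (y : ℝ) :
    cdf (outputDensity W p) y = ∫ e, (∫ q in Iic y, W q e) * p e := by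
  have hi : Integrable (fun z : ℝ × ℝ => W z.1 z.2 * p z.2)
      ((volume.restrict (Iic y)).prod volume) := by
    have := h.integrable_joint.integrableOn (s := Iic y ×ˢ univ)
    rwa [IntegrableOn, ← Measure.prod_restrict, Measure.restrict_univ] at this
  unfold cdf outputDensity
  rw [integral_integral_swap (f := fun q e => W q e * p e) hi]
  simp only [integral_mul_const]

lemma cdf_eq_integral_indicator_mul (p : ℝ → ℝ) (x : ℝ) :
    cdf p x = ∫ e, (Iic x).indicator 1 e * p e := by
  unfold cdf
  rw [← integral_indicator measurableSet_Iic]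
  refine integral_congr_ae (Filter.Eventually.of_forall fun e => ?_)
  by_cases he : e ∈ Iic x
  · simp only [indicator_of_mem he, Pi.one_apply, one_mul]
  · simp only [indicator_of_notMem he, zero_mul]

lemma integrable_indicator_mul (h : IsBoundedPair eMin eMax qMin qMax B W p) (x : ℝ) :
    Integrable fun e => (Iic x).indicator (1 : ℝ → ℝ) e * p e := by
  refine h.input.isDensityOn.integrable_mul_of_bound (measurable_one.indicator measurableSet_Iic) 1
    fun e _ => ?_
  by_cases he : e ∈ Iic x
  · simp [indicator_of_mem he]
  · simp [indicator_of_notMem he]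

end IsBoundedPair

lemma integrable_cauchy (t : ℝ) {l : ℝ} (hl : 0 < l) :
    Integrable fun x : ℝ => (1 + ((x - t) / l) ^ 2)⁻¹ :=
  (integrable_inv_one_add_sq.comp_div hl.ne').comp_sub_right t

lemma integral_cauchy (t : ℝ) {l : ℝ} (hl : 0 < l) :
    ∫ x : ℝ, (1 + ((x - t) / l) ^ 2)⁻¹ = l * Real.pi := by
  rw [integral_sub_right_eq_self (fun x : ℝ => (1 + (x / l) ^ 2)⁻¹) t,
    Measure.integral_comp_div (fun x : ℝ => (1 + x ^ 2)⁻¹), integral_univ_inv_one_add_sq,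
    abs_of_pos hl, smul_eq_mul]

namespace SlowRegime

variable {eMin eMax qMin qMax a b c r K L M P₀ P₁ s : ℝ} {W : ℝ → ℝ → ℝ} {p : ℝ → ℝ}
  {q e₀ e : ℝ}

lemma condCdf_le (h : SlowRegime eMin eMax qMin qMax a b K L M P₀ P₁ s W p)
    (he : e ∈ Ioo eMin eMax) {y d : ℝ} (hd : 0 < d) (hy : y + d ≤ condMean W e) :
    ∫ q in Iic y, W q e ≤ s ^ 2 / d ^ 2 :=
  h.setIntegral_le_of_far he hd measurableSet_Iic fun q hq => by
    have := mem_Iic.1 hq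
    exact le_trans (by linarith) (neg_le_abs _)

lemma le_condCdf (h : SlowRegime eMin eMax qMin qMax a b K L M P₀ P₁ s W p)
    (he : e ∈ Ioo eMin eMax) {y d : ℝ} (hd : 0 < d) (hy : condMean W e + d ≤ y) :
    1 - s ^ 2 / d ^ 2 ≤ ∫ q in Iic y, W q e := by
  have h1 := (h.channel.isDensityOn he).setIntegral_add_compl (measurableSet_Iic (a := y))
  have h2 := h.setIntegral_le_of_far he hd (measurableSet_Iic (a := y)).compl fun q hq => by
    rw [compl_Iic, mem_Ioi] at hq
    exact le_trans (by linarith) (le_abs_self _)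
  linarith

/-- If `E > e` then `m(E) ≥ m(e)`, so `Q ≤ m(e) - d` is a deviation of at least `d` from the mean
and Chebyshev's inequality applies. -/
lemma cdf_output_le (h : SlowRegime eMin eMax qMin qMax a b K L M P₀ P₁ s W p)
    (he : e ∈ Ioo eMin eMax) {d : ℝ} (hd : 0 < d) :
    cdf (outputDensity W p) (condMean W e - d) ≤ cdf p e + s ^ 2 / d ^ 2 := by
  have hp := h.input.isDensityOn
  have hb := h.isBoundedPair
  rw [hb.cdf_outputDensity, IsBoundedPair.cdf_eq_integral_indicator_mul]
  calc _ ≤ ∫ x, ((Iic e).indicator 1 x * p x + s ^ 2 / d ^ 2 * p x) := by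
        refine integral_mono (hb.integrable_condCdf_mul _)
          ((hb.integrable_indicator_mul e).add (hp.integrable.const_mul _)) fun x => ?_
        by_cases hx : x ∈ Ioo eMin eMax
        · simp only
          rw [← add_mul]
          refine mul_le_mul_of_nonneg_right ?_ (hp.nonneg x)
          by_cases hxe : x ∈ Iic e
          · rw [indicator_of_mem hxe, Pi.one_apply]
            have := (h.channel.isDensityOn hx).setIntegral_le_one (Iic (condMean W e - d))
            have : 0 ≤ s ^ 2 / d ^ 2 := by positivity
            linarith
          · rw [indicator_of_notMem hxe, zero_add]
            refine h.condCdf_le hx hd ?_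
            have := h.mean_le_of_le he hx (not_le.1 hxe).le
            linarith
        · simp [hp.support x hx]
    _ = _ := by
        rw [integral_add (hb.integrable_indicator_mul e) (hp.integrable.const_mul _),
          integral_const_mul, hp.integral_eq_one, mul_one]

lemma le_cdf_output (h : SlowRegime eMin eMax qMin qMax a b K L M P₀ P₁ s W p)
    (he : e ∈ Ioo eMin eMax) {d : ℝ} (hd : 0 < d) :
    cdf p e - s ^ 2 / d ^ 2 ≤ cdf (outputDensity W p) (condMean W e + d) := by
  have hp := h.input.isDensityOn
  have hb := h.isBoundedPair
  rw [hb.cdf_outputDensity, IsBoundedPair.cdf_eq_integral_indicator_mul]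
  calc _ = ∫ x, ((Iic e).indicator 1 x * p x - s ^ 2 / d ^ 2 * p x) := by
        rw [integral_sub (hb.integrable_indicator_mul e) (hp.integrable.const_mul _),
          integral_const_mul, hp.integral_eq_one, mul_one]
    _ ≤ _ := by
        refine integral_mono ((hb.integrable_indicator_mul e).sub (hp.integrable.const_mul _))
          (hb.integrable_condCdf_mul _) fun x => ?_
        by_cases hx : x ∈ Ioo eMin eMax
        · simp only
          rw [← sub_mul]
          refine mul_le_mul_of_nonneg_right ?_ (hp.nonneg x)
          by_cases hxe : x ∈ Iic e
          · rw [indicator_of_mem hxe, Pi.one_apply]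
            refine h.le_condCdf hx hd ?_
            have := h.mean_le_of_le hx he hxe
            linarith
          · rw [indicator_of_notMem hxe, zero_sub]
            have := (h.channel.isDensityOn hx).setIntegral_nonneg (Iic (condMean W e + d))
            have : 0 ≤ s ^ 2 / d ^ 2 := by positivity
            linarith
        · simp [hp.support x hx]

lemma abs_cdf_input_sub_le (h : SlowRegime eMin eMax qMin qMax a b K L M P₀ P₁ s W p) {e e' : ℝ}
    (he : e ∈ Icc a b) (he' : e' ∈ Icc a b) : |cdf p e' - cdf p e| ≤ P₁ * |e' - e| := by
  rw [h.input.isDensityOn.cdf_sub, ← Real.norm_eq_abs]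
  refine intervalIntegral.norm_integral_le_of_norm_le_const fun x hx => ?_
  rw [Real.norm_of_nonneg (h.input.nonneg x)]
  exact h.input_le x (uIcc_subset_Icc he he' (uIoc_subset_uIcc hx))

/-- The distribution functions of `Q` and of `E` agree at corresponding inner points. -/
lemma abs_cdf_output_sub_le (h : SlowRegime eMin eMax qMin qMax a b K L M P₀ P₁ s W p)
    (hi : IsInner a b c W q e₀) (hc : 0 < c) :
    |cdf (outputDensity W p) q - cdf p e₀| ≤ 2 * P₁ * (s * K * Real.pi) + s ^ 2 / c ^ 2 := by
  have hp := h.input.isDensityOn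
  have hb := h.isBoundedPair
  have hK := h.K_pos
  have hs := h.pos
  have hP₁ := h.P₁_pos
  have hl : 0 < s * K := by positivity
  rw [hb.cdf_outputDensity, IsBoundedPair.cdf_eq_integral_indicator_mul,
    ← integral_sub (hb.integrable_condCdf_mul _) (hb.integrable_indicator_mul e₀)]
  -- The difference between `P(Q ≤ q | x)` and the indicator of `x ≤ e₀` is at most `1` and, by
  -- Chebyshev, at most `s ^ 2 / |q - m(x)| ^ 2`. As `|q - m(x)| ≥ |x - e₀| / K` on `[a, b]`, both
  -- bounds together give `2 β(x)`, a Cauchy kernel whose integral is proportional to its width `s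
  -- K`. A uniform Chebyshev bound would not give order `s`.
  set β : ℝ → ℝ := fun x => (1 + ((x - e₀) / (s * K)) ^ 2)⁻¹ with hβ
  have hβ0 : ∀ x, 0 ≤ β x := fun x => by simp only [hβ]; positivity
  have hβi : Integrable β := integrable_cauchy e₀ hl
  have hpt : ∀ x, |(∫ q in Iic q, W q x) * p x - (Iic e₀).indicator 1 x * p x| ≤
      2 * P₁ * β x + s ^ 2 / c ^ 2 * p x := fun x => by
    have hsc : 0 ≤ s ^ 2 / c ^ 2 := by positivity
    by_cases hx : x ∈ Ioo eMin eMax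
    · rw [← sub_mul, abs_mul, abs_of_nonneg (hp.nonneg x)]
      have hV0 := (h.channel.isDensityOn hx).setIntegral_nonneg (Iic q)
      have hV1 := (h.channel.isDensityOn hx).setIntegral_le_one (Iic q)
      have hone : |(∫ q in Iic q, W q x) - (Iic e₀).indicator 1 x| ≤ 1 := by
        by_cases hxe : x ∈ Iic e₀
        · rw [indicator_of_mem hxe, Pi.one_apply, abs_le]; constructor <;> linarith
        · rw [indicator_of_notMem hxe, abs_le]; constructor <;> linarith
      have hdist : ∀ d, 0 < d → d ≤ |q - condMean W x| →
          |(∫ q in Iic q, W q x) - (Iic e₀).indicator 1 x| ≤ s ^ 2 / d ^ 2 := fun d hd hdx => by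
        by_cases hxe : x ∈ Iic e₀
        · have h1 := h.mean_le_of_le hx (h.mem_Ioo hi.mem) hxe
          rw [hi.mean_eq] at h1
          rw [abs_of_nonneg (sub_nonneg.2 h1)] at hdx
          have h2 := h.le_condCdf hx hd (y := q) (by linarith)
          rw [indicator_of_mem hxe, Pi.one_apply, abs_sub_comm, abs_of_nonneg (by linarith)]
          linarith
        · have h1 := h.mean_le_of_le (h.mem_Ioo hi.mem) hx (not_le.1 hxe).le
          rw [hi.mean_eq] at h1
          rw [abs_sub_comm, abs_of_nonneg (sub_nonneg.2 h1)] at hdx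
          have h2 := h.condCdf_le hx hd (y := q) (by linarith)
          rwa [indicator_of_notMem hxe, sub_zero, abs_of_nonneg hV0]
      by_cases hab : x ∈ Icc a b
      · have hβle : |(∫ q in Iic q, W q x) - (Iic e₀).indicator 1 x| ≤ 2 * β x := by
          have h3 : |x - e₀| ≤ K * |q - condMean W x| := by
            have := h.abs_sub_le hab hi.mem
            rwa [hi.mean_eq, abs_sub_comm (condMean W x)] at this
          have hden : 0 < 1 + ((x - e₀) / (s * K)) ^ 2 := by positivity
          simp only [hβ]
          rw [← div_eq_mul_inv, le_div_iff₀ hden]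
          rcases (abs_nonneg (q - condMean W x)).eq_or_lt with h0 | h0
          · rw [← h0, mul_zero] at h3
            have h4 : x - e₀ = 0 := abs_nonpos_iff.1 h3
            rw [h4]
            norm_num
            linarith
          · have h5 := hdist _ h0 le_rfl
            have h6 : ((x - e₀) / (s * K)) ^ 2 ≤ |q - condMean W x| ^ 2 / s ^ 2 := by
              rw [div_pow, ← sq_abs (x - e₀), div_le_div_iff₀ (by positivity) (by positivity)]
              calc |x - e₀| ^ 2 * s ^ 2 ≤ (K * |q - condMean W x|) ^ 2 * s ^ 2 := by gcongr
                _ = _ := by ring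
            calc _ = |(∫ q in Iic q, W q x) - (Iic e₀).indicator 1 x| +
                  |(∫ q in Iic q, W q x) - (Iic e₀).indicator 1 x| *
                    ((x - e₀) / (s * K)) ^ 2 := by ring
              _ ≤ 1 + s ^ 2 / |q - condMean W x| ^ 2 * (|q - condMean W x| ^ 2 / s ^ 2) := by
                  gcongr
              _ = 2 := by
                  field_simp
                  norm_num
        calc _ ≤ 2 * β x * P₁ :=
              mul_le_mul hβle (h.input_le x hab) (hp.nonneg x) (by linarith [hβ0 x])
          _ ≤ _ := by
              have := mul_nonneg hsc (hp.nonneg x)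
              linarith
      · have h7 := hdist c hc (h.le_abs_sub_of_notMem hi hx hab)
        have h8 := mul_le_mul_of_nonneg_right h7 (hp.nonneg x)
        have h9 := mul_nonneg hP₁.le (hβ0 x)
        linarith
    · have := mul_nonneg hP₁.le (hβ0 x)
      simp only [hp.support x hx, mul_zero, sub_self, abs_zero, add_zero]
      linarith
  calc _ ≤ ∫ x, |(∫ q in Iic q, W q x) * p x - (Iic e₀).indicator 1 x * p x| :=
        abs_integral_le_integral_abs
    _ ≤ ∫ x, (2 * P₁ * β x + s ^ 2 / c ^ 2 * p x) :=
        integral_mono ((hb.integrable_condCdf_mul _).sub (hb.integrable_indicator_mul e₀)).abs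
          ((hβi.const_mul _).add (hp.integrable.const_mul _)) hpt
    _ = _ := by
        rw [integral_add (hβi.const_mul _) (hp.integrable.const_mul _), integral_const_mul,
          integral_const_mul, hp.integral_eq_one, mul_one, hβ, integral_cauchy e₀ hl]

end SlowRegime

/-- The posterior mean of the distribution function of `E` at an inner point. -/
lemma exists_abs_posteriorMean_sub_le {K L M P₀ P₁ r : ℝ} (hK : 1 ≤ K) (hL : 0 ≤ L) (hM : 0 < M)
    (hP₀ : 0 < P₀) (hP₁ : 0 < P₁) (hr : 0 < r) :
    ∃ A s₀ : ℝ, 0 < A ∧ 0 < s₀ ∧ ∀ {eMin eMax qMin qMax a b c s : ℝ} {W : ℝ → ℝ → ℝ}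
      {p : ℝ → ℝ} {q e₀ : ℝ}, SlowRegime eMin eMax qMin qMax a b K L M P₀ P₁ s W p →
      IsInner a b c W q e₀ → IsRadius K L c r → s ≤ s₀ →
      0 < outputDensity W p q ∧
      |(∫ e, cdf p e * (W q e / outputDensity W p q) * p e) - cdf p e₀| ≤ A * s := by
  have hK0 : 0 < K := by linarith
  have hΓ := tailConst_nonneg hK
  obtain ⟨A', s', hA', hs', hf⟩ := exists_logNear_outputDensity hK hL hM hP₀ hr
  set C₁ := K / (r / K) ^ 3 * (Real.exp 1 * (M / P₀)) with hC₁
  have hC₁0 : 0 < C₁ := by positivity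
  set E := Real.exp (5 * K * L * r + 1) with hE
  refine ⟨P₁ * K * E * tailConst K + C₁, min s' (min 1 (1 / A')), by positivity,
    by positivity, ?_⟩
  intro eMin eMax qMin qMax a b c s W p q e₀ h hi hrad hs
  have hs0 := h.pos
  have hs1 : s ≤ 1 := hs.trans ((min_le_right _ _).trans (min_le_left _ _))
  have hsA : A' * s ≤ 1 := by
    have h1 : s ≤ 1 / A' := hs.trans ((min_le_right _ _).trans (min_le_right _ _))
    rwa [le_div_iff₀ hA', mul_comm] at h1
  have hfθ := hf h hi hrad (hs.trans (min_le_left _ _))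
  have hθ0 := h.outputScale_pos hi.mem
  have hθ := h.le_outputScale hi.mem
  have heI := h.mem_Ioo hi.mem
  have hf0 := hfθ.pos hθ0
  refine ⟨hf0, ?_⟩
  set θ := p e₀ / deriv (condMean W) e₀ with hθdef
  set f := outputDensity W p q with hfdef
  set N := nearSet W a b q (r / s) with hN
  have hm : MeasurableSet N := h.measurableSet_nearSet q (r / s)
  have hp := h.input.isDensityOn
  have hsec0 := h.isBoundedPair.integrable_section q
  have hsec : Integrable fun e => W q e / f * p e := by
    refine (hsec0.div_const f).congr (Filter.Eventually.of_forall fun e => ?_)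
    simp only
    ring
  have hnn : ∀ e, 0 ≤ W q e / f * p e := fun e => by
    rw [div_mul_eq_mul_div]
    exact div_nonneg (h.isBoundedPair.joint_nonneg q e) hf0.le
  have hone : ∫ e, W q e / f * p e = 1 := by
    simp only [div_mul_eq_mul_div]
    rw [integral_div]
    exact div_self hf0.ne'
  have hint : Integrable fun e => (cdf p e - cdf p e₀) * (W q e / f * p e) := by
    refine hsec.bdd_mul (c := 1)
      (hp.continuous_cdf.sub continuous_const).aestronglyMeasurable
      (Filter.Eventually.of_forall fun e => ?_)
    rw [Real.norm_eq_abs, abs_le]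
    constructor <;>
      linarith [hp.cdf_nonneg e, hp.cdf_nonneg e₀, hp.cdf_le_one e, hp.cdf_le_one e₀]
  have hdiff : (∫ e, cdf p e * (W q e / f) * p e) - cdf p e₀ =
      ∫ e, (cdf p e - cdf p e₀) * (W q e / f * p e) := by
    have h1 : ∀ e, cdf p e * (W q e / f) * p e =
        (cdf p e - cdf p e₀) * (W q e / f * p e) + cdf p e₀ * (W q e / f * p e) := fun e => by
      ring
    simp only [h1]
    rw [integral_add hint (hsec.const_mul _), integral_const_mul, hone]
    ring
  -- With comparison function `0` the estimate bounds the near integral itself: the Lipschitz bound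
  -- on `cdf p` supplies the factor `s |z|`.
  have hnear := h.abs_setIntegral_nearSet_sub_le hi hrad
    (F := fun e => (cdf p e - cdf p e₀) * (W q e / f * p e)) (G := fun _ => 0)
    (D := P₁ * K * E * s) (by positivity) hint.integrableOn (integrable_zero _ _ _) fun e he => by
      have hsl := h.stdSlope_pos he.1 (h.KL_abs_sub_mean_le hrad he)
      have hφ0 := h.shape_nonneg heI (stdCoord W q e)
      have hz := h.mul_abs_stdCoord_le he
      have h1 := (h.logNear_joint hi hrad he).div hfθ (by positivity) hθ0
      rw [mul_div_cancel_left₀ _ hθ0.ne', mul_div_right_comm] at h1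
      have h2 : W q e / f * p e ≤ E * (stdSlope W q e * shape W (stdCoord W q e) e₀) := by
        refine h1.2.trans ?_
        rw [hE]
        have hL := h.nonneg
        gcongr
      have h3 : |cdf p e - cdf p e₀| ≤ P₁ * (K * (s * |stdCoord W q e|)) :=
        (h.abs_cdf_input_sub_le hi.mem he.1).trans (by
          gcongr
          exact h.abs_sub_center_le hi he.1)
      rw [mul_zero, sub_zero, abs_mul, abs_of_nonneg (hnn e)]
      have h4 := one_add_abs_mul_le_errWeight (h.shape_nonneg heI) (stdCoord W q e)
      calc _ ≤ P₁ * (K * (s * (1 + |stdCoord W q e|))) *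
            (E * (stdSlope W q e * shape W (stdCoord W q e) e₀)) := by
            refine mul_le_mul (h3.trans ?_) h2 (hnn e) (by positivity)
            gcongr
            linarith
        _ = P₁ * K * E * s *
            (stdSlope W q e * ((1 + |stdCoord W q e|) * shape W (stdCoord W q e) e₀)) := by ring
        _ ≤ _ := by gcongr
  rw [integral_zero, sub_zero] at hnear
  have hfar : |∫ e in Nᶜ, (cdf p e - cdf p e₀) * (W q e / f * p e)| ≤ C₁ * s := by
    have hflow : Real.exp (-1) * (P₀ / M) ≤ f := by
      refine le_trans ?_ hfθ.1
      gcongr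
    have h5 := h.setIntegral_joint_le_of_far (q := q) (div_pos hr hK0) hm.compl
      (fun e he heI => h.le_abs_sub_of_notMem_nearSet hi hrad heI he)
    calc _ ≤ ∫ e in Nᶜ, |(cdf p e - cdf p e₀) * (W q e / f * p e)| :=
          abs_integral_le_integral_abs
      _ ≤ ∫ e in Nᶜ, W q e / f * p e := by
          refine setIntegral_mono hint.abs.integrableOn hsec.integrableOn fun e => ?_
          simp only
          rw [abs_mul, abs_of_nonneg (hnn e)]
          refine mul_le_of_le_one_left (hnn e) ?_
          rw [abs_le]
          constructor <;>
            linarith [hp.cdf_nonneg e, hp.cdf_nonneg e₀, hp.cdf_le_one e, hp.cdf_le_one e₀]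
      _ = (∫ e in Nᶜ, W q e * p e) / f := by
          rw [← integral_div]
          simp only [div_mul_eq_mul_div]
      _ ≤ C₁ * s := by
          rw [div_le_iff₀ hf0]
          calc _ ≤ K * s ^ 2 / (r / K) ^ 3 := h5
            _ = C₁ * (s * s) * (Real.exp (-1) * (P₀ / M)) := by
                rw [hC₁, Real.exp_neg]
                field_simp
            _ ≤ C₁ * (s * 1) * f := by gcongr
            _ = _ := by ring
  rw [hdiff, ← integral_add_compl hm hint]
  refine (abs_add_le _ _).trans ?_
  linarith

/-! ### Uniform constants and central quantiles. -/

lemma IsCapacityAchieving.capacity_eq {eMin eMax : ℝ} {W : ℝ → ℝ → ℝ} {p : ℝ → ℝ}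
    (hp : IsCapacityAchieving eMin eMax W p) : capacity eMin eMax W = mutualInfo W p := by
  refine IsGreatest.csSup_eq ⟨⟨p, hp.1, rfl⟩, ?_⟩
  rintro _ ⟨p', hp', rfl⟩
  exact hp.2 p' hp'

/-- In a slow-change regime `K ≥ 1` and `σ_max > 0`. -/
lemma IsSlowChange.one_le_and_maxSD_pos {eMin eMax qMin qMax a b K L : ℝ} {W : ℝ → ℝ → ℝ}
    {p : ℝ → ℝ} (h : IsSlowChange eMin eMax qMin qMax a b K L W p)
    (hW : IsChannel eMin eMax qMin qMax W) {e : ℝ} (he : e ∈ Ioo eMin eMax) :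
    1 ≤ K ∧ 0 < maxSD eMin eMax W := by
  have h1 := hW.condSD_pos he
  have h2 := hW.condSD_le_maxSD he
  have h3 := h.sd_comparable e he
  refine ⟨?_, h1.trans_le h2⟩
  refine le_of_mul_le_mul_right ?_ h1
  rw [one_mul]
  exact h2.trans h3

/-- On `[a, b]` each of `m'` and `p` varies by at most the factor `exp (L (b - a))`, so bounds on
integrals become pointwise bounds. The rise of `m` is at most `qMax - qMin`, and the mass of `p`
lies between `2 δ` and `1`. -/
lemma IsSlowChange.slowRegime {eMin eMax qMin qMax a b K L δ : ℝ} {W : ℝ → ℝ → ℝ} {p : ℝ → ℝ}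
    (h : IsSlowChange eMin eMax qMin qMax a b K L W p) (hW : IsChannel eMin eMax qMin qMax W)
    (hp : IsInputDensity eMin eMax p) (ha : eMin < a) (hab : a < b) (hb : b < eMax)
    (hL : 0 ≤ L) (hδ : 0 < δ) (hF : 2 * δ ≤ cdf p b - cdf p a) :
    SlowRegime eMin eMax qMin qMax a b K L
      (Real.exp (L * (b - a)) * (qMax - qMin) / (b - a))
      (2 * δ / (Real.exp (L * (b - a)) * (b - a))) (Real.exp (L * (b - a)) / (b - a))
      (maxSD eMin eMax W) W p := by
  have hba : 0 < b - a := sub_pos.2 hab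
  set Λ := Real.exp (L * (b - a)) with hΛ
  have hΛ0 : 0 < Λ := Real.exp_pos _
  have hmem : ∀ e ∈ Icc a b, e ∈ Ioo eMin eMax := fun e he =>
    ⟨ha.trans_le he.1, he.2.trans_lt hb⟩
  have hd : ∀ e ∈ Icc a b, ∀ e' ∈ Icc a b, Real.exp (L * |e - e'|) ≤ Λ := fun e he e' he' => by
    have : |e - e'| ≤ b - a := by
      rw [abs_le]
      constructor <;> linarith [he.1, he.2, he'.1, he'.2]
    rw [hΛ]
    gcongr
  have hpΛ : ∀ e ∈ Icc a b, ∀ e' ∈ Icc a b, p e ≤ Λ * p e' := fun e he e' he' =>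
    (h.input_slow e he e' he').trans (mul_le_mul_of_nonneg_right (hd e he e' he') (hp.nonneg e'))
  have hpd := hp.isDensityOn
  have hK1 := h.one_le_and_maxSD_pos hW (hmem a (left_mem_Icc.2 hab.le))
  have hvol : (volume : Measure ℝ).real (Icc a b) = b - a := by
    rw [Real.volume_real_Icc, max_eq_left hba.le]
  refine ⟨hW, hp, h, ha, hab, hb, hK1.1, hL, rfl, hK1.2, fun e he => ?_, by positivity,
    fun e he => ?_, fun e he => ?_⟩
  · have h1 : ∀ x ∈ interior (Icc a b), deriv (condMean W) e / Λ ≤ deriv (condMean W) x :=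
      fun x hx => by
        have hx' := interior_subset hx
        rw [div_le_iff₀ hΛ0, mul_comm]
        refine (h.mean_deriv_slow e he x hx').trans (mul_le_mul_of_nonneg_right (hd e he x hx') ?_)
        exact le_trans (by have := hK1.1; positivity) (h.mean_deriv_ge x hx')
    have h2 := (convex_Icc a b).mul_sub_le_image_sub_of_le_deriv
      (fun x hx => (h.mean_diff x hx).continuousAt.continuousWithinAt)
      (fun x hx => (h.mean_diff x (interior_subset hx)).differentiableWithinAt) h1
      a (left_mem_Icc.2 hab.le) b (right_mem_Icc.2 hab.le) hab.le
    have h3 := (hW.condMean_mem (hmem a (left_mem_Icc.2 hab.le))).1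
    have h4 := (hW.condMean_mem (hmem b (right_mem_Icc.2 hab.le))).2
    rw [le_div_iff₀ hba]
    rw [div_mul_eq_mul_div, div_le_iff₀ hΛ0] at h2
    refine h2.trans ?_
    rw [mul_comm]
    gcongr
  · rw [div_le_iff₀ (by positivity)]
    have h1 : cdf p b - cdf p a ≤ Λ * p e * (b - a) := by
      rw [hpd.cdf_sub, intervalIntegral.integral_of_le hab.le]
      calc ∫ t in Ioc a b, p t ≤ ∫ _ in Ioc a b, Λ * p e :=
            setIntegral_mono_on hpd.integrable.integrableOn (integrableOn_const (by simp))
              measurableSet_Ioc fun x hx => hpΛ x (Ioc_subset_Icc_self hx) e he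
        _ = Λ * p e * (b - a) := by
            rw [setIntegral_const, Real.volume_real_Ioc, max_eq_left hba.le, smul_eq_mul, mul_comm]
    linarith
  · rw [le_div_iff₀ hba]
    have h1 : (b - a) * (p e / Λ) ≤ 1 := by
      calc (b - a) * (p e / Λ) = ∫ _ in Icc a b, p e / Λ := by
            rw [setIntegral_const, hvol, smul_eq_mul]
        _ ≤ ∫ t in Icc a b, p t :=
            setIntegral_mono_on (integrableOn_const (by simp)) hpd.integrable.integrableOn
              measurableSet_Icc fun x hx => by
                rw [div_le_iff₀ hΛ0, mul_comm]
                exact hpΛ e he x hx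
        _ ≤ 1 := hpd.setIntegral_le_one _
    rw [← mul_div_assoc, div_le_one hΛ0] at h1
    linarith

/-- Central quantiles of `Q` are inner points. -/
lemma SlowRegime.exists_isInner_quantile
    {eMin eMax qMin qMax a b K L M P₀ P₁ s c₀ δ : ℝ} {W : ℝ → ℝ → ℝ} {p : ℝ → ℝ}
    (h : SlowRegime eMin eMax qMin qMax a b K L M P₀ P₁ s W p) (hδ : 0 < δ) (hc₀ : 0 < c₀)
    (hc₀b : c₀ ≤ b - a) (hc₀P : P₁ * c₀ ≤ δ / 2) (hs : s ≤ c₀ / (2 * K) * min 1 (δ / 4))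
    {qs : ℝ} (hqs : qs ∈ Icc (cdf p a + δ) (cdf p b - δ)) :
    qs ∈ Ioo (0 : ℝ) 1 ∧
      ∃ e₀, IsInner a b (c₀ / (2 * K)) W (quantile (outputDensity W p) qs) e₀ := by
  have hp := h.input.isDensityOn
  have hf := h.isBoundedPair.isDensityOn_output
  have hK := h.K_pos
  have ha := left_mem_Icc.2 h.lt.le
  have hb := right_mem_Icc.2 h.lt.le
  have hqs01 : qs ∈ Ioo (0 : ℝ) 1 := by
    constructor
    · linarith [hp.cdf_nonneg a, hqs.1]
    · linarith [hp.cdf_le_one b, hqs.2]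
  refine ⟨hqs01, ?_⟩
  set η := c₀ / (2 * K) with hη
  have hη0 : 0 < η := by positivity
  have hηK : c₀ / K = 2 * η := by rw [hη]; field_simp
  have hs0 := h.pos
  -- Moving in by `c₀` from an endpoint costs at most `δ / 2` of mass and moves the mean by at least
  -- `2 η`. Chebyshev at distance `η` costs another `δ / 4`, so the margin `δ` of `qs` is not used
  -- up and the quantile stays `η` inside.
  have hsη : s ^ 2 / η ^ 2 ≤ δ / 4 := by
    have h1 : s / η ≤ min 1 (δ / 4) := by rwa [div_le_iff₀ hη0, mul_comm]
    have h0 : 0 ≤ s / η := by positivity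
    rw [← div_pow, sq]
    calc s / η * (s / η) ≤ 1 * (δ / 4) :=
          mul_le_mul (h1.trans (min_le_left _ _)) (h1.trans (min_le_right _ _)) h0 zero_le_one
      _ = δ / 4 := one_mul _
  have ha₁ : a + c₀ ∈ Icc a b := ⟨by linarith, by linarith⟩
  have hb₁ : b - c₀ ∈ Icc a b := ⟨by linarith, by linarith⟩
  have hFa : cdf p (a + c₀) - cdf p a ≤ δ / 2 := by
    have := (le_abs_self _).trans (h.abs_cdf_input_sub_le ha ha₁)
    rw [add_sub_cancel_left, abs_of_pos hc₀] at this
    exact this.trans hc₀P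
  have hFb : cdf p b - cdf p (b - c₀) ≤ δ / 2 := by
    have := (le_abs_self _).trans (h.abs_cdf_input_sub_le hb₁ hb)
    rw [sub_sub_cancel, abs_of_pos hc₀] at this
    exact this.trans hc₀P
  have hma : 2 * η ≤ condMean W (a + c₀) - condMean W a := by
    have := h.sub_le_mul_mean_sub ha ha₁ ha₁.1
    rw [add_sub_cancel_left] at this
    rwa [← hηK, div_le_iff₀ hK, mul_comm]
  have hmb : 2 * η ≤ condMean W b - condMean W (b - c₀) := by
    have := h.sub_le_mul_mean_sub hb₁ hb hb₁.2
    rw [sub_sub_cancel] at this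
    rwa [← hηK, div_le_iff₀ hK, mul_comm]
  have hlow := h.cdf_output_le (h.mem_Ioo ha₁) hη0
  have hup := h.le_cdf_output (h.mem_Ioo hb₁) hη0
  refine h.exists_isInner hη0.le ?_ ?_
  · have h1 : ¬ quantile (outputDensity W p) qs ≤ condMean W (a + c₀) - η := by
      rw [hf.quantile_le_iff hqs01]
      linarith [hqs.1]
    linarith [not_le.1 h1]
  · have h1 : quantile (outputDensity W p) qs ≤ condMean W (b - c₀) + η := by
      rw [hf.quantile_le_iff hqs01]
      linarith [hqs.2]
    linarith

end EnvChannel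

theorem corollary4 (eMin eMax qMin qMax a b K L δ : ℝ)
    (ha : eMin < a) (hab : a < b) (hb : b < eMax) (hK : 0 < K) (hL : 0 ≤ L) (hδ : 0 < δ) :
    ∃ A σ₀ : ℝ, 0 < A ∧ 0 < σ₀ ∧ ∀ (W : ℝ → ℝ → ℝ) (p : ℝ → ℝ),
      EnvChannel.IsChannel eMin eMax qMin qMax W →
      EnvChannel.IsCapacityAchieving eMin eMax W p →
      EnvChannel.IsSlowChange eMin eMax qMin qMax a b K L W p →
      EnvChannel.maxSD eMin eMax W ≤ σ₀ →
      (∀ qs ∈ Set.Icc (EnvChannel.cdf p a + δ) (EnvChannel.cdf p b - δ),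
        |EnvChannel.starMean W p qs - qs| ≤ A * EnvChannel.maxSD eMin eMax W) ∧
      (∀ qs ∈ Set.Icc (EnvChannel.cdf p a + δ) (EnvChannel.cdf p b - δ),
        |EnvChannel.starEntropy W p qs - -EnvChannel.capacity eMin eMax W| ≤
          A * EnvChannel.maxSD eMin eMax W) ∧
      (∀ qs ∈ Set.Icc (EnvChannel.cdf p a + δ) (EnvChannel.cdf p b - δ),
        ∀ qs' ∈ Set.Icc (EnvChannel.cdf p a + δ) (EnvChannel.cdf p b - δ),
        |EnvChannel.starEntropy W p qs - EnvChannel.starEntropy W p qs'| ≤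
          A * EnvChannel.maxSD eMin eMax W) := by
  have haI : a ∈ Ioo eMin eMax := ⟨ha, hab.trans hb⟩
  by_cases hKq : 1 ≤ K ∧ qMin < qMax
  swap
  -- If `K < 1` or the range of `Q` is empty, no channel satisfies the hypotheses.
  · refine ⟨1, 1, one_pos, one_pos, fun W p hW _ hslow _ => ?_⟩
    exact absurd ⟨(hslow.one_le_and_maxSD_pos hW haI).1, (hW.isDensityOn haI).lt⟩ hKq
  obtain ⟨hK1, hq⟩ := hKq
  have hba : 0 < b - a := sub_pos.2 hab
  have hR : 0 < qMax - qMin := sub_pos.2 hq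
  set Λ := Real.exp (L * (b - a)) with hΛ
  have hΛ0 : 0 < Λ := Real.exp_pos _
  set M := Λ * (qMax - qMin) / (b - a) with hM
  set P₀ := 2 * δ / (Λ * (b - a)) with hP₀
  set P₁ := Λ / (b - a) with hP₁
  have hM0 : 0 < M := by positivity
  have hP₀0 : 0 < P₀ := by positivity
  have hP₁0 : 0 < P₁ := by positivity
  -- Since `p ≤ P₁` on `[a, b]`, an interval of length `c₀` there carries mass at most `δ / 2`.
  set c₀ := min (b - a) (δ / 2 / P₁) with hc₀
  have hc₀0 : 0 < c₀ := by positivity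
  have hc₀b : c₀ ≤ b - a := min_le_left _ _
  have hc₀P : P₁ * c₀ ≤ δ / 2 := by
    have := min_le_right (b - a) (δ / 2 / P₁)
    rwa [← hc₀, le_div_iff₀ hP₁0, mul_comm] at this
  set c := c₀ / (2 * K) with hc
  have hc0 : 0 < c := by positivity
  -- The radius is adapted to `c / 2` because the capacity estimate also evaluates the output
  -- density at points displaced by up to `c / 2`.
  obtain ⟨r, hrad⟩ := EnvChannel.exists_isRadius hK1 hL (half_pos hc0)
  have hrad' : EnvChannel.IsRadius K L c r :=
    ⟨hrad.pos, hrad.mul_lt.trans (half_lt_self hc0), hrad.slope⟩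
  obtain ⟨A₁, s₁, hA₁, hs₁, hpost⟩ :=
    EnvChannel.exists_abs_posterior_sub_le hK1 hL hM0 hP₀0 hP₁0 hrad.pos
  obtain ⟨A₂, s₂, hA₂, hs₂, hcapa⟩ :=
    EnvChannel.exists_abs_capacity_sub_le hK1 hL hM0 hP₀0 hP₁0 hc0 hq hrad
  obtain ⟨A₃, s₃, hA₃, hs₃, hmean⟩ :=
    EnvChannel.exists_abs_posteriorMean_sub_le hK1 hL hM0 hP₀0 hP₁0 hrad.pos
  have hlog2 : 0 < Real.log 2 := Real.log_pos one_lt_two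
  set B₁ := A₃ + 2 * P₁ * (K * Real.pi) + 1 / c ^ 2 with hB₁
  set B₂ := (A₁ + A₂) / Real.log 2 with hB₂
  have hB₁0 : 0 < B₁ := by positivity
  have hB₂0 : 0 < B₂ := by positivity
  refine ⟨B₁ + 2 * B₂, min (min s₁ s₂) (min s₃ (min 1 (c * min 1 (δ / 4)))), by positivity,
    by positivity, ?_⟩
  intro W p hW hcap hslow hs
  set s := EnvChannel.maxSD eMin eMax W with hsdef
  have hs0 : 0 < s := (hslow.one_le_and_maxSD_pos hW haI).2
  have hle₁ : s ≤ s₁ := hs.trans ((min_le_left _ _).trans (min_le_left _ _))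
  have hle₂ : s ≤ s₂ := hs.trans ((min_le_left _ _).trans (min_le_right _ _))
  have hle₃ : s ≤ s₃ := hs.trans ((min_le_right _ _).trans (min_le_left _ _))
  have hle' : s ≤ min 1 (c * min 1 (δ / 4)) :=
    hs.trans ((min_le_right _ _).trans (min_le_right _ _))
  have hle1 : s ≤ 1 := hle'.trans (min_le_left _ _)
  have hlec : s ≤ c * min 1 (δ / 4) := hle'.trans (min_le_right _ _)
  have main : ∀ qs ∈ Icc (EnvChannel.cdf p a + δ) (EnvChannel.cdf p b - δ),
      |EnvChannel.starMean W p qs - qs| ≤ B₁ * s ∧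
      |EnvChannel.starEntropy W p qs - -EnvChannel.capacity eMin eMax W| ≤ B₂ * s := by
    intro qs hqs
    -- The existence of `qs` forces `F_E(b) - F_E(a) ≥ 2 δ`, the source of the lower bound on `p`;
    -- otherwise there is nothing to prove.
    have h := hslow.slowRegime hW hcap.1 ha hab hb hL hδ (by linarith [hqs.1, hqs.2])
    obtain ⟨hqs01, e₀, hi⟩ :=
      h.exists_isInner_quantile hδ hc₀0 hc₀b hc₀P hlec hqs
    have hbp := h.isBoundedPair
    obtain ⟨hf0, hmn⟩ := hmean h hi hrad' hle₃
    have hps := hpost h hi hrad' hle₁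
    have hcp := hcapa h hcap hi hle₂
    constructor
    · rw [hbp.starMean_eq hqs01 rfl hf0]
      have h1 := h.abs_cdf_output_sub_le hi hc0
      rw [hbp.isDensityOn_output.cdf_quantile hqs01, abs_sub_comm] at h1
      have h2 : s ^ 2 / c ^ 2 ≤ 1 / c ^ 2 * s := by
        rw [div_mul_eq_mul_div, one_mul]
        gcongr
        nlinarith
      calc _ ≤ A₃ * s + (2 * P₁ * (s * K * Real.pi) + s ^ 2 / c ^ 2) :=
            (abs_sub_le _ _ _).trans (add_le_add hmn h1)
        _ ≤ A₃ * s + (2 * P₁ * (s * K * Real.pi) + 1 / c ^ 2 * s) := by gcongr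
        _ = B₁ * s := by rw [hB₁]; ring
    · rw [hcap.capacity_eq]
      have h1 := hbp.log_two_mul_starEntropy hqs01 rfl hf0
      rw [hB₂, div_mul_eq_mul_div, le_div_iff₀ hlog2, ← abs_of_pos hlog2, ← abs_mul]
      have h3 := abs_le.1 hps
      have h4 := abs_le.1 hcp
      rw [abs_le]
      -- The terms `log κ` and `J` are common to the posterior and capacity estimates and cancel.
      constructor <;> linarith [h3.1, h3.2, h4.1, h4.2]
  have hB₁s : 0 ≤ B₁ * s := by positivity
  have hB₂s : 0 ≤ B₂ * s := by positivity
  refine ⟨fun qs hqs => ?_, fun qs hqs => ?_, fun qs hqs qs' hqs' => ?_⟩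
  · linarith [(main qs hqs).1]
  · linarith [(main qs hqs).2]
  · have h1 := (main qs hqs).2
    have h2 := (main qs' hqs').2
    rw [abs_sub_comm] at h2
    have h3 := (abs_sub_le _ _ _).trans (add_le_add h1 h2)
    linarith
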